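/- **Proposition 3.5.** Let $U$ be a utility function satisfying the following assumptions. (i) $U\in C^7(0,\infty)$ is strictly increasing and strictly concave, with $U'(0+)=\infty$, $U'(\infty)=0$ and asymptotic elasticity $\limsup_{x\to\infty} xU'(x)/U(x)<1$. (ii) $U(0+)=0$ (and $U(0):=0$). (iii) The risk tolerance $R(x):=-U'(x)/U''(x)$ is well defined and strictly increasing on $(0,\infty)$, satisfies $R(0):=R(0+)=0$ and $R'(0)<\infty$ (it is enough that $R(x)/x$ is bounded above near $0$), and there is a constant $K$ with $|\partial_x^{i}(R^i)(x)|\le K$ for all $x>0$ and $2\le i\le 5$. (iv) The inverse marginal utility $I=(U')^{-1}:(0,\infty)\to(0,\infty)$ satisfies $I(y)\le\alpha+\kappa y^{-\alpha}$ for all $y>0$, for some $\alpha>0$ and some constant $\kappa$. Let $T>0$, let $W$ be a standard Brownian motion with respect to a filtration $(\mathcal F_s)$ on a probability space, and let $\mu,\sigma:\mathbb R\to\mathbb R$ with $\sigma>0$; put $\lambda(z)=\mu(z)/\sigma(z)$. For $0\le t<T$, $x>0$ and $z\in\mathbb R$ let $M(t,x;\lambda(z))$ be the Merton value function with frozen coefficients,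 $$M(t,x;\lambda(z))=\sup_\pi \mathbb E\,[U(X^\pi_T)],\qquad dX^\pi_s=\pi_s\mu(z)\,ds+\pi_s\sigma(z)\,dW_s,\quad X^\pi_t=x,$$ the supremum being over progressively measurable $\pi$ with $\int_t^T\pi_s^2\,ds<\infty$ a.s. and $X^\pi_s\ge 0$ for all $s\in[t,T]$ a.s. Let $$R(t,x;\lambda(z))=-\frac{M_x(t,x;\lambda(z))}{M_{xx}(t,x;\lambda(z))}.$$ Then, for all $t\in[0,T)$ and $z\in\mathbb R$, $M(t,\cdot;\lambda(z))$ is $C^2$ on $(0,\infty)$ with $M_{xx}<0$, $R(t,\cdot;\lambda(z))$ is $C^5$ on $(0,\infty)$, and: 1. there are constants $K_j>0$, $0\le j\le 4$, such that for all $(t,x,z)\in[0,T)\times(0,\infty)\times\mathbb R$ $$\bigl|R^j(t,x;\lambda(z))\,\partial_x^{j+1}R(t,x;\lambda(z))\bigr|\le K_j,\qquad 0\le j\le 4,$$ and moreover $R(t,x;\lambda(z))\le K_0\,x$; 2. (equivalent form of the first bounds) there are constants $\widetilde K_j>0$, $1\le j\le5$, such that for all $(t,x,z)\in[0,T)\times(0,\infty)\times\mathbb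 R$ $$\bigl|\partial_x^{j}\bigl(R^j(t,x;\lambda(z))\bigr)\bigr|\le\widetilde K_j,\qquad 1\le j\le 5.$$ -/

import Mathlib

open MeasureTheory ProbabilityTheory Set Filter Topology
open scoped NNReal ENNReal

noncomputable section

/-! ### Utility functions -/

/-- The risk tolerance `R = -U'/U''` of a utility function `U`. -/
def riskTolerance (U : ℝ → ℝ) (x : ℝ) : ℝ :=
  -(deriv U x / iteratedDeriv 2 U x)

/-- The inverse `I = (U')⁻¹ : (0,∞) → (0,∞)` of the marginal utility. -/
def inverseMarginal (U : ℝ → ℝ) (y : ℝ) : ℝ :=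
  Function.invFunOn (deriv U) (Ioi 0) y

/-- The standing assumptions on the utility function. Only the values of `U` on `[0,∞)` matter.
`U''` has no zero on `(0,∞)` as a consequence of `tolerance_strictMono` and `tolerance_zero`
(at a zero of `U''` the quotient `riskTolerance U` would take the value `0`). -/
structure IsAdmissibleUtility (U : ℝ → ℝ) : Prop where
  contDiffOn : ContDiffOn ℝ 7 U (Ioi 0)
  strictMonoOn : StrictMonoOn U (Ioi 0)
  strictConcaveOn : StrictConcaveOn ℝ (Ioi 0) U
  /-- Inada condition `U'(0+) = ∞`. -/
  inada_zero : Tendsto (deriv U) (𝓝[>] 0) atTop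
  /-- Inada condition `U'(∞) = 0`. -/
  inada_top : Tendsto (deriv U) atTop (𝓝 0)
  /-- Asymptotic elasticity: `limsup_{x → ∞} x U'(x) / U(x) < 1`. -/
  asymptotic_elasticity : ∃ a < 1, ∀ᶠ x in atTop, x * deriv U x / U x ≤ a
  /-- `U(0+) = 0`, and `U` is extended to `0` by this limit. -/
  tendsto_zero : Tendsto U (𝓝[>] 0) (𝓝 0)
  map_zero : U 0 = 0
  /-- `R(0) = 0`. -/
  tolerance_zero : Tendsto (riskTolerance U) (𝓝[>] 0) (𝓝 0)
  tolerance_strictMono : StrictMonoOn (riskTolerance U) (Ioi 0)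
  /-- `R'(0) < ∞`: as `R(0) = 0`, the difference quotients of `R` at `0` are `R(x)/x`, and only
  an upper bound on them is required. (At `x > 0` finiteness of `R'(x)` is automatic.) -/
  tolerance_deriv_zero : ∃ C : ℝ, ∀ᶠ x in 𝓝[>] 0, riskTolerance U x / x ≤ C
  /-- `|∂ₓⁱ (Rⁱ)| ≤ K` for `2 ≤ i ≤ 5`. -/
  tolerance_bound : ∃ K : ℝ, ∀ i : ℕ, 2 ≤ i → i ≤ 5 → ∀ x : ℝ, 0 < x →
    |iteratedDeriv i (fun y => riskTolerance U y ^ i) x| ≤ K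
  /-- Polynomial growth of the inverse marginal utility. -/
  inverseMarginal_growth : ∃ α κ : ℝ, 0 < α ∧ ∀ y : ℝ, 0 < y →
    inverseMarginal U y ≤ α + κ * y ^ (-α)

/-! ### Brownian motion with respect to a filtration, and the Itô integral -/

variable {Ω : Type*} {mΩ : MeasurableSpace Ω}

/-- `W` is a standard Brownian motion with respect to the filtration `ℱ` under `P`. -/
structure IsFiltrationBrownian (W : ℝ≥0 → Ω → ℝ) (ℱ : Filtration ℝ≥0 mΩ) (P : Measure Ω) :
    Prop where
  isBrownian : IsBrownianReal W P
  continuous_paths : ∀ ω, Continuous fun s => W s ω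
  adapted : Adapted ℱ W
  indep_increment : ∀ s r : ℝ≥0, s ≤ r →
    Indep (MeasurableSpace.comap (W r - W s) inferInstance) (ℱ s) P

/-- Simple integrands `∑_{k < n} ξ_k 1_{(s_k, s_{k+1}]}` with `s_0 ≤ s_1 ≤ ⋯` deterministic and
`ξ_k` bounded and `ℱ_{s_k}`-measurable. -/
structure SimpleIntegrand (ℱ : Filtration ℝ≥0 mΩ) where
  n : ℕ
  time : ℕ → ℝ≥0
  mono : Monotone time
  val : ℕ → Ω → ℝ
  measurable_val : ∀ k, Measurable[ℱ (time k)] (val k)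
  bounded_val : ∃ C : ℝ, ∀ k ω, |val k ω| ≤ C

/-- The process `∑_{k < n} ξ_k 1_{(s_k, s_{k+1}]}`. -/
def SimpleIntegrand.process {ℱ : Filtration ℝ≥0 mΩ} (ψ : SimpleIntegrand ℱ) (u : ℝ≥0) (ω : Ω) :
    ℝ :=
  ∑ k ∈ Finset.range ψ.n, (Ioc (ψ.time k) (ψ.time (k + 1))).indicator (fun _ => ψ.val k ω) u

/-- The elementary stochastic integral
`∫₀ˢ ψ dW = ∑_{k < n} ξ_k (W_{s_{k+1} ∧ s} - W_{s_k ∧ s})`. -/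
def SimpleIntegrand.integral {ℱ : Filtration ℝ≥0 mΩ} (ψ : SimpleIntegrand ℱ) (W : ℝ≥0 → Ω → ℝ)
    (s : ℝ≥0) (ω : Ω) : ℝ :=
  ∑ k ∈ Finset.range ψ.n,
    ψ.val k ω * (W (min (ψ.time (k + 1)) s) ω - W (min (ψ.time k) s) ω)

/-- `J` is (a version of) the Itô integral process `J_s = ∫_t^s φ dW`, `t ≤ s ≤ T`: there are simple
integrands `ψ_n` living on `(t,∞)` such that `∫_t^T |ψ_n - φ|² du → 0` in probability and
`sup_{t ≤ s ≤ T} |∫_t^s ψ_n dW - J_s| → 0` in probability. -/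
def IsItoIntegral (W : ℝ≥0 → Ω → ℝ) (ℱ : Filtration ℝ≥0 mΩ) (P : Measure Ω) (t T : ℝ≥0)
    (φ J : ℝ≥0 → Ω → ℝ) : Prop :=
  ∃ ψ : ℕ → SimpleIntegrand ℱ,
    (∀ n, t ≤ (ψ n).time 0) ∧
    (∀ ε : ℝ≥0∞, 0 < ε → Tendsto (fun n => P {ω | ε ≤ ∫⁻ u in Icc (t : ℝ) T,
      ENNReal.ofReal (((ψ n).process u.toNNReal ω - φ u.toNNReal ω) ^ 2)}) atTop (𝓝 0)) ∧
    (∀ ε : ℝ, 0 < ε → Tendsto (fun n => P {ω | ∃ s ∈ Icc t T,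
      ε ≤ |(ψ n).integral W s ω - J s ω|}) atTop (𝓝 0))

/-! ### The Merton problem with constant coefficients -/

/-- `π` is an admissible strategy (amount of money held in the stock) on `[t,T]` from initial
wealth `x`, with wealth process `X`:
`dX_s = π_s μ ds + π_s σ dW_s`, `X_t = x`, and `X_s ≥ 0` for `t ≤ s ≤ T`. -/
structure IsAdmissibleStrategy (W : ℝ≥0 → Ω → ℝ) (ℱ : Filtration ℝ≥0 mΩ) (P : Measure Ω)
    (T : ℝ≥0) (μ σ : ℝ) (t : ℝ≥0) (x : ℝ) (π X : ℝ≥0 → Ω → ℝ) : Prop where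
  progressive : IsStronglyProgressive ℱ π
  sq_integrable : ∀ᵐ ω ∂P, IntegrableOn (fun u : ℝ => π u.toNNReal ω ^ 2) (Icc (t : ℝ) T)
  wealth_eq : ∃ J : ℝ≥0 → Ω → ℝ, IsItoIntegral W ℱ P t T (fun s ω => π s ω * σ) J ∧
    ∀ᵐ ω ∂P, ∀ s ∈ Icc t T,
      X s ω = x + (∫ u in (t : ℝ)..s, π u.toNNReal ω * μ) + J s ω
  nonneg : ∀ᵐ ω ∂P, ∀ s ∈ Icc t T, 0 ≤ X s ω

/-- The Merton value function: the supremum of `E[U(X_T)]` over all admissible strategies started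
from wealth `x` at time `t`, for a stock with constant drift `μ` and volatility `σ`. -/
def mertonValue (W : ℝ≥0 → Ω → ℝ) (ℱ : Filtration ℝ≥0 mΩ) (P : Measure Ω) (U : ℝ → ℝ)
    (T : ℝ≥0) (μ σ : ℝ) (t : ℝ≥0) (x : ℝ) : ℝ :=
  (⨆ (π : ℝ≥0 → Ω → ℝ) (X : ℝ≥0 → Ω → ℝ) (_ : IsAdmissibleStrategy W ℱ P T μ σ t x π X),
    ∫⁻ ω, ENNReal.ofReal (U (X T ω)) ∂P).toReal

/-- The risk tolerance function `R = -M_x / M_xx` of the Merton value function `M`. -/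
def mertonRiskTolerance (W : ℝ≥0 → Ω → ℝ) (ℱ : Filtration ℝ≥0 mΩ) (P : Measure Ω) (U : ℝ → ℝ)
    (T : ℝ≥0) (μ σ : ℝ) (t : ℝ≥0) (x : ℝ) : ℝ :=
  riskTolerance (mertonValue W ℱ P U T μ σ t) x

end

/-!
The proof rests on an explicit formula for the value function in logarithmic marginal coordinates.

Let `G(w)` be the wealth at which marginal utility is `e⁻ʷ`. It solves `G' = R ∘ G`, so its
derivatives are `R ∘ G` times polynomials in the quantities `Rʲ R⁽ʲ⁺¹⁾ ∘ G` (`hasDerivAt_curve`).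
These quantities are bounded: the bounds on `∂ʲ(Rʲ)` for `j ≥ 2` give them one after the other once
`R'` is bounded, and `R'` is bounded by interpolating between `R² ≥ 0` and the bound on `(R²)''`
(`IsAdmissibleUtility.exists_abs_deriv_tolerance_le`). Hence `|G⁽ᵏ⁾| ≤ C G'` for `1 ≤ k ≤ 6` and
`G' ≤ C G`; these facts are collected in `IsWealthCurve`.

With `q = (μ/σ) √(T - t)` and `heat f q w = E f(w + q N)`, `N` standard Gaussian, the value function
satisfies `M(t, heat G q w) = heat (U ∘ G) q (w + q²)` (`IsWealthCurve.mertonValue_eq`).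
Differentiating in `w` gives `M_x = exp(-w - q²/2)`, and a second time
`R(t, heat G q w) = heat G' q w` (`IsWealthCurve.value_regularity`). Thus `x = heat G q w` is again
a wealth curve, now for the risk tolerance `R(t, ·)`. As averaging preserves the inequalities
`|G⁽ᵏ⁾| ≤ C G' ≤ C² G` with the same constants, reading the polynomial identities backwards bounds
`Rʲ ∂ʲ⁺¹R` independently of `q`, that is, uniformly in `t` and `z`
(`IsWealthCurve.uniform_bounds`). The bounds on `∂ʲ(Rʲ)` are polynomial in these.

The formula for the value function has two halves.

* Upper bound: for the state price density `Z`, Fenchel's inequality for `U` reduces the claim to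
  the budget constraint `E[Z_T X_T] ≤ x` (`IsAdmissibleStrategy.lintegral_stateDensity_le`). An
  admissible wealth process is, along a subsequence, the almost sure uniform limit of wealth
  processes of simple strategies. These are stopped when they first fall below `-ε` on a grid so
  fine that the overshoot has negligible price (`HasStoppedWealth`); the stopped processes are
  martingales under `Z` and Fatou's lemma applies.
* Attainment: `X_s = heat G ((μ/σ) √(T - s)) (η_s)` with `η` the drifted Brownian motion
  `shiftedPath` is the wealth process of an admissible strategy with `X_T = G(η_T)`
  (`IsWealthCurve.exists_isAdmissibleStrategy`). The required Itô formula is obtained from a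
  second-order expansion that is uniform along each path (`HasItoExpansion`): on a fine grid the
  Riemann sums of the integrand miss the increments of the process by `∑ c ((ΔW)² - Δs)`, which is
  small by Kolmogorov's maximal inequality, up to a negligible error.
-/

/-! ### Gaussian averages -/

/-- `f` grows at most exponentially in both directions. -/
def ExpBounded (f : ℝ → ℝ) : Prop :=
  ∃ C c : ℝ, 0 ≤ C ∧ 0 ≤ c ∧ ∀ w, |f w| ≤ C * Real.exp (c * |w|)

/-- The heat flow, `E f(w + q N)` for a standard Gaussian variable `N`. It is parametrised by the
standard deviation `q` rather than by the time `q²`; the sign of `q` is irrelevant. -/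
noncomputable def heat (f : ℝ → ℝ) (q w : ℝ) : ℝ :=
  ∫ n, f (w + q * n) ∂(gaussianReal 0 1)

lemma integrable_exp_mul_abs_gaussian (a : ℝ) :
    Integrable (fun n : ℝ => Real.exp (a * |n|)) (gaussianReal 0 1) := by
  have h1 := integrable_exp_mul_gaussianReal (μ := 0) (v := 1) a
  have h2 := integrable_exp_mul_gaussianReal (μ := 0) (v := 1) (-a)
  refine (h1.add h2).mono' (by fun_prop) (ae_of_all _ fun n => ?_)
  rw [Real.norm_eq_abs, abs_of_pos (Real.exp_pos _)]
  simp only [Pi.add_apply]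
  rcases abs_cases n with ⟨h, -⟩ | ⟨h, -⟩ <;> rw [h]
  · linarith [Real.exp_pos (-a * n)]
  · rw [show a * -n = -a * n by ring]; linarith [Real.exp_pos (a * n)]

lemma exp_abs_shift_le {c w q : ℝ} (hc : 0 ≤ c) {A Q : ℝ} (hw : |w| ≤ A) (hq : |q| ≤ Q) (n : ℝ) :
    Real.exp (c * |w + q * n|) ≤ Real.exp (c * A) * Real.exp (c * Q * |n|) := by
  rw [← Real.exp_add]
  apply Real.exp_le_exp.2
  have : |w + q * n| ≤ A + Q * |n| := by
    refine (abs_add_le _ _).trans ?_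
    rw [abs_mul]
    gcongr
  calc c * |w + q * n| ≤ c * (A + Q * |n|) := by gcongr
    _ = _ := by ring

lemma ExpBounded.integrable {f : ℝ → ℝ} (hf : ExpBounded f) (hc : Continuous f) (q w : ℝ) :
    Integrable (fun n => f (w + q * n)) (gaussianReal 0 1) := by
  obtain ⟨C, c, hC, hc0, h⟩ := hf
  refine ((integrable_exp_mul_abs_gaussian (c * |q|)).const_mul (C * Real.exp (c * |w|))).mono'
    (by fun_prop) (ae_of_all _ fun n => ?_)
  rw [Real.norm_eq_abs]
  refine (h _).trans ?_
  rw [mul_assoc]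
  gcongr
  exact exp_abs_shift_le hc0 le_rfl le_rfl n

lemma ExpBounded.integrable_mul {f : ℝ → ℝ} (hf : ExpBounded f) (hc : Continuous f) (q w : ℝ) :
    Integrable (fun n => n * f (w + q * n)) (gaussianReal 0 1) := by
  obtain ⟨C, c, hC, hc0, h⟩ := hf
  refine ((integrable_exp_mul_abs_gaussian (c * |q| + 1)).const_mul
    (C * Real.exp (c * |w|))).mono' (by fun_prop) (ae_of_all _ fun n => ?_)
  rw [Real.norm_eq_abs, abs_mul]
  have h1 := exp_abs_shift_le hc0 (le_refl |w|) (le_refl |q|) n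
  have h2 : |n| ≤ Real.exp |n| := by linarith [Real.add_one_le_exp |n|]
  calc |n| * |f (w + q * n)|
      ≤ Real.exp |n| * (C * (Real.exp (c * |w|) * Real.exp (c * |q| * |n|))) := by
        gcongr
        exact (h _).trans (by gcongr)
    _ = _ := by rw [add_mul, Real.exp_add]; ring_nf

lemma continuous_heat {f : ℝ → ℝ} (hf : ExpBounded f) (hc : Continuous f) :
    Continuous (fun p : ℝ × ℝ => heat f p.1 p.2) := by
  obtain ⟨C, c, hC, hc0, h⟩ := hf
  rw [continuous_iff_continuousAt]
  rintro ⟨q, w⟩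
  refine continuousAt_of_dominated (bound := fun n => C * (Real.exp (c * (|w| + 1)) *
    Real.exp (c * (|q| + 1) * |n|))) (Eventually.of_forall fun p => by fun_prop) ?_
    (((integrable_exp_mul_abs_gaussian _).const_mul _).const_mul _)
    (ae_of_all _ fun n => by fun_prop)
  have hev : ∀ᶠ p : ℝ × ℝ in 𝓝 (q, w), |p.1| < |q| + 1 ∧ |p.2| < |w| + 1 := by
    have h1 : Tendsto (fun p : ℝ × ℝ => |p.1|) (𝓝 (q, w)) (𝓝 |q|) :=
      (continuous_fst.abs).tendsto (q, w)
    have h2 : Tendsto (fun p : ℝ × ℝ => |p.2|) (𝓝 (q, w)) (𝓝 |w|) :=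
      (continuous_snd.abs).tendsto (q, w)
    exact (h1.eventually_lt_const (by linarith)).and (h2.eventually_lt_const (by linarith))
  filter_upwards [hev] with p hp
  refine ae_of_all _ fun n => ?_
  rw [Real.norm_eq_abs]
  refine (h _).trans ?_
  gcongr
  exact exp_abs_shift_le hc0 hp.2.le hp.1.le n

lemma hasDerivAt_heat {f f' : ℝ → ℝ} (hf : ExpBounded f) (hf' : ExpBounded f')
    (hd : ∀ w, HasDerivAt f (f' w) w) (hc' : Continuous f') (q w : ℝ) :
    HasDerivAt (heat f q) (heat f' q w) w := by
  have hc : Continuous f := continuous_iff_continuousAt.2 fun w => (hd w).continuousAt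
  have hi := hf.integrable hc q w
  obtain ⟨C, c, hC, hc0, h⟩ := hf'
  refine (hasDerivAt_integral_of_dominated_loc_of_deriv_le
    (F := fun w n => f (w + q * n)) (F' := fun w n => f' (w + q * n))
    (bound := fun n => C * (Real.exp (c * (|w| + 1)) * Real.exp (c * |q| * |n|)))
    (Metric.ball_mem_nhds w one_pos) (Eventually.of_forall fun x => by fun_prop) hi
    (by fun_prop) (ae_of_all _ fun n x hx => ?_)
    (((integrable_exp_mul_abs_gaussian _).const_mul _).const_mul _)
    (ae_of_all _ fun n x _ => ?_)).2
  · rw [Real.norm_eq_abs]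
    refine (h _).trans ?_
    gcongr
    refine exp_abs_shift_le hc0 ?_ le_rfl n
    have : |x - w| < 1 := by simpa [Real.dist_eq] using hx
    linarith [abs_sub_abs_le_abs_sub x w]
  · exact (hd (x + q * n)).comp_add_const x (q * n)

/-- Gaussian integration by parts. -/
lemma integral_mul_gaussian_eq {f f' : ℝ → ℝ} (hf : ExpBounded f) (hf' : ExpBounded f')
    (hd : ∀ w, HasDerivAt f (f' w) w) (hc' : Continuous f') (q w : ℝ) :
    ∫ n, n * f (w + q * n) ∂(gaussianReal 0 1) = q * heat f' q w := by
  have hc : Continuous f := continuous_iff_continuousAt.2 fun w => (hd w).continuousAt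
  have h1 := hf.integrable_mul hc q w
  have h0 := hf.integrable hc q w
  have h2 := (hf'.integrable hc' q w).const_mul q
  have key : ∀ g : ℝ → ℝ, Integrable g (gaussianReal 0 1) →
      Integrable (fun n => gaussianPDFReal 0 1 n * g n) volume := by
    intro g hg
    rw [gaussianReal_of_var_ne_zero 0 one_ne_zero,
      integrable_withDensity_iff_integrable_smul' (measurable_gaussianPDF 0 1)
        (ae_of_all _ fun _ => gaussianPDF_lt_top)] at hg
    simpa [gaussianPDF, ENNReal.toReal_ofReal (gaussianPDFReal_nonneg 0 1 _)] using hg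
  have hderiv : ∀ n : ℝ, HasDerivAt (gaussianPDFReal 0 1) (-n * gaussianPDFReal 0 1 n) n := by
    intro n
    unfold gaussianPDFReal
    have : HasDerivAt (fun x : ℝ => -(x - 0) ^ 2 / (2 * ((1 : ℝ≥0) : ℝ))) (-n) n := by
      have := (((hasDerivAt_id n).sub_const 0).pow 2).neg.div_const (2 * ((1 : ℝ≥0) : ℝ))
      refine this.congr_deriv ?_
      simp only [id_eq, sub_zero, NNReal.coe_one]
      ring
    have := (this.exp).const_mul ((√(2 * Real.pi * ((1 : ℝ≥0) : ℝ)))⁻¹)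
    refine this.congr_deriv ?_
    ring
  have hdf : ∀ n : ℝ, HasDerivAt (fun n => f (w + q * n)) (q * f' (w + q * n)) n := by
    intro n
    have := (hd (w + q * n)).comp n (((hasDerivAt_id n).const_mul q).const_add w)
    exact this.congr_deriv (by ring)
  have hparts := integral_mul_deriv_eq_deriv_mul_of_integrable
    (u := gaussianPDFReal 0 1) (v := fun n => f (w + q * n))
    (u' := fun n => -n * gaussianPDFReal 0 1 n)
    (v' := fun n => q * f' (w + q * n)) (fun n _ => hderiv n) (fun n _ => hdf n)
    (key _ h2) (by
      have := (key _ h1).neg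
      refine this.congr (ae_of_all _ fun n => ?_)
      simp only [Pi.neg_apply, Pi.mul_apply]; ring)
    (key _ h0)
  rw [integral_gaussianReal_eq_integral_smul one_ne_zero]
  unfold heat
  rw [← integral_const_mul, integral_gaussianReal_eq_integral_smul one_ne_zero]
  simp only [smul_eq_mul]
  rw [hparts, ← integral_neg]
  congr 1; ext n; ring

/-- The heat equation, in terms of the standard deviation `q`. -/
lemma hasDerivAt_heat_param {f f' f'' : ℝ → ℝ} (hf : ExpBounded f) (hf' : ExpBounded f')
    (hf'' : ExpBounded f'') (hd : ∀ w, HasDerivAt f (f' w) w) (hd' : ∀ w, HasDerivAt f' (f'' w) w)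
    (hc'' : Continuous f'') (q w : ℝ) :
    HasDerivAt (fun q => heat f q w) (q * heat f'' q w) q := by
  have hc : Continuous f := continuous_iff_continuousAt.2 fun w => (hd w).continuousAt
  have hc' : Continuous f' := continuous_iff_continuousAt.2 fun w => (hd' w).continuousAt
  rw [← integral_mul_gaussian_eq hf' hf'' hd' hc'']
  have hi := hf.integrable hc q w
  obtain ⟨C, c, hC, hc0, h⟩ := hf'
  refine (hasDerivAt_integral_of_dominated_loc_of_deriv_le
    (F := fun q n => f (w + q * n)) (F' := fun q n => n * f' (w + q * n))
    (bound := fun n => C * (Real.exp (c * |w|) * Real.exp ((c * (|q| + 1) + 1) * |n|)))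
    (Metric.ball_mem_nhds q one_pos) (Eventually.of_forall fun x => by fun_prop) hi
    (by fun_prop) (ae_of_all _ fun n x hx => ?_)
    (((integrable_exp_mul_abs_gaussian _).const_mul _).const_mul _)
    (ae_of_all _ fun n x _ => ?_)).2
  · rw [Real.norm_eq_abs, abs_mul]
    have : |x - q| < 1 := by simpa [Real.dist_eq] using hx
    have hx' : |x| ≤ |q| + 1 := by linarith [abs_sub_abs_le_abs_sub x q]
    have h1 := exp_abs_shift_le hc0 (le_refl |w|) hx' n
    have h2 : |n| ≤ Real.exp |n| := by linarith [Real.add_one_le_exp |n|]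
    calc |n| * |f' (w + x * n)|
        ≤ Real.exp |n| * (C * (Real.exp (c * |w|) * Real.exp (c * (|q| + 1) * |n|))) := by
          gcongr
          exact (h _).trans (by gcongr)
      _ = _ := by rw [add_mul (c * (|q| + 1)), Real.exp_add]; ring_nf
  · have := (hd (w + x * n)).comp x (((hasDerivAt_id x).mul_const n).const_add w)
    exact this.congr_deriv (by ring)

/-- Exponential tilting of a Gaussian average. -/
lemma heat_exp_neg_mul (g : ℝ → ℝ) (q w : ℝ) :
    heat (fun w => Real.exp (-w) * g w) q w = Real.exp (-w + q ^ 2 / 2) * heat g q (w - q ^ 2) := by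
  unfold heat
  rw [integral_gaussianReal_eq_integral_smul one_ne_zero,
    integral_gaussianReal_eq_integral_smul one_ne_zero, ← integral_const_mul,
    ← integral_sub_right_eq_self _ q]
  congr 1; ext n
  simp only [smul_eq_mul, gaussianPDFReal, NNReal.coe_one, mul_one, sub_zero]
  have e1 : Real.exp (-(n - q) ^ 2 / 2) * Real.exp (-(w + q * (n - q)))
      = Real.exp (-w + q ^ 2 / 2) * Real.exp (-n ^ 2 / 2) := by
    rw [← Real.exp_add, ← Real.exp_add]; congr 1; ring
  have e2 : w + q * (n - q) = w - q ^ 2 + q * n := by ring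
  calc _ = (√(2 * Real.pi))⁻¹ * (Real.exp (-(n - q) ^ 2 / 2) * Real.exp (-(w + q * (n - q))))
        * g (w + q * (n - q)) := by ring
    _ = _ := by rw [e1, e2]; ring

lemma heat_nonneg {g : ℝ → ℝ} (h : ∀ w, 0 ≤ g w) (q w : ℝ) : 0 ≤ heat g q w :=
  integral_nonneg fun _ => h _

lemma heat_pos {g : ℝ → ℝ} (hg : ExpBounded g) (hc : Continuous g) (h : ∀ w, 0 < g w) (q w : ℝ) :
    0 < heat g q w := by
  refine (integral_pos_iff_support_of_nonneg (fun _ => (h _).le) (hg.integrable hc q w)).2 ?_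
  have : Function.support (fun n => g (w + q * n)) = univ := by
    ext n; simpa using (h _).ne'
  rw [this]; simp

lemma abs_heat_le {f g : ℝ → ℝ} (hg : ExpBounded g) (hc : Continuous g) {C : ℝ}
    (h : ∀ w, |f w| ≤ C * g w) (q w : ℝ) : |heat f q w| ≤ C * heat g q w := by
  unfold heat
  rw [← integral_const_mul, ← Real.norm_eq_abs]
  exact norm_integral_le_of_norm_le ((hg.integrable hc q w).const_mul C)
    (ae_of_all _ fun n => h _)

lemma tendsto_heat_atBot {g : ℝ → ℝ} (hg : ExpBounded g) (hc : Continuous g) (h : ∀ w, 0 < g w)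
    (hm : Monotone g) (h0 : Tendsto g atBot (𝓝 0)) (q : ℝ) :
    Tendsto (heat g q) atBot (𝓝 0) := by
  have := tendsto_integral_filter_of_dominated_convergence (μ := gaussianReal 0 1)
    (F := fun w n => g (w + q * n)) (f := fun _ => (0 : ℝ)) (l := atBot)
    (fun n => g (0 + q * n)) (Eventually.of_forall fun w => by fun_prop)
    (by
      filter_upwards [eventually_le_atBot 0] with w hw
      refine ae_of_all _ fun n => ?_
      rw [Real.norm_eq_abs, abs_of_pos (h _)]
      exact hm (by linarith))
    (hg.integrable hc q 0)
    (ae_of_all _ fun n => h0.comp (tendsto_atBot_add_const_right _ _ tendsto_id))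
  rw [integral_zero] at this
  exact this

lemma tendsto_heat_atTop {g : ℝ → ℝ} (hg : ExpBounded g) (hc : Continuous g) (h : ∀ w, 0 < g w)
    (hm : Monotone g) (h0 : Tendsto g atTop atTop) (q : ℝ) :
    Tendsto (heat g q) atTop atTop := by
  set p := (gaussianReal 0 1).real (Icc (-1 : ℝ) 1) with hp
  have hp0 : 0 < p := by
    refine ENNReal.toReal_pos (fun h0 => ?_) (measure_ne_top _ _)
    have := gaussianReal_absolutelyContinuous' 0 one_ne_zero h0
    simp at this
    norm_num at this
  have hlb : ∀ w, g (w - |q|) * p ≤ heat g q w := by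
    intro w
    unfold heat
    calc g (w - |q|) * p = ∫ n in Icc (-1 : ℝ) 1, g (w - |q|) ∂(gaussianReal 0 1) := by
          simp [hp, mul_comm]
      _ ≤ ∫ n in Icc (-1 : ℝ) 1, g (w + q * n) ∂(gaussianReal 0 1) := by
          refine setIntegral_mono_on (by simp) (hg.integrable hc q w).integrableOn
            measurableSet_Icc fun n hn => hm ?_
          have : |q * n| ≤ |q| := by
            rw [abs_mul]
            exact mul_le_of_le_one_right (abs_nonneg _) (abs_le.2 hn)
          linarith [neg_abs_le (q * n)]
      _ ≤ _ := setIntegral_le_integral (hg.integrable hc q w) (ae_of_all _ fun n => (h _).le)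
  refine tendsto_atTop_mono hlb (Tendsto.atTop_mul_const hp0 (h0.comp ?_))
  exact tendsto_atTop_add_const_right _ _ tendsto_id

/-! ### Derivatives of a risk tolerance and of the associated wealth curve -/

/-- A uniformly bounded family of real numbers. -/
def UniformlyBounded {ι : Type*} (f : ι → ℝ) : Prop := ∃ C, ∀ i, |f i| ≤ C

namespace UniformlyBounded

variable {ι : Type*} {f g : ι → ℝ}

lemma add (hf : UniformlyBounded f) (hg : UniformlyBounded g) :
    UniformlyBounded (fun i => f i + g i) := by
  obtain ⟨C, hC⟩ := hf
  obtain ⟨D, hD⟩ := hg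
  exact ⟨C + D, fun i => (abs_add_le _ _).trans (add_le_add (hC i) (hD i))⟩

lemma mul (hf : UniformlyBounded f) (hg : UniformlyBounded g) :
    UniformlyBounded (fun i => f i * g i) := by
  obtain ⟨C, hC⟩ := hf
  obtain ⟨D, hD⟩ := hg
  refine ⟨C * D, fun i => ?_⟩
  rw [abs_mul]
  exact mul_le_mul (hC i) (hD i) (abs_nonneg _) ((abs_nonneg _).trans (hC i))

lemma const (c : ℝ) : UniformlyBounded (fun _ : ι => c) := ⟨|c|, fun _ => le_rfl⟩

lemma pow (hf : UniformlyBounded f) (n : ℕ) : UniformlyBounded (fun i => f i ^ n) := by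
  induction n with
  | zero => simpa using const 1
  | succ n ih => simpa [pow_succ] using ih.mul hf

lemma const_mul (c : ℝ) (hf : UniformlyBounded f) : UniformlyBounded (fun i => c * f i) :=
  (const c).mul hf

lemma sub (hf : UniformlyBounded f) (hg : UniformlyBounded g) :
    UniformlyBounded (fun i => f i - g i) := by
  simpa [sub_eq_add_neg] using hf.add (hg.const_mul (-1))

end UniformlyBounded

/-- `∂ⱼ(rʲ)` as a polynomial in the quantities `bᵢ = rⁱ r⁽ⁱ⁺¹⁾`, for `1 ≤ j ≤ 5`. -/
def powPoly (j : ℕ) (b : ℕ → ℝ) : ℝ :=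
  match j with
  | 1 => b 0
  | 2 => 2 * b 1 + 2 * b 0 ^ 2
  | 3 => 3 * b 2 + 18 * (b 0 * b 1) + 6 * b 0 ^ 3
  | 4 => 4 * b 3 + 48 * (b 0 * b 2) + 36 * b 1 ^ 2 + 144 * (b 0 ^ 2 * b 1) + 24 * b 0 ^ 4
  | 5 => 5 * b 4 + 100 * (b 0 * b 3) + 200 * (b 1 * b 2) + 600 * (b 0 ^ 2 * b 2)
      + 900 * (b 0 * b 1 ^ 2) + 1200 * (b 0 ^ 3 * b 1) + 120 * b 0 ^ 5
  | _ => 0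

/-- If `g' = r ∘ g`, the quotient `g⁽ᵏ⁺¹⁾ / g'` as a polynomial in the quantities
`bᵢ = (rⁱ r⁽ⁱ⁺¹⁾) ∘ g`, for `0 ≤ k ≤ 5`. -/
def curvePoly (k : ℕ) (b : ℕ → ℝ) : ℝ :=
  match k with
  | 0 => 1
  | 1 => b 0
  | 2 => b 1 + b 0 ^ 2
  | 3 => b 2 + 4 * (b 0 * b 1) + b 0 ^ 3
  | 4 => b 3 + 7 * (b 0 * b 2) + 4 * b 1 ^ 2 + 11 * (b 0 ^ 2 * b 1) + b 0 ^ 4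
  | 5 => b 4 + 11 * (b 0 * b 3) + 32 * (b 0 ^ 2 * b 2) + 34 * (b 0 * b 1 ^ 2)
      + 15 * (b 1 * b 2) + 26 * (b 0 ^ 3 * b 1) + b 0 ^ 5
  | _ => 0

section Families

variable {ι : Type*} {b : ℕ → ι → ℝ}

lemma uniformlyBounded_powPoly (h : ∀ j ≤ 4, UniformlyBounded (b j)) {j : ℕ} (h1 : 1 ≤ j)
    (h5 : j ≤ 5) : UniformlyBounded (fun i => powPoly j (fun k => b k i)) := by
  have b0 := h 0 (by norm_num)
  have b1 := h 1 (by norm_num)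
  have b2 := h 2 (by norm_num)
  have b3 := h 3 (by norm_num)
  have b4 := h 4 (by norm_num)
  interval_cases j
  · exact b0
  · exact (b1.const_mul 2).add ((b0.pow 2).const_mul 2)
  · exact ((b2.const_mul 3).add ((b0.mul b1).const_mul 18)).add ((b0.pow 3).const_mul 6)
  · exact ((((b3.const_mul 4).add ((b0.mul b2).const_mul 48)).add ((b1.pow 2).const_mul 36)).add
      (((b0.pow 2).mul b1).const_mul 144)).add ((b0.pow 4).const_mul 24)
  · exact ((((((b4.const_mul 5).add ((b0.mul b3).const_mul 100)).add
      ((b1.mul b2).const_mul 200)).add (((b0.pow 2).mul b2).const_mul 600)).add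
      ((b0.mul (b1.pow 2)).const_mul 900)).add (((b0.pow 3).mul b1).const_mul 1200)).add
      ((b0.pow 5).const_mul 120)

lemma uniformlyBounded_curvePoly (h : ∀ j ≤ 4, UniformlyBounded (b j)) {k : ℕ} (h5 : k ≤ 5) :
    UniformlyBounded (fun i => curvePoly k (fun k => b k i)) := by
  have b0 := h 0 (by norm_num)
  have b1 := h 1 (by norm_num)
  have b2 := h 2 (by norm_num)
  have b3 := h 3 (by norm_num)
  have b4 := h 4 (by norm_num)
  interval_cases k
  · exact UniformlyBounded.const 1
  · exact b0
  · exact b1.add (b0.pow 2)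
  · exact (b2.add ((b0.mul b1).const_mul 4)).add (b0.pow 3)
  · exact (((b3.add ((b0.mul b2).const_mul 7)).add ((b1.pow 2).const_mul 4)).add
      (((b0.pow 2).mul b1).const_mul 11)).add (b0.pow 4)
  · exact (((((b4.add ((b0.mul b3).const_mul 11)).add (((b0.pow 2).mul b2).const_mul 32)).add
      ((b0.mul (b1.pow 2)).const_mul 34)).add ((b1.mul b2).const_mul 15)).add
      (((b0.pow 3).mul b1).const_mul 26)).add (b0.pow 5)

/-- The polynomials `powPoly j` are triangular: `bⱼ₋₁` enters `powPoly j` linearly. -/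
lemma uniformlyBounded_of_powPoly (h0 : UniformlyBounded (b 0))
    (h : ∀ j, 2 ≤ j → j ≤ 5 → UniformlyBounded (fun i => powPoly j (fun k => b k i))) :
    ∀ j ≤ 4, UniformlyBounded (b j) := by
  have b1 : UniformlyBounded (b 1) := by
    have := ((h 2 (by norm_num) (by norm_num)).sub ((h0.pow 2).const_mul 2)).const_mul (1 / 2)
    convert this using 2 with i
    simp only [powPoly]; ring
  have b2 : UniformlyBounded (b 2) := by
    have := ((h 3 (by norm_num) (by norm_num)).sub (((h0.mul b1).const_mul 18).add
      ((h0.pow 3).const_mul 6))).const_mul (1 / 3)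
    convert this using 2 with i
    simp only [powPoly]; ring
  have b3 : UniformlyBounded (b 3) := by
    have := ((h 4 (by norm_num) (by norm_num)).sub (((((h0.mul b2).const_mul 48).add
      ((b1.pow 2).const_mul 36)).add (((h0.pow 2).mul b1).const_mul 144)).add
      ((h0.pow 4).const_mul 24))).const_mul (1 / 4)
    convert this using 2 with i
    simp only [powPoly]; ring
  have b4 : UniformlyBounded (b 4) := by
    have := ((h 5 (by norm_num) (by norm_num)).sub (((((((h0.mul b3).const_mul 100).add
      ((b1.mul b2).const_mul 200)).add (((h0.pow 2).mul b2).const_mul 600)).add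
      ((h0.mul (b1.pow 2)).const_mul 900)).add (((h0.pow 3).mul b1).const_mul 1200)).add
      ((h0.pow 5).const_mul 120))).const_mul (1 / 5)
    convert this using 2 with i
    simp only [powPoly]; ring
  intro j hj
  interval_cases j <;> assumption

/-- The polynomials `curvePoly k` are triangular: `bₖ₋₁` enters `curvePoly k` linearly. -/
lemma uniformlyBounded_of_curvePoly
    (h : ∀ k, 1 ≤ k → k ≤ 5 → UniformlyBounded (fun i => curvePoly k (fun k => b k i))) :
    ∀ j ≤ 4, UniformlyBounded (b j) := by
  have h0 : UniformlyBounded (b 0) := h 1 le_rfl (by norm_num)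
  have b1 : UniformlyBounded (b 1) := by
    have := (h 2 (by norm_num) (by norm_num)).sub (h0.pow 2)
    convert this using 2 with i
    simp only [curvePoly]; ring
  have b2 : UniformlyBounded (b 2) := by
    have := (h 3 (by norm_num) (by norm_num)).sub (((h0.mul b1).const_mul 4).add (h0.pow 3))
    convert this using 2 with i
    simp only [curvePoly]; ring
  have b3 : UniformlyBounded (b 3) := by
    have := (h 4 (by norm_num) (by norm_num)).sub (((((h0.mul b2).const_mul 7).add
      ((b1.pow 2).const_mul 4)).add (((h0.pow 2).mul b1).const_mul 11)).add (h0.pow 4))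
    convert this using 2 with i
    simp only [curvePoly]; ring
  have b4 : UniformlyBounded (b 4) := by
    have := (h 5 (by norm_num) (by norm_num)).sub (((((((h0.mul b3).const_mul 11).add
      (((h0.pow 2).mul b2).const_mul 32)).add ((h0.mul (b1.pow 2)).const_mul 34)).add
      ((b1.mul b2).const_mul 15)).add (((h0.pow 3).mul b1).const_mul 26)).add (h0.pow 5))
    convert this using 2 with i
    simp only [curvePoly]; ring
  intro j hj
  interval_cases j <;> assumption

end Families

lemma hasDerivAt_iteratedDeriv {f : ℝ → ℝ} {n : ℕ} (hf : ContDiffOn ℝ n f (Ioi 0)) {k : ℕ}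
    (hk : k < n) {x : ℝ} (hx : 0 < x) :
    HasDerivAt (iteratedDeriv k f) (iteratedDeriv (k + 1) f x) x := by
  have h1 := (hf.differentiableOn_iteratedDerivWithin (m := k) (by exact_mod_cast hk)
    isOpen_Ioi.uniqueDiffOn) x hx
  have h2 : DifferentiableWithinAt ℝ (iteratedDeriv k f) (Ioi 0) x :=
    h1.congr (fun y hy => (iteratedDerivWithin_of_isOpen isOpen_Ioi hy).symm)
      (iteratedDerivWithin_of_isOpen isOpen_Ioi hx).symm
  rw [iteratedDeriv_succ]
  exact (h2.differentiableAt (Ioi_mem_nhds hx)).hasDerivAt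

lemma continuousOn_iteratedDeriv {f : ℝ → ℝ} {n : ℕ} (hf : ContDiffOn ℝ n f (Ioi 0)) {k : ℕ}
    (hk : k ≤ n) : ContinuousOn (iteratedDeriv k f) (Ioi 0) :=
  (hf.continuousOn_iteratedDerivWithin (m := k) (by exact_mod_cast hk)
    isOpen_Ioi.uniqueDiffOn).congr fun _ hy => (iteratedDerivWithin_of_isOpen isOpen_Ioi hy).symm

lemma iteratedDeriv_eq_of_hasDerivAt {F : ℕ → ℝ → ℝ} {n : ℕ}
    (h : ∀ k < n, ∀ x, 0 < x → HasDerivAt (F k) (F (k + 1) x) x) :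
    ∀ k ≤ n, ∀ x, 0 < x → iteratedDeriv k (F 0) x = F k x := by
  intro k
  induction k with
  | zero => intro _ x _; simp
  | succ k ih =>
    intro hk x hx
    rw [iteratedDeriv_succ]
    have : iteratedDeriv k (F 0) =ᶠ[𝓝 x] F k := by
      filter_upwards [Ioi_mem_nhds hx] with y hy using ih (by omega) y hy
    rw [this.deriv_eq]
    exact (h k (by omega) x hx).deriv

/-- The functions `F k`, `k ≤ n`, are the successive derivatives of `F 0`. -/
lemma contDiff_of_hasDerivAt {n : ℕ} : ∀ {F : ℕ → ℝ → ℝ},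
    (∀ k < n, ∀ x, HasDerivAt (F k) (F (k + 1) x) x) → Continuous (F n) → ContDiff ℝ n (F 0) := by
  induction n with
  | zero => intro F _ hc; simpa using hc
  | succ n ih =>
    intro F h hc
    have hd : deriv (F 0) = F 1 := funext fun x => (h 0 (by omega) x).deriv
    have h1 : ContDiff ℝ n (F 1) :=
      ih (F := fun k => F (k + 1)) (fun k hk x => h (k + 1) (by omega) x) hc
    rw [Nat.cast_succ, contDiff_succ_iff_deriv]
    refine ⟨fun x => (h 0 (by omega) x).differentiableAt, fun h => ?_, hd ▸ h1⟩
    simp at h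

/-- The scale-invariant derivative `rʲ r⁽ʲ⁺¹⁾`. -/
noncomputable def scaledDeriv (r : ℝ → ℝ) (j : ℕ) (x : ℝ) : ℝ :=
  r x ^ j * iteratedDeriv (j + 1) r x

lemma iteratedDeriv_pow_eq {r : ℝ → ℝ} (hr : ContDiffOn ℝ 5 r (Ioi 0)) {j : ℕ} (h1 : 1 ≤ j)
    (h5 : j ≤ 5) {x : ℝ} (hx : 0 < x) :
    iteratedDeriv j (fun y => r y ^ j) x = powPoly j (fun i => scaledDeriv r i x) := by
  have d : ∀ k < 5, ∀ y, 0 < y → HasDerivAt (iteratedDeriv k r) (iteratedDeriv (k + 1) r y) y :=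
    fun k hk y hy => hasDerivAt_iteratedDeriv (n := 5) (by exact_mod_cast hr) hk hy
  simp only [scaledDeriv]
  have e0 : iteratedDeriv 0 r = r := iteratedDeriv_zero
  have d0 := d 0 (by norm_num)
  have d1 := d 1 (by norm_num)
  have d2 := d 2 (by norm_num)
  have d3 := d 3 (by norm_num)
  have d4 := d 4 (by norm_num)
  rw [e0] at d0
  simp only [Nat.reduceAdd, zero_add] at d0 d1 d2 d3 d4
  set r1 := iteratedDeriv 1 r
  set r2 := iteratedDeriv 2 r
  set r3 := iteratedDeriv 3 r
  set r4 := iteratedDeriv 4 r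
  set r5 := iteratedDeriv 5 r
  interval_cases j
  · simp [powPoly, iteratedDeriv_one]
  · have := iteratedDeriv_eq_of_hasDerivAt (n := 2) (F := fun k y => match k with
      | 0 => r y ^ 2
      | 1 => 2 * (r y * r1 y)
      | _ => 2 * r1 y ^ 2 + 2 * (r y * r2 y)) (fun k hk y hy => by
        have a0 := d0 y hy
        have a1 := d1 y hy
        interval_cases k
        · exact (a0.pow 2).congr_deriv (by norm_num [Pi.pow_apply]; try ring)
        · exact ((a0.mul a1).const_mul 2).congr_deriv (by norm_num [Pi.pow_apply]; try ring))
      2 le_rfl x hx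
    refine this.trans ?_
    simp only [powPoly]; ring
  · have := iteratedDeriv_eq_of_hasDerivAt (n := 3) (F := fun k y => match k with
      | 0 => r y ^ 3
      | 1 => 3 * (r y ^ 2 * r1 y)
      | 2 => 6 * (r y * r1 y ^ 2) + 3 * (r y ^ 2 * r2 y)
      | _ => 6 * r1 y ^ 3 + 18 * (r y * r1 y * r2 y) + 3 * (r y ^ 2 * r3 y)) (fun k hk y hy => by
        have a0 := d0 y hy
        have a1 := d1 y hy
        have a2 := d2 y hy
        interval_cases k
        · exact (a0.pow 3).congr_deriv (by norm_num [Pi.pow_apply]; try ring)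
        · exact (((a0.pow 2).mul a1).const_mul 3).congr_deriv (by norm_num [Pi.pow_apply]; try ring)
        · exact (((a0.mul (a1.pow 2)).const_mul 6).add
            (((a0.pow 2).mul a2).const_mul 3)).congr_deriv (by norm_num [Pi.pow_apply]; try ring))
      3 le_rfl x hx
    refine this.trans ?_
    simp only [powPoly]; ring
  · have := iteratedDeriv_eq_of_hasDerivAt (n := 4) (F := fun k y => match k with
      | 0 => r y ^ 4
      | 1 => 4 * (r y ^ 3 * r1 y)
      | 2 => 12 * (r y ^ 2 * r1 y ^ 2) + 4 * (r y ^ 3 * r2 y)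
      | 3 => 24 * (r y * r1 y ^ 3) + 36 * (r y ^ 2 * r1 y * r2 y) + 4 * (r y ^ 3 * r3 y)
      | _ => 24 * r1 y ^ 4 + 144 * (r y * r1 y ^ 2 * r2 y) + 36 * (r y ^ 2 * r2 y ^ 2)
          + 48 * (r y ^ 2 * r1 y * r3 y) + 4 * (r y ^ 3 * r4 y)) (fun k hk y hy => by
        have a0 := d0 y hy
        have a1 := d1 y hy
        have a2 := d2 y hy
        have a3 := d3 y hy
        interval_cases k
        · exact (a0.pow 4).congr_deriv (by norm_num [Pi.pow_apply]; try ring)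
        · exact (((a0.pow 3).mul a1).const_mul 4).congr_deriv (by norm_num [Pi.pow_apply]; try ring)
        · exact ((((a0.pow 2).mul (a1.pow 2)).const_mul 12).add
            (((a0.pow 3).mul a2).const_mul 4)).congr_deriv (by norm_num [Pi.pow_apply]; try ring)
        · exact ((((a0.mul (a1.pow 3)).const_mul 24).add
            ((((a0.pow 2).mul a1).mul a2).const_mul 36)).add
            (((a0.pow 3).mul a3).const_mul 4)).congr_deriv
              (by simp only [Pi.pow_apply, Pi.mul_apply]; ring))
      4 le_rfl x hx
    refine this.trans ?_
    simp only [powPoly]; ring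
  · have := iteratedDeriv_eq_of_hasDerivAt (n := 5) (F := fun k y => match k with
      | 0 => r y ^ 5
      | 1 => 5 * (r y ^ 4 * r1 y)
      | 2 => 20 * (r y ^ 3 * r1 y ^ 2) + 5 * (r y ^ 4 * r2 y)
      | 3 => 60 * (r y ^ 2 * r1 y ^ 3) + 60 * (r y ^ 3 * r1 y * r2 y) + 5 * (r y ^ 4 * r3 y)
      | 4 => 120 * (r y * r1 y ^ 4) + 360 * (r y ^ 2 * r1 y ^ 2 * r2 y)
          + 60 * (r y ^ 3 * r2 y ^ 2) + 80 * (r y ^ 3 * r1 y * r3 y) + 5 * (r y ^ 4 * r4 y)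
      | _ => 120 * r1 y ^ 5 + 1200 * (r y * r1 y ^ 3 * r2 y) + 900 * (r y ^ 2 * r1 y * r2 y ^ 2)
          + 600 * (r y ^ 2 * r1 y ^ 2 * r3 y) + 200 * (r y ^ 3 * r2 y * r3 y)
          + 100 * (r y ^ 3 * r1 y * r4 y) + 5 * (r y ^ 4 * r5 y)) (fun k hk y hy => by
        have a0 := d0 y hy
        have a1 := d1 y hy
        have a2 := d2 y hy
        have a3 := d3 y hy
        have a4 := d4 y hy
        interval_cases k
        · exact (a0.pow 5).congr_deriv (by norm_num [Pi.pow_apply]; try ring)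
        · exact (((a0.pow 4).mul a1).const_mul 5).congr_deriv (by norm_num [Pi.pow_apply]; try ring)
        · exact ((((a0.pow 3).mul (a1.pow 2)).const_mul 20).add
            (((a0.pow 4).mul a2).const_mul 5)).congr_deriv (by norm_num [Pi.pow_apply]; try ring)
        · exact (((((a0.pow 2).mul (a1.pow 3)).const_mul 60).add
            ((((a0.pow 3).mul a1).mul a2).const_mul 60)).add
            (((a0.pow 4).mul a3).const_mul 5)).congr_deriv
              (by simp only [Pi.pow_apply, Pi.mul_apply]; ring)
        · exact ((((((a0.mul (a1.pow 4)).const_mul 120).add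
            ((((a0.pow 2).mul (a1.pow 2)).mul a2).const_mul 360)).add
            (((a0.pow 3).mul (a2.pow 2)).const_mul 60)).add
            ((((a0.pow 3).mul a1).mul a3).const_mul 80)).add
            (((a0.pow 4).mul a4).const_mul 5)).congr_deriv
              (by simp only [Pi.pow_apply, Pi.mul_apply]; ring))
      5 le_rfl x hx
    refine this.trans ?_
    simp only [powPoly]; ring

/-- If `g' = r ∘ g`, all derivatives of `g` are `r ∘ g` times a polynomial in the
`rⁱ r⁽ⁱ⁺¹⁾ ∘ g`. -/
lemma hasDerivAt_curve {r g : ℝ → ℝ} (hr : ContDiffOn ℝ 5 r (Ioi 0)) (hg : ∀ w, 0 < g w)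
    (hd : ∀ w, HasDerivAt g (r (g w)) w) {k : ℕ} (hk : k < 5) (w : ℝ) :
    HasDerivAt (fun w => r (g w) * curvePoly k (fun i => scaledDeriv r i (g w)))
      (r (g w) * curvePoly (k + 1) (fun i => scaledDeriv r i (g w))) w := by
  have d : ∀ k < 5, HasDerivAt (fun w => iteratedDeriv k r (g w))
      (iteratedDeriv (k + 1) r (g w) * r (g w)) w :=
    fun k hk => (hasDerivAt_iteratedDeriv (n := 5) (by exact_mod_cast hr) hk (hg w)).comp w (hd w)
  simp only [scaledDeriv]
  have a0 := d 0 (by norm_num)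
  have a1 := d 1 (by norm_num)
  have a2 := d 2 (by norm_num)
  have a3 := d 3 (by norm_num)
  have a4 := d 4 (by norm_num)
  simp only [iteratedDeriv_zero] at a0
  simp only [Nat.reduceAdd, zero_add] at a0 a1 a2 a3 a4 ⊢
  set r1 := iteratedDeriv 1 r
  set r2 := iteratedDeriv 2 r
  set r3 := iteratedDeriv 3 r
  set r4 := iteratedDeriv 4 r
  set r5 := iteratedDeriv 5 r
  have b0 : HasDerivAt (fun w => r (g w) ^ 0 * r1 (g w)) (r (g w) ^ 1 * r2 (g w)) w :=
    (a1.congr_of_eventuallyEq (Eventually.of_forall fun y => by simp)).congr_deriv (by ring)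
  have b1 := (a0.pow 1).mul a2
  have b2 := (a0.pow 2).mul a3
  have b3 := (a0.pow 3).mul a4
  interval_cases k
  · exact (a0.mul_const 1).congr_deriv (by simp only [curvePoly]; ring)
  · exact (a0.mul b0).congr_deriv (by simp only [curvePoly]; ring)
  · exact (a0.mul (b1.add (b0.pow 2))).congr_deriv (by
      simp only [curvePoly, Pi.pow_apply, Pi.mul_apply, Pi.add_apply]; ring)
  · exact (a0.mul ((b2.add ((b0.mul b1).const_mul 4)).add (b0.pow 3))).congr_deriv (by
      simp only [curvePoly, Pi.pow_apply, Pi.mul_apply, Pi.add_apply]; ring)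
  · exact (a0.mul ((((b3.add ((b0.mul b2).const_mul 7)).add ((b1.pow 2).const_mul 4)).add
      (((b0.pow 2).mul b1).const_mul 11)).add (b0.pow 4))).congr_deriv (by
      simp only [curvePoly, Pi.pow_apply, Pi.mul_apply, Pi.add_apply]; ring)

/-- A strictly increasing function with nonvanishing derivative between open sets has a
differentiable inverse. -/
lemma exists_hasDerivAt_inverse {f f' : ℝ → ℝ} {s t : Set ℝ} (hs : IsOpen s) (ht : IsOpen t)
    (hmono : StrictMonoOn f s) (him : f '' s = t) (hd : ∀ x ∈ s, HasDerivAt f (f' x) x)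
    (hne : ∀ x ∈ s, f' x ≠ 0) :
    ∃ g : ℝ → ℝ, (∀ y ∈ t, g y ∈ s ∧ f (g y) = y ∧ HasDerivAt g (f' (g y))⁻¹ y) ∧
      (∀ x ∈ s, g (f x) = x) ∧ StrictMonoOn g t := by
  have h0 : ∀ y : ℝ, ∃ x, y ∈ t → x ∈ s ∧ f x = y := by
    intro y
    by_cases hy : y ∈ t
    · rw [← him] at hy
      obtain ⟨x, hx, hxy⟩ := hy
      exact ⟨x, fun _ => ⟨hx, hxy⟩⟩
    · exact ⟨0, fun h => absurd h hy⟩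
  choose g hg using h0
  have hleft : ∀ x ∈ s, g (f x) = x := fun x hx => by
    have hfx : f x ∈ t := him ▸ mem_image_of_mem f hx
    exact hmono.injOn (hg _ hfx).1 hx (hg _ hfx).2
  have hgm : StrictMonoOn g t := by
    intro a ha b hb hab
    rw [← hmono.lt_iff_lt (hg a ha).1 (hg b hb).1, (hg a ha).2, (hg b hb).2]
    exact hab
  have hgi : g '' t = s := by
    ext x
    constructor
    · rintro ⟨y, hy, rfl⟩
      exact (hg y hy).1
    · intro hx
      exact ⟨f x, him ▸ mem_image_of_mem f hx, hleft x hx⟩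
  refine ⟨g, fun y hy => ⟨(hg y hy).1, (hg y hy).2, ?_⟩, hleft, hgm⟩
  have hcont : ContinuousAt g y := hgm.continuousAt_of_image_mem_nhds (ht.mem_nhds hy)
    (hgi ▸ hs.mem_nhds (hg y hy).1)
  exact HasDerivAt.of_local_left_inverse hcont (hd _ (hg y hy).1) (hne _ (hg y hy).1)
    (by filter_upwards [ht.mem_nhds hy] with z hz using (hg z hz).2)

/-! ### Utility functions in logarithmic marginal coordinates -/

namespace IsAdmissibleUtility

variable {U : ℝ → ℝ} (hU : IsAdmissibleUtility U)
include hU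

lemma tolerance_pos {x : ℝ} (hx : 0 < x) : 0 < riskTolerance U x := by
  have h1 : 0 ≤ riskTolerance U (x / 2) := by
    refine le_of_tendsto hU.tolerance_zero ?_
    filter_upwards [Ioo_mem_nhdsGT (show (0 : ℝ) < x / 2 by positivity)] with y hy
    exact (hU.tolerance_strictMono hy.1 (show 0 < x / 2 by positivity) hy.2).le
  exact h1.trans_lt (hU.tolerance_strictMono (show 0 < x / 2 by positivity) hx (by linarith))

lemma hasDerivAt {x : ℝ} (hx : 0 < x) : HasDerivAt U (deriv U x) x := by
  have := hasDerivAt_iteratedDeriv (n := 7) (by exact_mod_cast hU.contDiffOn) (k := 0)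
    (by norm_num) hx
  simpa [iteratedDeriv_one] using this

lemma hasDerivAt_deriv {x : ℝ} (hx : 0 < x) : HasDerivAt (deriv U) (iteratedDeriv 2 U x) x := by
  have := hasDerivAt_iteratedDeriv (n := 7) (by exact_mod_cast hU.contDiffOn) (k := 1)
    (by norm_num) hx
  simpa [iteratedDeriv_one] using this

lemma deriv_pos {x : ℝ} (hx : 0 < x) : 0 < deriv U x := by
  have h0 : 0 ≤ deriv U x := by
    refine ge_of_tendsto (hU.hasDerivAt hx).tendsto_slope ?_
    rw [eventually_nhdsWithin_iff]
    filter_upwards [Ioi_mem_nhds hx] with y hy hne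
    rw [slope_def_field]
    rcases lt_or_gt_of_ne hne with h | h
    · exact div_nonneg_of_nonpos (by linarith [hU.strictMonoOn hy hx h]) (by linarith)
    · exact div_nonneg (by linarith [hU.strictMonoOn hx hy h]) (by linarith)
  refine h0.lt_of_ne fun h => ?_
  have := hU.tolerance_pos hx
  simp [riskTolerance, ← h] at this

lemma iteratedDeriv_two_neg {x : ℝ} (hx : 0 < x) : iteratedDeriv 2 U x < 0 := by
  have h1 := hU.tolerance_pos hx
  have h2 := hU.deriv_pos hx
  by_contra! h
  have : 0 ≤ deriv U x / iteratedDeriv 2 U x := div_nonneg h2.le h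
  unfold riskTolerance at h1
  linarith

lemma contDiffOn_tolerance : ContDiffOn ℝ 5 (riskTolerance U) (Ioi 0) := by
  have h1 : ContDiffOn ℝ 6 (deriv U) (Ioi 0) :=
    hU.contDiffOn.deriv_of_isOpen isOpen_Ioi (by norm_num)
  have h2 : ContDiffOn ℝ 5 (iteratedDeriv 2 U) (Ioi 0) := by
    rw [iteratedDeriv_succ, iteratedDeriv_one]
    exact h1.deriv_of_isOpen isOpen_Ioi (by norm_num)
  exact ((h1.of_le (by norm_num)).div h2 fun x hx => (hU.iteratedDeriv_two_neg hx).ne).neg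

lemma hasDerivAt_tolerance {x : ℝ} (hx : 0 < x) :
    HasDerivAt (riskTolerance U) (deriv (riskTolerance U) x) x := by
  have := hasDerivAt_iteratedDeriv (n := 5) (by exact_mod_cast hU.contDiffOn_tolerance) (k := 0)
    (by norm_num) hx
  simpa [iteratedDeriv_one] using this

/-- The bound on `(R²)''` controls `R'`, by the interpolation inequality `(f')² ≤ 4 K f` for
nonnegative `f` with `f'' ≤ K`. On a half-line the interpolation needs `f' ≤ K x`, and this is
where `R(x) = O(x)` enters. -/
lemma exists_abs_deriv_tolerance_le :
    ∃ c, 0 < c ∧ ∀ x, 0 < x → |deriv (riskTolerance U) x| ≤ c := by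
  obtain ⟨K₀, hK₀⟩ := hU.tolerance_bound
  set K := |K₀| + 1 with hKdef
  have hK : 0 < K := by positivity
  set R := riskTolerance U with hR
  set f : ℝ → ℝ := fun y => R y ^ 2 with hf
  have hfs : ContDiffOn ℝ 5 f (Ioi 0) := hU.contDiffOn_tolerance.pow 2
  have d0 : ∀ x, 0 < x → HasDerivAt f (deriv f x) x := fun x hx => by
    have := hasDerivAt_iteratedDeriv (n := 5) (by exact_mod_cast hfs) (k := 0) (by norm_num) hx
    simpa [iteratedDeriv_one] using this
  have d1 : ∀ x, 0 < x → HasDerivAt (deriv f) (iteratedDeriv 2 f x) x := fun x hx => by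
    have := hasDerivAt_iteratedDeriv (n := 5) (by exact_mod_cast hfs) (k := 1) (by norm_num) hx
    simpa [iteratedDeriv_one] using this
  have hbd : ∀ x, 0 < x → iteratedDeriv 2 f x ≤ K := fun x hx => by
    have := hK₀ 2 le_rfl (by norm_num) x hx
    linarith [le_abs_self (iteratedDeriv 2 f x), le_abs_self K₀]
  have hf' : ∀ x, 0 < x → deriv f x = 2 * R x * deriv R x := fun x hx => by
    have := ((hU.hasDerivAt_tolerance hx).pow 2).deriv
    rw [show f = riskTolerance U ^ 2 from rfl, this]
    simp [hR]
  have hR' : ∀ x, 0 < x → 0 ≤ deriv R x := fun x hx => by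
    refine ge_of_tendsto (hU.hasDerivAt_tolerance hx).tendsto_slope ?_
    rw [eventually_nhdsWithin_iff]
    filter_upwards [Ioi_mem_nhds hx] with y hy hne
    rw [slope_def_field]
    rcases lt_or_gt_of_ne hne with h | h
    · exact div_nonneg_of_nonpos (by linarith [hU.tolerance_strictMono hy hx h]) (by linarith)
    · exact div_nonneg (by linarith [hU.tolerance_strictMono hx hy h]) (by linarith)
  have growth : ∀ a b, 0 < a → a ≤ b → deriv f b - deriv f a ≤ K * (b - a) := by
    intro a b ha hab
    refine Convex.image_sub_le_mul_sub_of_deriv_le (convex_Ioi (0 : ℝ))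
      (fun y hy => (d1 y hy).continuousAt.continuousWithinAt)
      (fun y hy => ?_) (fun y hy => ?_) a ha b (ha.trans_le hab) hab
    · rw [interior_Ioi] at hy; exact (d1 y hy).differentiableAt.differentiableWithinAt
    · rw [interior_Ioi] at hy; rw [(d1 y hy).deriv]; exact hbd y hy
  have hlin : ∀ x, 0 < x → deriv f x ≤ K * x := by
    intro x hx
    refine le_of_forall_pos_le_add fun η hη => ?_
    obtain ⟨C, hC⟩ := hU.tolerance_deriv_zero
    have hCev := (hC.and (Ioo_mem_nhdsGT (show (0 : ℝ) < min x (η / (2 * (C ^ 2 + 1))) by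
      positivity))).exists
    obtain ⟨e, heC, he0, he⟩ := hCev
    have hex := he.trans_le (min_le_left _ _)
    have heη := he.trans_le (min_le_right _ _)
    have hRe : R e ≤ C * e := by rwa [div_le_iff₀ he0] at heC
    have hRpos := hU.tolerance_pos he0
    have hfe : f e ≤ C ^ 2 * e ^ 2 := by
      simp only [hf]; rw [← mul_pow]; exact pow_le_pow_left₀ hRpos.le hRe 2
    obtain ⟨y, hy, hyeq⟩ := exists_deriv_eq_slope f (show e / 2 < e by linarith)
      (fun z hz => (d0 z (by linarith [hz.1])).continuousAt.continuousWithinAt)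
      (fun z hz => (d0 z (by linarith [hz.1])).differentiableAt.differentiableWithinAt)
    have hy0 : 0 < y := by linarith [hy.1]
    have hfy : deriv f y ≤ η := by
      rw [hyeq, div_le_iff₀ (by linarith)]
      have : 0 ≤ f (e / 2) := sq_nonneg _
      rw [lt_div_iff₀ (by positivity)] at heη
      nlinarith [sq_nonneg C]
    have := growth y x hy0 (by linarith [hy.2])
    nlinarith
  refine ⟨K, hK, fun x hx => ?_⟩
  rw [abs_of_nonneg (hR' x hx)]
  have hRx := hU.tolerance_pos hx
  rcases (hR' x hx).eq_or_lt with h0 | h0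
  · rw [← h0]; exact hK.le
  set m := deriv f x with hm
  have hm0 : 0 < m := by rw [hm, hf' x hx]; positivity
  -- on `[x - m / (2K), x]` the derivative of `f` stays above `m / 2`
  set δ := m / (2 * K) with hδ
  have hδ0 : 0 < δ := by positivity
  have hδx : δ < x := by
    rw [hδ, div_lt_iff₀ (by positivity)]
    nlinarith [hlin x hx]
  have hlow : m / 2 * (x - (x - δ)) ≤ f x - f (x - δ) := by
    refine Convex.mul_sub_le_image_sub_of_le_deriv (convex_Icc (x - δ) x)
      (fun y hy => (d0 y (by linarith [hy.1])).continuousAt.continuousWithinAt)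
      (fun y hy => ?_) (fun y hy => ?_) (x - δ) (by simp [hδ0.le]) x (by simp [hδ0.le])
      (by linarith)
    · rw [interior_Icc] at hy
      exact (d0 y (by linarith [hy.1])).differentiableAt.differentiableWithinAt
    · rw [interior_Icc] at hy
      have h1 := growth y x (by linarith [hy.1]) hy.2.le
      have h2 : K * (x - y) ≤ K * δ := by gcongr; linarith [hy.1]
      have h3 : K * δ = m / 2 := by rw [hδ]; field_simp
      linarith
  have hpos : 0 ≤ f (x - δ) := sq_nonneg _
  have hmf : m ^ 2 ≤ 4 * K * f x := by
    have : m / 2 * (x - (x - δ)) = m ^ 2 / (4 * K) := by rw [hδ]; field_simp; ring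
    rw [this] at hlow
    have := (div_le_iff₀ (by positivity)).1 (hlow.trans (by linarith : _ ≤ f x))
    linarith
  rw [hm, hf' x hx] at hmf
  have h4 : deriv R x ^ 2 ≤ K := by
    have : (4 * R x ^ 2) * deriv R x ^ 2 ≤ (4 * R x ^ 2) * K := by
      simp only [hf] at hmf; nlinarith
    exact le_of_mul_le_mul_left this (by positivity)
  have hK1 : 1 ≤ K := by rw [hKdef]; linarith [abs_nonneg K₀]
  nlinarith

lemma tolerance_le {c : ℝ} (hc : ∀ x, 0 < x → |deriv (riskTolerance U) x| ≤ c) {x : ℝ}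
    (hx : 0 < x) : riskTolerance U x ≤ c * x := by
  have hc0 : 0 ≤ c := (abs_nonneg _).trans (hc x hx)
  have hev : ∀ᶠ e in 𝓝[>] (0 : ℝ), riskTolerance U x - c * x ≤ riskTolerance U e := by
    filter_upwards [Ioo_mem_nhdsGT hx] with e he
    have := Convex.image_sub_le_mul_sub_of_deriv_le (convex_Ioi (0 : ℝ)) (f := riskTolerance U)
      (C := c) (fun y hy => (hU.hasDerivAt_tolerance hy).continuousAt.continuousWithinAt)
      (fun y hy => by
        rw [interior_Ioi] at hy
        exact (hU.hasDerivAt_tolerance hy).differentiableAt.differentiableWithinAt)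
      (fun y hy => by rw [interior_Ioi] at hy; exact (le_abs_self _).trans (hc y hy))
      e he.1 x hx he.2.le
    nlinarith [he.1]
  linarith [ge_of_tendsto hU.tolerance_zero hev]

/-- All the scale-invariant derivatives `Rʲ R⁽ʲ⁺¹⁾`, `j ≤ 4`, are bounded. -/
lemma uniformlyBounded_scaledDeriv :
    ∀ j ≤ 4, UniformlyBounded (fun x : Ioi (0 : ℝ) => scaledDeriv (riskTolerance U) j x) := by
  obtain ⟨c, -, hc⟩ := hU.exists_abs_deriv_tolerance_le
  obtain ⟨K, hK⟩ := hU.tolerance_bound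
  refine uniformlyBounded_of_powPoly ⟨c, fun x => ?_⟩ fun j h2 h5 => ⟨K, fun x => ?_⟩
  · simpa [scaledDeriv, iteratedDeriv_one] using hc x x.2
  · have := hK j h2 h5 x x.2
    rwa [iteratedDeriv_pow_eq hU.contDiffOn_tolerance (by omega) h5 x.2] at this

/-- The wealth `G(w)` at which marginal utility equals `e⁻ʷ`: it solves `G' = R ∘ G`. -/
lemma exists_wealth_curve :
    ∃ G : ℝ → ℝ, (∀ w, 0 < G w) ∧ (∀ w, deriv U (G w) = Real.exp (-w)) ∧
      (∀ w, HasDerivAt G (riskTolerance U (G w)) w) ∧ StrictMono G ∧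
      Tendsto G atBot (𝓝 0) ∧ Tendsto G atTop atTop := by
  set ℓ : ℝ → ℝ := fun x => -Real.log (deriv U x) with hℓ
  have hd : ∀ x ∈ Ioi (0 : ℝ), HasDerivAt ℓ (riskTolerance U x)⁻¹ x := by
    intro x hx
    refine (((hU.hasDerivAt_deriv hx).log (hU.deriv_pos hx).ne').neg).congr_deriv ?_
    rw [riskTolerance, inv_neg, inv_div]
  have hcont : ContinuousOn ℓ (Ioi 0) := fun x hx => (hd x hx).continuousAt.continuousWithinAt
  have hmono : StrictMonoOn ℓ (Ioi 0) := by
    refine strictMonoOn_of_deriv_pos (convex_Ioi 0) hcont fun x hx => ?_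
    rw [interior_Ioi] at hx
    rw [(hd x hx).deriv]
    exact inv_pos.2 (hU.tolerance_pos hx)
  have h0 : Tendsto ℓ (𝓝[>] 0) atBot :=
    tendsto_neg_atTop_atBot.comp (Real.tendsto_log_atTop.comp hU.inada_zero)
  have h1 : Tendsto ℓ atTop atTop := by
    refine tendsto_neg_atBot_atTop.comp (Real.tendsto_log_nhdsGT_zero.comp ?_)
    exact tendsto_nhdsWithin_iff.2 ⟨hU.inada_top, by
      filter_upwards [eventually_gt_atTop 0] with x hx using hU.deriv_pos hx⟩
  have him : ℓ '' Ioi 0 = univ := by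
    refine eq_univ_of_forall fun w => ?_
    obtain ⟨a, haw, ha⟩ := ((h0.eventually (eventually_le_atBot w)).and
      self_mem_nhdsWithin).exists
    obtain ⟨b, hbw, hab⟩ := ((h1.eventually (eventually_ge_atTop w)).and
      (eventually_ge_atTop a)).exists
    have := intermediate_value_Icc hab (hcont.mono fun y hy => lt_of_lt_of_le ha hy.1)
    obtain ⟨y, hy, hyw⟩ := this ⟨haw, hbw⟩
    exact ⟨y, lt_of_lt_of_le ha hy.1, hyw⟩
  obtain ⟨G, hG, hleft, hGm⟩ := exists_hasDerivAt_inverse isOpen_Ioi isOpen_univ hmono him hd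
    (fun x hx => (inv_pos.2 (hU.tolerance_pos hx)).ne')
  have hpos : ∀ w, 0 < G w := fun w => (hG w (mem_univ w)).1
  have hmonoG : StrictMono G := fun a b hab => hGm (mem_univ a) (mem_univ b) hab
  refine ⟨G, hpos, fun w => ?_, fun w => ?_, hmonoG, ?_, ?_⟩
  · have h := (hG w (mem_univ w)).2.1
    rw [← Real.exp_log (hU.deriv_pos (hpos w))]
    congr 1
    simp only [hℓ] at h
    linarith
  · simpa using (hG w (mem_univ w)).2.2
  · rw [Metric.tendsto_nhds]
    intro ε hε
    filter_upwards [eventually_lt_atBot (ℓ ε)] with w hw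
    rw [Real.dist_eq, sub_zero, abs_of_pos (hpos w)]
    calc G w < G (ℓ ε) := hmonoG hw
      _ = ε := hleft ε hε
  · refine tendsto_atTop.2 fun A => ?_
    have hA : (0 : ℝ) < |A| + 1 := by positivity
    filter_upwards [eventually_ge_atTop (ℓ (|A| + 1))] with w hw
    calc A ≤ |A| + 1 := by linarith [le_abs_self A]
      _ = G (ℓ (|A| + 1)) := (hleft _ hA).symm
      _ ≤ G w := hmonoG.monotone hw

lemma le_tangent {x y : ℝ} (hx : 0 ≤ x) (hy : 0 < y) : U x ≤ U y + deriv U y * (x - y) := by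
  have hpos : ∀ x, 0 < x → U x ≤ U y + deriv U y * (x - y) := by
    intro x hx
    have hc := hU.strictConcaveOn.concaveOn
    rcases lt_trichotomy x y with h | h | h
    · have := hc.le_slope_of_hasDerivAt hx hy h (hU.hasDerivAt hy)
      rw [slope_def_field, le_div_iff₀ (by linarith)] at this
      linarith
    · simp [h]
    · have := hc.slope_le_of_hasDerivAt hy hx h (hU.hasDerivAt hy)
      rw [slope_def_field, div_le_iff₀ (by linarith)] at this
      linarith
  rcases hx.eq_or_lt with rfl | hx
  · rw [hU.map_zero]
    have hlim : Tendsto (fun x => U y + deriv U y * (x - y)) (𝓝[>] 0)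
        (𝓝 (U y + deriv U y * (0 - y))) := by
      apply Tendsto.mono_left _ nhdsWithin_le_nhds
      exact Continuous.tendsto (by fun_prop) 0
    exact le_of_tendsto_of_tendsto hU.tendsto_zero hlim (by
      filter_upwards [self_mem_nhdsWithin] with x hx using hpos x hx)
  · exact hpos x hx

lemma nonneg {x : ℝ} (hx : 0 ≤ x) : 0 ≤ U x := by
  rcases hx.eq_or_lt with rfl | hx
  · rw [hU.map_zero]
  · refine le_of_tendsto hU.tendsto_zero ?_
    filter_upwards [Ioo_mem_nhdsGT hx] with y hy
    exact (hU.strictMonoOn hy.1 hx hy.2).le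

end IsAdmissibleUtility

/-- The wealth curve `G = g 0` of a utility function `U`, parametrised by the logarithmic marginal
utility, `U'(G(w)) = e⁻ʷ`, together with its derivatives `g k`, `k ≤ 6`. -/
structure IsWealthCurve (U : ℝ → ℝ) (g : ℕ → ℝ → ℝ) : Prop where
  pos : ∀ w, 0 < g 0 w
  pos_one : ∀ w, 0 < g 1 w
  hasDerivAt : ∀ k < 6, ∀ w, HasDerivAt (g k) (g (k + 1) w) w
  continuous : ∀ k ≤ 6, Continuous (g k)
  expBounded : ∀ k ≤ 6, ExpBounded (g k)
  bound : ∃ C, 0 < C ∧ (∀ k, 1 ≤ k → k ≤ 6 → ∀ w, |g k w| ≤ C * g 1 w) ∧ ∀ w, g 1 w ≤ C * g 0 w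
  tendsto_atBot : Tendsto (g 0) atBot (𝓝 0)
  tendsto_atTop : Tendsto (g 0) atTop atTop
  monotone : Monotone (g 0)
  utility_hasDerivAt : ∀ w, HasDerivAt (fun w => U (g 0 w)) (Real.exp (-w) * g 1 w) w
  utility_expBounded : ExpBounded (fun w => U (g 0 w))
  /-- Fenchel's inequality: `U` lies below its tangent at `g 0 w`, whose slope is `e⁻ʷ`. -/
  utility_le : ∀ w x, 0 ≤ x → U x ≤ U (g 0 w) + Real.exp (-w) * (x - g 0 w)
  utility_nonneg : ∀ x, 0 ≤ x → 0 ≤ U x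

lemma ExpBounded.of_abs_le {f g : ℝ → ℝ} (hg : ExpBounded g) {C : ℝ} (hC : 0 ≤ C)
    (h : ∀ w, |f w| ≤ C * |g w|) : ExpBounded f := by
  obtain ⟨D, c, hD, hc, hg⟩ := hg
  refine ⟨C * D, c, by positivity, hc, fun w => (h w).trans ?_⟩
  rw [mul_assoc]
  gcongr
  exact hg w

/-- A positive function whose logarithmic derivative lies in `[0, c]` grows at most
exponentially. -/
lemma expBounded_of_deriv_le {f f' : ℝ → ℝ} {c : ℝ} (hpos : ∀ w, 0 < f w)
    (hd : ∀ w, HasDerivAt f (f' w) w) (h0 : ∀ w, 0 ≤ f' w) (hc : ∀ w, f' w ≤ c * f w) :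
    ExpBounded f := by
  have hc0 : 0 ≤ c := by
    have := (h0 0).trans (hc 0)
    exact nonneg_of_mul_nonneg_left this (hpos 0)
  have hlog : ∀ w, HasDerivAt (fun w => Real.log (f w)) (f' w / f w) w :=
    fun w => (hd w).log (hpos w).ne'
  refine ⟨f 0, c, (hpos 0).le, hc0, fun w => ?_⟩
  have := Convex.norm_image_sub_le_of_norm_deriv_le (f := fun w => Real.log (f w)) (C := c)
    (s := univ) (x := 0) (y := w) (fun x _ => (hlog x).differentiableAt) (fun x _ => by
      rw [(hlog x).deriv, Real.norm_eq_abs, abs_of_nonneg (div_nonneg (h0 x) (hpos x).le),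
        div_le_iff₀ (hpos x)]
      exact hc x) convex_univ (mem_univ _) (mem_univ _)
  rw [sub_zero, Real.norm_eq_abs, Real.norm_eq_abs] at this
  rw [abs_of_pos (hpos w)]
  calc f w = Real.exp (Real.log (f 0) + (Real.log (f w) - Real.log (f 0))) := by
        rw [add_sub_cancel, Real.exp_log (hpos w)]
    _ ≤ Real.exp (Real.log (f 0) + c * |w|) := by
        gcongr
        exact (le_abs_self _).trans this
    _ = _ := by rw [Real.exp_add, Real.exp_log (hpos 0)]

lemma continuous_curvePoly_five {b : ℕ → ℝ → ℝ} (h : ∀ j ≤ 4, Continuous (b j)) :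
    Continuous (fun w => curvePoly 5 (fun i => b i w)) := by
  have c0 := h 0 (by norm_num)
  have c1 := h 1 (by norm_num)
  have c2 := h 2 (by norm_num)
  have c3 := h 3 (by norm_num)
  have c4 := h 4 (by norm_num)
  simp only [curvePoly]
  fun_prop

/-- The growth of the wealth curve comes from `R(x) ≤ c x`, that is, from `G' ≤ c G`. -/
lemma IsAdmissibleUtility.exists_isWealthCurve {U : ℝ → ℝ} (hU : IsAdmissibleUtility U) :
    ∃ g, IsWealthCurve U g := by
  obtain ⟨G, hpos, hmarg, hd, hmono, hbot, htop⟩ := hU.exists_wealth_curve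
  set R := riskTolerance U with hR
  have hRG : ∀ w, 0 < R (G w) := fun w => hU.tolerance_pos (hpos w)
  set g : ℕ → ℝ → ℝ := fun k w => match k with
    | 0 => G w
    | k + 1 => R (G w) * curvePoly k (fun i => scaledDeriv R i (G w)) with hg
  have hg1 : ∀ w, g 1 w = R (G w) := fun w => by simp [hg, curvePoly]
  have hder : ∀ k < 6, ∀ w, HasDerivAt (g k) (g (k + 1) w) w := by
    intro k hk w
    rcases k with _ | k
    · rw [zero_add, hg1]; exact hd w
    · exact hasDerivAt_curve hU.contDiffOn_tolerance hpos hd (by omega) w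
  have hsc : ∀ j ≤ 4, ContinuousOn (scaledDeriv R j) (Ioi 0) := fun j hj =>
    (hU.contDiffOn_tolerance.continuousOn.pow j).mul
      (continuousOn_iteratedDeriv (n := 5) (by exact_mod_cast hU.contDiffOn_tolerance)
        (by omega))
  have hGc : Continuous G := continuous_iff_continuousAt.2 fun w => (hd w).continuousAt
  have hscG : ∀ j ≤ 4, Continuous (fun w => scaledDeriv R j (G w)) := fun j hj =>
    (hsc j hj).comp_continuous hGc hpos
  have hcont : ∀ k ≤ 6, Continuous (g k) := by
    intro k hk
    rcases hk.lt_or_eq with h | rfl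
    · exact continuous_iff_continuousAt.2 fun w => (hder k h w).continuousAt
    · exact (hU.contDiffOn_tolerance.continuousOn.comp_continuous hGc hpos).mul
        (continuous_curvePoly_five hscG)
  obtain ⟨c, hc0, hc⟩ := hU.exists_abs_deriv_tolerance_le
  have hub : ∀ k, 1 ≤ k → k ≤ 6 → ∃ C, ∀ w, |g k w| ≤ C * g 1 w := by
    intro k h1 h6
    obtain ⟨k, rfl⟩ : ∃ m, k = m + 1 := ⟨k - 1, by omega⟩
    obtain ⟨C, hC⟩ := uniformlyBounded_curvePoly (b := fun j (x : Ioi (0 : ℝ)) =>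
      scaledDeriv R j x) hU.uniformlyBounded_scaledDeriv (k := k) (by omega)
    refine ⟨C, fun w => ?_⟩
    have := hC ⟨G w, hpos w⟩
    rw [hg1]
    simp only [hg]
    rw [abs_mul, abs_of_pos (hRG w), mul_comm]
    exact mul_le_mul_of_nonneg_right this (hRG w).le
  choose! C hC using hub
  set D := c + ∑ k ∈ Finset.range 7, |C k| with hD
  have hDpos : 0 < D := by positivity
  have hbound : (∀ k, 1 ≤ k → k ≤ 6 → ∀ w, |g k w| ≤ D * g 1 w) ∧ ∀ w, g 1 w ≤ D * g 0 w := by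
    constructor
    · intro k h1 h6 w
      refine (hC k h1 h6 w).trans ?_
      rw [hg1]
      have h2 : |C k| ≤ ∑ k ∈ Finset.range 7, |C k| :=
        Finset.single_le_sum (f := fun k => |C k|) (fun _ _ => abs_nonneg _)
          (Finset.mem_range.2 (by omega))
      exact mul_le_mul_of_nonneg_right (by linarith [le_abs_self (C k)]) (hRG w).le
    · intro w
      rw [hg1]
      refine (hU.tolerance_le hc (hpos w)).trans ?_
      have : 0 ≤ ∑ k ∈ Finset.range 7, |C k| := Finset.sum_nonneg fun _ _ => abs_nonneg _
      exact mul_le_mul_of_nonneg_right (by linarith) (hpos w).le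
  have hexp0 : ExpBounded (g 0) := expBounded_of_deriv_le hpos (fun w => hder 0 (by norm_num) w)
    (fun w => by rw [zero_add, hg1]; exact (hRG w).le) (fun w => hbound.2 w)
  have hexp1 : ExpBounded (g 1) := hexp0.of_abs_le hDpos.le fun w => by
    rw [hg1, abs_of_pos (hRG w), abs_of_pos (hpos w), ← hg1]; exact hbound.2 w
  have hUd : ∀ w, HasDerivAt (fun w => U (g 0 w)) (Real.exp (-w) * g 1 w) w := fun w => by
    have := (hU.hasDerivAt (hpos w)).comp w (hd w)
    rw [hmarg] at this
    rw [hg1]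
    exact this
  have hFen : ∀ w x, 0 ≤ x → U x ≤ U (g 0 w) + Real.exp (-w) * (x - g 0 w) := fun w x hx => by
    have := hU.le_tangent hx (hpos w)
    rwa [hmarg] at this
  refine ⟨g, hpos, fun w => by rw [hg1]; exact hRG w, hder, hcont, ?_, ⟨D, hDpos, hbound⟩,
    hbot, htop, hmono.monotone, hUd, ?_, hFen, fun x => hU.nonneg⟩
  · intro k hk
    rcases k with _ | k
    · exact hexp0
    · refine hexp1.of_abs_le hDpos.le fun w => (hbound.1 _ (by omega) hk w).trans ?_
      rw [abs_of_pos (by rw [hg1]; exact hRG w)]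
  · obtain ⟨A, a, hA, ha, hGa⟩ := hexp0
    -- `U` lies below its tangent at `G(0)`, which has slope `1`
    have hU0 : 0 ≤ U (g 0 0) := hU.nonneg (hpos 0).le
    refine ⟨U (g 0 0) + A, a, by positivity, ha, fun w => ?_⟩
    rw [abs_of_nonneg (hU.nonneg (hpos w).le)]
    have h1 := hFen 0 (g 0 w) (hpos w).le
    have h2 := hGa w
    rw [abs_of_pos (hpos w)] at h2
    have h3 : 1 ≤ Real.exp (a * |w|) := Real.one_le_exp (by positivity)
    have h4 : U (g 0 0) ≤ U (g 0 0) * Real.exp (a * |w|) := le_mul_of_one_le_right hU0 h3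
    have h5 : 0 < g 0 0 := hpos 0
    simp only [neg_zero, Real.exp_zero, one_mul] at h1
    linarith

/-! ### The heat flow of the wealth curve and its risk tolerance -/

lemma ExpBounded.exp_neg_mul {f : ℝ → ℝ} (hf : ExpBounded f) :
    ExpBounded (fun w => Real.exp (-w) * f w) := by
  obtain ⟨C, c, hC, hc, h⟩ := hf
  refine ⟨C, c + 1, hC, by linarith, fun w => ?_⟩
  rw [abs_mul, abs_of_pos (Real.exp_pos _)]
  calc Real.exp (-w) * |f w| ≤ Real.exp |w| * (C * Real.exp (c * |w|)) := by
        gcongr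
        · exact neg_le_abs w
        · exact h w
    _ = _ := by rw [add_mul, one_mul, Real.exp_add]; ring

namespace IsWealthCurve

variable {U : ℝ → ℝ} {g : ℕ → ℝ → ℝ} (hg : IsWealthCurve U g)
include hg

lemma hasDerivAt_heat {k : ℕ} (hk : k < 6) (q w : ℝ) :
    HasDerivAt (heat (g k) q) (heat (g (k + 1)) q w) w :=
  _root_.hasDerivAt_heat (hg.expBounded k (by omega)) (hg.expBounded (k + 1) (by omega))
    (hg.hasDerivAt k hk) (hg.continuous (k + 1) (by omega)) q w

lemma continuous_heat {k : ℕ} (hk : k ≤ 6) (q : ℝ) : Continuous (heat (g k) q) :=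
  (_root_.continuous_heat (hg.expBounded k hk) (hg.continuous k hk)).comp
    (Continuous.prodMk_right q)

lemma heat_pos (q w : ℝ) : 0 < heat (g 0) q w :=
  _root_.heat_pos (hg.expBounded 0 (by norm_num)) (hg.continuous 0 (by norm_num)) hg.pos q w

lemma heat_one_pos (q w : ℝ) : 0 < heat (g 1) q w :=
  _root_.heat_pos (hg.expBounded 1 (by norm_num)) (hg.continuous 1 (by norm_num)) hg.pos_one q w

/-- The inverse of the heat flow of the wealth curve is as smooth as the curve. -/
lemma exists_inverse_heat (q : ℝ) :
    ∃ ξ : ℝ → ℝ, (∀ x, 0 < x → heat (g 0) q (ξ x) = x ∧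
      HasDerivAt ξ (heat (g 1) q (ξ x))⁻¹ x) ∧ (∀ w, ξ (heat (g 0) q w) = w) ∧
      ContDiffOn ℝ 6 ξ (Ioi 0) := by
  have hmono : StrictMonoOn (heat (g 0) q) univ := by
    refine (strictMono_of_deriv_pos fun w => ?_).strictMonoOn _
    rw [(hg.hasDerivAt_heat (k := 0) (by norm_num) q w).deriv]
    exact hg.heat_one_pos q w
  have h0 := tendsto_heat_atBot (hg.expBounded 0 (by norm_num)) (hg.continuous 0 (by norm_num))
    hg.pos hg.monotone hg.tendsto_atBot q
  have h1 := tendsto_heat_atTop (hg.expBounded 0 (by norm_num)) (hg.continuous 0 (by norm_num))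
    hg.pos hg.monotone hg.tendsto_atTop q
  have him : heat (g 0) q '' univ = Ioi 0 := by
    ext x
    constructor
    · rintro ⟨w, -, rfl⟩
      exact hg.heat_pos q w
    · intro hx
      obtain ⟨a, ha⟩ := (h0.eventually (eventually_lt_nhds hx)).exists
      obtain ⟨b, hb, hab⟩ := ((h1.eventually (eventually_ge_atTop x)).and
        (eventually_ge_atTop a)).exists
      obtain ⟨w, -, hw⟩ := intermediate_value_Icc hab
        (hg.continuous_heat (k := 0) (by norm_num) q).continuousOn ⟨ha.le, hb⟩
      exact ⟨w, mem_univ w, hw⟩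
  obtain ⟨ξ, hξ, hleft, -⟩ := exists_hasDerivAt_inverse isOpen_univ isOpen_Ioi hmono him
    (fun w _ => hg.hasDerivAt_heat (k := 0) (by norm_num) q w)
    (fun w _ => (hg.heat_one_pos q w).ne')
  have hsm : ContDiff ℝ 5 (heat (g 1) q) := by
    have := contDiff_of_hasDerivAt (n := 5) (F := fun k => heat (g (k + 1)) q)
      (fun k hk w => hg.hasDerivAt_heat (k := k + 1) (by omega) q w)
      (hg.continuous_heat (k := 6) le_rfl q)
    exact_mod_cast this
  have hcd : ∀ n : ℕ, n ≤ 6 → ContDiffOn ℝ n ξ (Ioi 0) := by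
    intro n
    induction n with
    | zero =>
      intro _
      rw [Nat.cast_zero, contDiffOn_zero]
      exact fun x hx => ((hξ x hx).2.2).continuousAt.continuousWithinAt
    | succ n ih =>
      intro hn
      rw [Nat.cast_succ, contDiffOn_succ_iff_deriv_of_isOpen isOpen_Ioi]
      refine ⟨fun x hx => ((hξ x hx).2.2).differentiableAt.differentiableWithinAt,
        fun h => by simp at h, ?_⟩
      have : ContDiffOn ℝ n (fun x => (heat (g 1) q (ξ x))⁻¹) (Ioi 0) :=
        ((hsm.of_le (by exact_mod_cast (by omega : n ≤ 5))).comp_contDiffOn (ih (by omega))).inv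
          fun x _ => (hg.heat_one_pos q _).ne'
      exact this.congr fun x hx => ((hξ x hx).2.2).deriv
  exact ⟨ξ, fun x hx => (hξ x hx).2, fun w => hleft w (mem_univ w), hcd 6 le_rfl⟩

/-- If the value function is the heat flow of utility along the heat flow of wealth, its risk
tolerance is the derivative of the heat flow of the wealth curve. -/
lemma value_regularity {M : ℝ → ℝ} {q : ℝ}
    (hM : ∀ w, M (heat (g 0) q w) = heat (fun w => U (g 0 w)) q (w + q ^ 2)) :
    ContDiffOn ℝ 2 M (Ioi 0) ∧ (∀ x, 0 < x → iteratedDeriv 2 M x < 0) ∧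
      ContDiffOn ℝ 5 (riskTolerance M) (Ioi 0) ∧
      ∀ w, riskTolerance M (heat (g 0) q w) = heat (g 1) q w := by
  obtain ⟨ξ, hξ, hleft, hsm⟩ := hg.exists_inverse_heat q
  have hd1 : ∀ x, 0 < x → HasDerivAt M (Real.exp (-ξ x - q ^ 2 / 2)) x := by
    intro x hx
    have hF := _root_.hasDerivAt_heat hg.utility_expBounded
      (hg.expBounded 1 (by norm_num)).exp_neg_mul hg.utility_hasDerivAt
      (by have := hg.continuous 1 (by norm_num); fun_prop) q (ξ x + q ^ 2)
    have hcomp := hF.comp x ((hξ x hx).2.add_const (q ^ 2))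
    rw [heat_exp_neg_mul, add_sub_cancel_right, mul_assoc,
      mul_inv_cancel₀ (hg.heat_one_pos q _).ne', mul_one] at hcomp
    refine (hcomp.congr_of_eventuallyEq ?_).congr_deriv (by congr 1; ring)
    filter_upwards [Ioi_mem_nhds hx] with y hy
    rw [← (hξ y hy).1, hM, Function.comp_apply, hleft]
  have hderiv : EqOn (deriv M) (fun x => Real.exp (-ξ x - q ^ 2 / 2)) (Ioi 0) :=
    fun x hx => (hd1 x hx).deriv
  have hd2 : ∀ x, 0 < x → iteratedDeriv 2 M x =
      -(Real.exp (-ξ x - q ^ 2 / 2) * (heat (g 1) q (ξ x))⁻¹) := by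
    intro x hx
    rw [iteratedDeriv_succ, iteratedDeriv_one]
    have := (((hξ x hx).2.neg).sub_const (q ^ 2 / 2)).exp
    refine ((this.congr_of_eventuallyEq ?_).congr_deriv (by simp only [Pi.neg_apply]; ring)).deriv
    filter_upwards [Ioi_mem_nhds hx] with y hy using hderiv hy
  have hrisk : ∀ x, 0 < x → riskTolerance M x = heat (g 1) q (ξ x) := by
    intro x hx
    have := (hg.heat_one_pos q (ξ x)).ne'
    rw [riskTolerance, hd2 x hx, hderiv hx]
    have := (Real.exp_pos (-ξ x - q ^ 2 / 2)).ne'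
    field_simp
  refine ⟨?_, ?_, ?_, ?_⟩
  · rw [show (2 : WithTop ℕ∞) = 1 + 1 by norm_num,
      contDiffOn_succ_iff_deriv_of_isOpen isOpen_Ioi]
    refine ⟨fun x hx => (hd1 x hx).differentiableAt.differentiableWithinAt,
      fun h => by simp at h, ?_⟩
    refine ContDiffOn.congr ?_ hderiv
    exact (((hsm.of_le (by norm_num)).neg).sub contDiffOn_const).exp
  · intro x hx
    rw [hd2 x hx]
    have := hg.heat_one_pos q (ξ x)
    have := Real.exp_pos (-ξ x - q ^ 2 / 2)
    simp only [Left.neg_neg_iff]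
    positivity
  · have hsm1 : ContDiff ℝ 5 (heat (g 1) q) := by
      have := contDiff_of_hasDerivAt (n := 5) (F := fun k => heat (g (k + 1)) q)
        (fun k hk w => hg.hasDerivAt_heat (k := k + 1) (by omega) q w)
        (hg.continuous_heat (k := 6) le_rfl q)
      exact_mod_cast this
    exact (hsm1.comp_contDiffOn (hsm.of_le (by norm_num))).congr hrisk
  · intro w
    rw [hrisk _ (hg.heat_pos q w), hleft]

/-- The bounds `|g⁽ᵏ⁾| ≤ C g'` pass to the heat flow with the same constant, hence the bounds on
the risk tolerance do not depend on the variance `q²`. -/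
lemma uniform_bounds {ι : Type*} {M : ι → ℝ → ℝ} {q : ι → ℝ}
    (hM : ∀ i w, M i (heat (g 0) (q i) w) = heat (fun w => U (g 0 w)) (q i) (w + q i ^ 2)) :
    (∀ j ≤ 4, UniformlyBounded (fun p : ι × Ioi (0 : ℝ) =>
      scaledDeriv (riskTolerance (M p.1)) j p.2)) ∧
    ∃ C, ∀ i x, 0 < x → riskTolerance (M i) x ≤ C * x := by
  obtain ⟨C, hC0, hC, hC1⟩ := hg.bound
  have hsurj : ∀ i x, 0 < x → ∃ w, heat (g 0) (q i) w = x := fun i x hx => by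
    obtain ⟨ξ, hξ, -⟩ := hg.exists_inverse_heat (q i)
    exact ⟨ξ x, (hξ x hx).1⟩
  constructor
  · refine uniformlyBounded_of_curvePoly fun k h1 h5 => ⟨C, ?_⟩
    rintro ⟨i, x, hx⟩
    obtain ⟨w, rfl⟩ := hsurj i x hx
    obtain ⟨-, -, hsm, hr⟩ := hg.value_regularity (hM i)
    have hpos := hg.heat_one_pos (q i) w
    have hcurve : ∀ k ≤ 5, ∀ w, heat (g (k + 1)) (q i) w = heat (g 1) (q i) w *
        curvePoly k (fun j => scaledDeriv (riskTolerance (M i)) j (heat (g 0) (q i) w)) := by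
      intro k
      induction k with
      | zero => intro _ w; simp [curvePoly]
      | succ k ih =>
        intro hk w
        have h1 := hg.hasDerivAt_heat (k := k + 1) (by omega) (q i) w
        have h2 := hasDerivAt_curve hsm (hg.heat_pos (q i)) (fun w => by
          rw [hr]; exact hg.hasDerivAt_heat (k := 0) (by norm_num) (q i) w) (k := k) (by omega) w
        rw [hr] at h2
        refine h1.unique (h2.congr_of_eventuallyEq (Eventually.of_forall fun y => ?_))
        simp only
        rw [ih (by omega) y, hr]
    have hle := abs_heat_le (hg.expBounded 1 (by norm_num)) (hg.continuous 1 (by norm_num))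
      (hC (k + 1) (by omega) (by omega)) (q i) w
    rw [hcurve k h5, abs_mul, abs_of_pos hpos, mul_comm] at hle
    exact le_of_mul_le_mul_right hle hpos
  · refine ⟨C, fun i x hx => ?_⟩
    obtain ⟨w, rfl⟩ := hsurj i x hx
    obtain ⟨-, -, -, hr⟩ := hg.value_regularity (hM i)
    rw [hr]
    refine (le_abs_self _).trans (abs_heat_le (hg.expBounded 0 (by norm_num))
      (hg.continuous 0 (by norm_num)) (fun w => ?_) (q i) w)
    rw [abs_of_pos (hg.pos_one w)]
    exact hC1 w

end IsWealthCurve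

/-! ### Increments of a Brownian motion with respect to a filtration -/

/-- Cameron–Martin shift of the standard Gaussian measure. -/
lemma integral_gaussian_tilt (f : ℝ → ℝ) (q : ℝ) :
    ∫ n, Real.exp (-q * n - q ^ 2 / 2) * f (n + q) ∂(gaussianReal 0 1) =
      ∫ n, f n ∂(gaussianReal 0 1) := by
  rw [integral_gaussianReal_eq_integral_smul one_ne_zero,
    integral_gaussianReal_eq_integral_smul one_ne_zero,
    ← integral_add_right_eq_self (fun n => gaussianPDFReal 0 1 n • f n) q]
  congr 1; ext n
  simp only [smul_eq_mul, gaussianPDFReal, NNReal.coe_one, mul_one, sub_zero]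
  rw [← mul_assoc, mul_assoc (√(2 * Real.pi))⁻¹, ← Real.exp_add]
  congr 3
  ring_nf

lemma integrable_of_abs_le_exp {f : ℝ → ℝ} (hf : Measurable f) {C c : ℝ}
    (h : ∀ n, |f n| ≤ C * Real.exp (c * |n|)) : Integrable f (gaussianReal 0 1) :=
  ((integrable_exp_mul_abs_gaussian c).const_mul C).mono' hf.aestronglyMeasurable
    (ae_of_all _ h)

lemma integrable_gaussian_tilt_pow (q : ℝ) (j : ℕ) :
    Integrable (fun n : ℝ => Real.exp (-q * n - q ^ 2 / 2) * (n + q) ^ j) (gaussianReal 0 1) := by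
  refine integrable_of_abs_le_exp (C := Real.exp (j * |q|)) (c := |q| + j) (by fun_prop)
    fun n => ?_
  rw [abs_mul, abs_of_pos (Real.exp_pos _), abs_pow]
  have h1 : |n + q| ^ j ≤ Real.exp (j * (|n| + |q|)) := by
    rw [Real.exp_nat_mul]
    gcongr
    have := Real.add_one_le_exp (|n| + |q|)
    linarith [abs_add_le n q]
  have h2 : Real.exp (-q * n - q ^ 2 / 2) ≤ Real.exp (|q| * |n|) := by
    gcongr
    rw [← abs_mul]
    nlinarith [neg_abs_le (q * n), sq_nonneg q]
  calc _ ≤ Real.exp (|q| * |n|) * Real.exp (j * (|n| + |q|)) := by gcongr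
    _ = _ := by rw [← Real.exp_add, ← Real.exp_add]; ring_nf

lemma integral_gaussian_id : ∫ n, n ∂(gaussianReal 0 1) = 0 := integral_id_gaussianReal

lemma integral_gaussian_sq : ∫ n, n ^ 2 ∂(gaussianReal 0 1) = 1 := by
  have := variance_fun_id_gaussianReal (μ := 0) (v := 1)
  rw [variance_eq_integral (by fun_prop)] at this
  simpa [integral_id_gaussianReal] using this

lemma integrable_gaussian_pow (j : ℕ) : Integrable (fun n : ℝ => n ^ j) (gaussianReal 0 1) := by
  simpa using integrable_gaussian_tilt_pow 0 j

namespace IsFiltrationBrownian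

variable {Ω : Type*} {mΩ : MeasurableSpace Ω} {P : Measure Ω}
  {ℱ : Filtration ℝ≥0 mΩ} {W : ℝ≥0 → Ω → ℝ} (hW : IsFiltrationBrownian W ℱ P)
include hW

lemma measurable (s : ℝ≥0) : Measurable (W s) := (hW.adapted s).mono (ℱ.le s) le_rfl

lemma measurable_le {s r : ℝ≥0} (h : s ≤ r) : Measurable[ℱ r] (W s) :=
  (hW.adapted s).mono (ℱ.mono h) le_rfl

lemma indepFun_increment {s r : ℝ≥0} (h : s ≤ r) {f : ℝ → ℝ} (hf : Measurable f) {B : Ω → ℝ}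
    (hB : Measurable[ℱ s] B) : IndepFun (fun ω => f (W r ω - W s ω)) B P := by
  have h1 := hW.indep_increment s r h
  rw [IndepFun_iff_Indep]
  refine indep_of_indep_of_le_left (indep_of_indep_of_le_right h1 hB.comap_le) ?_
  rintro _ ⟨A, hA, rfl⟩
  exact ⟨f ⁻¹' A, hf hA, rfl⟩

/-- A Brownian increment over `[s, r]` has the law of `√(r - s)` times a standard Gaussian. -/
lemma map_increment {s r : ℝ≥0} (h : s ≤ r) :
    P.map (fun ω => W r ω - W s ω) =
      (gaussianReal 0 1).map (fun n => √((r : ℝ) - s) * n) := by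
  have h1 := (hW.isBrownian.hasLaw_sub r s).map_eq
  rw [gaussianReal_map_const_mul]
  have h0 : (0 : ℝ) ≤ r - s := sub_nonneg.2 h
  have h2 : nndist r.1 s.1 = NNReal.mk (√((r : ℝ) - s) ^ 2) (sq_nonneg _) * 1 := by
    ext
    simp only [coe_nndist, mul_one, NNReal.coe_mk]
    rw [Real.sq_sqrt h0, Real.dist_eq]
    exact abs_of_nonneg h0
  rw [mul_zero, ← h2, ← h1]
  rfl

lemma integral_increment {s r : ℝ≥0} (h : s ≤ r) {f : ℝ → ℝ} (hf : Measurable f) :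
    ∫ ω, f (W r ω - W s ω) ∂P = ∫ n, f (√((r : ℝ) - s) * n) ∂(gaussianReal 0 1) := by
  rw [← integral_map (φ := fun ω => W r ω - W s ω)
    ((hW.measurable r).sub (hW.measurable s)).aemeasurable hf.aestronglyMeasurable,
    hW.map_increment h, integral_map (by fun_prop) hf.aestronglyMeasurable]

lemma integrable_increment {s r : ℝ≥0} (h : s ≤ r) {f : ℝ → ℝ} (hf : Measurable f)
    (hi : Integrable (fun n => f (√((r : ℝ) - s) * n)) (gaussianReal 0 1)) :
    Integrable (fun ω => f (W r ω - W s ω)) P := by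
  have h1 : Integrable f (P.map (fun ω => W r ω - W s ω)) := by
    rw [hW.map_increment h]
    exact (integrable_map_measure hf.aestronglyMeasurable (by fun_prop)).2 hi
  exact (integrable_map_measure hf.aestronglyMeasurable
    ((hW.measurable r).sub (hW.measurable s)).aemeasurable).1 h1

lemma integral_increment_mul {s r : ℝ≥0} (h : s ≤ r) {f : ℝ → ℝ} (hf : Measurable f)
    (hi : Integrable (fun n => f (√((r : ℝ) - s) * n)) (gaussianReal 0 1)) {B : Ω → ℝ}
    (hB : Measurable[ℱ s] B) (hBi : Integrable B P) :
    Integrable (fun ω => f (W r ω - W s ω) * B ω) P ∧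
      ∫ ω, f (W r ω - W s ω) * B ω ∂P =
        (∫ n, f (√((r : ℝ) - s) * n) ∂(gaussianReal 0 1)) * ∫ ω, B ω ∂P := by
  have hind := hW.indepFun_increment h hf hB
  have hfi := hW.integrable_increment h hf hi
  refine ⟨hind.integrable_mul hfi hBi, ?_⟩
  rw [← hW.integral_increment h hf]
  exact hind.integral_fun_mul_eq_mul_integral hfi.aestronglyMeasurable hBi.aestronglyMeasurable

/-- Moments of the shifted increment `ΔW + λ Δ` under the Girsanov weight of the interval. -/
lemma integral_weight_mul (l : ℝ) {s r : ℝ≥0} (h : s ≤ r) (j : ℕ) {B : Ω → ℝ}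
    (hB : Measurable[ℱ s] B) (hBi : Integrable B P) :
    Integrable (fun ω => Real.exp (-l * (W r ω - W s ω) - l ^ 2 * ((r : ℝ) - s) / 2) *
      (W r ω - W s ω + l * ((r : ℝ) - s)) ^ j * B ω) P ∧
    ∫ ω, Real.exp (-l * (W r ω - W s ω) - l ^ 2 * ((r : ℝ) - s) / 2) *
      (W r ω - W s ω + l * ((r : ℝ) - s)) ^ j * B ω ∂P =
      √((r : ℝ) - s) ^ j * (∫ n, n ^ j ∂(gaussianReal 0 1)) * ∫ ω, B ω ∂P := by
  have h0 : (0 : ℝ) ≤ r - s := sub_nonneg.2 h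
  set c := √((r : ℝ) - s) with hc
  have hcc : (r : ℝ) - s = c ^ 2 := (Real.sq_sqrt h0).symm
  set f : ℝ → ℝ := fun y => Real.exp (-l * y - l ^ 2 * ((r : ℝ) - s) / 2) *
      (y + l * ((r : ℝ) - s)) ^ j with hf
  have hfe : (fun n => f (c * n)) = fun n => c ^ j *
      (Real.exp (-(l * c) * n - (l * c) ^ 2 / 2) * (n + l * c) ^ j) := by
    ext n
    simp only [hf, hcc]
    rw [show c * n + l * c ^ 2 = c * (n + l * c) by ring, mul_pow]
    rw [show -l * (c * n) - l ^ 2 * c ^ 2 / 2 = -(l * c) * n - (l * c) ^ 2 / 2 by ring]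
    ring
  have key := hW.integral_increment_mul h (f := f) (by fun_prop) (by
    rw [← hc, hfe]; exact (integrable_gaussian_tilt_pow (l * c) j).const_mul _) hB hBi
  refine ⟨key.1, key.2.trans ?_⟩
  rw [← hc, hfe, integral_const_mul, integral_gaussian_tilt (fun n => n ^ j)]

end IsFiltrationBrownian

/-! ### The supermartingale property of admissible wealth -/

section Supermartingale

variable {Ω : Type*} {mΩ : MeasurableSpace Ω}

/-- The state price density `exp(-l (W_s - W_t) - l² (s - t) / 2)`. -/
noncomputable def stateDensity (W : ℝ≥0 → Ω → ℝ) (l : ℝ) (t s : ℝ≥0) (ω : Ω) : ℝ :=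
  Real.exp (-l * (W s ω - W t ω) - l ^ 2 * ((s : ℝ) - t) / 2)

lemma stateDensity_pos (W : ℝ≥0 → Ω → ℝ) (l : ℝ) (t s : ℝ≥0) (ω : Ω) :
    0 < stateDensity W l t s ω := Real.exp_pos _

lemma stateDensity_mul (W : ℝ≥0 → Ω → ℝ) (l : ℝ) (t s r : ℝ≥0) (ω : Ω) :
    stateDensity W l t r ω = stateDensity W l s r ω * stateDensity W l t s ω := by
  unfold stateDensity
  rw [← Real.exp_add]
  congr 1
  ring

variable {P : Measure Ω} {ℱ : Filtration ℝ≥0 mΩ} {W : ℝ≥0 → Ω → ℝ}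

lemma IsFiltrationBrownian.measurable_stateDensity (hW : IsFiltrationBrownian W ℱ P) (l : ℝ)
    {t s r : ℝ≥0} (hts : t ≤ s) (hsr : s ≤ r) : Measurable[ℱ r] (stateDensity W l t s) := by
  have h1 := hW.measurable_le hsr
  have h2 := hW.measurable_le (hts.trans hsr)
  unfold stateDensity
  exact Real.measurable_exp.comp (((h1.sub h2).const_mul _).sub_const _)

lemma IsFiltrationBrownian.integrable_stateDensity [IsProbabilityMeasure P]
    (hW : IsFiltrationBrownian W ℱ P) (l : ℝ) {t s : ℝ≥0} (hts : t ≤ s) :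
    Integrable (stateDensity W l t s) P ∧ ∫ ω, stateDensity W l t s ω ∂P = 1 := by
  have := hW.integral_weight_mul l hts 0 (B := fun _ => 1) measurable_const (integrable_const 1)
  have e : stateDensity W l t s =
      fun ω => Real.exp (-l * (W s ω - W t ω) - l ^ 2 * ((s : ℝ) - t) / 2) := rfl
  rw [e]
  simpa using this

/-- A discretely stopped version `S` of the wealth process `Y` at time `s`. It is a martingale
under the state price density, it equals `Y_s` on the event `G`, which contains all paths above
`-ε`, and elsewhere `Y` has been stopped below `-ε`, the overshoot being controlled by `V`, whose
price is at most `η`. -/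
def HasStoppedWealth (W : ℝ≥0 → Ω → ℝ) (ℱ : Filtration ℝ≥0 mΩ) (P : Measure Ω) (l x ε : ℝ)
    (t : ℝ≥0) (Y : ℝ≥0 → Ω → ℝ) (s : ℝ≥0) (η : ℝ) : Prop :=
  ∃ (S V : Ω → ℝ) (G : Set Ω), Measurable[ℱ s] S ∧ Measurable[ℱ s] V ∧ MeasurableSet[ℱ s] G ∧
    Integrable (fun ω => stateDensity W l t s ω * S ω) P ∧
    ∫ ω, stateDensity W l t s ω * S ω ∂P = x ∧
    Integrable (fun ω => stateDensity W l t s ω * V ω) P ∧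
    ∫ ω, stateDensity W l t s ω * V ω ∂P ≤ η ∧
    (∀ ω, 0 ≤ V ω) ∧ (∀ ω ∈ G, S ω = Y s ω ∧ -ε ≤ Y s ω) ∧ (∀ ω ∉ G, -2 * ε - V ω ≤ S ω) ∧
    {ω | ∀ r ∈ Icc t s, -ε ≤ Y r ω} ⊆ G

lemma HasStoppedWealth.mono {l x ε : ℝ} {t s : ℝ≥0} {Y : ℝ≥0 → Ω → ℝ} {η η' : ℝ} (h : η ≤ η')
    (hs : HasStoppedWealth W ℱ P l x ε t Y s η) : HasStoppedWealth W ℱ P l x ε t Y s η' := by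
  obtain ⟨S, V, G, h1, h2, h3, h4, h5, h6, h7, h8⟩ := hs
  exact ⟨S, V, G, h1, h2, h3, h4, h5, h6, h7.trans h, h8⟩

lemma abs_le_add_pow_four_div {ε : ℝ} (hε : 0 < ε) (a : ℝ) : |a| ≤ ε + a ^ 4 / ε ^ 3 := by
  have h4 : a ^ 4 = |a| ^ 4 := (Even.pow_abs (by decide) a).symm
  rcases le_total |a| ε with h | h
  · have : 0 ≤ a ^ 4 / ε ^ 3 := by positivity
    linarith
  · have : |a| ≤ a ^ 4 / ε ^ 3 := by
      rw [le_div_iff₀ (by positivity), h4, show |a| ^ 4 = |a| * |a| ^ 3 by ring]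
      gcongr
    linarith

/-- Fourth moment of the standard Gaussian. -/
noncomputable def gaussianMomentFour : ℝ := ∫ n, n ^ 4 ∂(gaussianReal 0 1)

lemma gaussianMomentFour_nonneg : 0 ≤ gaussianMomentFour :=
  integral_nonneg fun n => by positivity

lemma HasStoppedWealth.step [IsProbabilityMeasure P] (hW : IsFiltrationBrownian W ℱ P)
    {l x ε : ℝ} (hε : 0 < ε) {t s r : ℝ≥0} (hts : t ≤ s) (hsr : s ≤ r) {Y : ℝ≥0 → Ω → ℝ} {η C : ℝ}
    {v : Ω → ℝ} (hv : Measurable[ℱ s] v) (hvC : ∀ ω, |v ω| ≤ C) (hY : Measurable[ℱ r] (Y r))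
    (hinc : ∀ ω, Y r ω = Y s ω + v ω * (W r ω - W s ω + l * ((r : ℝ) - s)))
    (hs : HasStoppedWealth W ℱ P l x ε t Y s η) :
    HasStoppedWealth W ℱ P l x ε t Y r
      (η + C ^ 4 * gaussianMomentFour / ε ^ 3 * ((r : ℝ) - s) ^ 2) := by
  classical
  obtain ⟨S, V, G, hS, hV, hG, hSi, hSx, hVi, hVη, hV0, hSG, hSG', hsub⟩ := hs
  set Z := stateDensity W l t s with hZ
  set d : Ω → ℝ := fun ω => W r ω - W s ω + l * ((r : ℝ) - s) with hd
  set u : Ω → ℝ := G.indicator v with hu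
  have hum : Measurable[ℱ s] u := hv.indicator hG
  have hC0 : ∀ ω : Ω, 0 ≤ C := fun ω => (abs_nonneg _).trans (hvC ω)
  have huC : ∀ ω, |u ω| ≤ C := fun ω => by
    by_cases h : ω ∈ G
    · simpa [hu, h] using hvC ω
    · simpa [hu, h] using hC0 ω
  have hZm : Measurable[ℱ s] Z := hW.measurable_stateDensity l hts le_rfl
  have hZi := hW.integrable_stateDensity l hts
  have hle : ℱ s ≤ ℱ r := ℱ.mono hsr
  have hdm : Measurable[ℱ r] d :=
    ((hW.measurable_le le_rfl).sub (hW.measurable_le hsr)).add_const _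
  have hZu : Integrable (fun ω => Z ω * u ω) P :=
    hZi.1.mul_bdd (c := C) (hum.mono (ℱ.le s) le_rfl).aestronglyMeasurable (ae_of_all _ huC)
  have hv4 : ∀ ω, |v ω ^ 4| ≤ C ^ 4 := fun ω => by
    rw [abs_pow]; exact pow_le_pow_left₀ (abs_nonneg _) (hvC ω) 4
  have hZv : Integrable (fun ω => Z ω * v ω ^ 4) P :=
    hZi.1.mul_bdd (c := C ^ 4) ((hv.pow_const 4).mono (ℱ.le s) le_rfl).aestronglyMeasurable
      (ae_of_all _ hv4)
  obtain ⟨i1, e1⟩ := hW.integral_weight_mul l hsr 0 (hZm.mul hS) hSi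
  obtain ⟨i2, e2⟩ := hW.integral_weight_mul l hsr 1 (hZm.mul hum) hZu
  obtain ⟨i3, e3⟩ := hW.integral_weight_mul l hsr 0 (hZm.mul hV) hVi
  obtain ⟨i4, e4⟩ := hW.integral_weight_mul l hsr 4 (hZm.mul (hv.pow_const 4)) hZv
  have hZr : ∀ ω, stateDensity W l t r ω = stateDensity W l s r ω * Z ω :=
    fun ω => stateDensity_mul W l t s r ω
  have f1 : (fun ω => stateDensity W l t r ω * (S ω + u ω * d ω)) = fun ω =>
      (Real.exp (-l * (W r ω - W s ω) - l ^ 2 * ((r : ℝ) - s) / 2) *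
        (W r ω - W s ω + l * ((r : ℝ) - s)) ^ 0 * (Z ω * S ω)) +
      (Real.exp (-l * (W r ω - W s ω) - l ^ 2 * ((r : ℝ) - s) / 2) *
        (W r ω - W s ω + l * ((r : ℝ) - s)) ^ 1 * (Z ω * u ω)) := by
    ext ω
    rw [hZr]
    simp only [stateDensity, hd]
    ring
  have f2 : (fun ω => stateDensity W l t r ω * (V ω + (v ω * d ω) ^ 4 / ε ^ 3)) = fun ω =>
      (Real.exp (-l * (W r ω - W s ω) - l ^ 2 * ((r : ℝ) - s) / 2) *
        (W r ω - W s ω + l * ((r : ℝ) - s)) ^ 0 * (Z ω * V ω)) +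
      (Real.exp (-l * (W r ω - W s ω) - l ^ 2 * ((r : ℝ) - s) / 2) *
        (W r ω - W s ω + l * ((r : ℝ) - s)) ^ 4 * (Z ω * v ω ^ 4)) * (ε ^ 3)⁻¹ := by
    ext ω
    rw [hZr]
    simp only [stateDensity, hd]
    ring
  have g1 : ∫ n : ℝ, n ^ 0 ∂(gaussianReal 0 1) = 1 := by simp
  have g2 : ∫ n : ℝ, n ^ 1 ∂(gaussianReal 0 1) = 0 := by
    simp only [pow_one]
    exact integral_gaussian_id
  simp only [Pi.mul_apply] at i1 e1 i2 e2 i3 e3 i4 e4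
  refine ⟨fun ω => S ω + u ω * d ω, fun ω => V ω + (v ω * d ω) ^ 4 / ε ^ 3,
    G ∩ {ω | -ε ≤ Y r ω}, ?_, ?_, ?_, ?_, ?_, ?_, ?_, ?_, ?_, ?_, ?_⟩
  · exact (hS.mono hle le_rfl).add ((hum.mono hle le_rfl).mul hdm)
  · exact (hV.mono hle le_rfl).add ((((hv.mono hle le_rfl).mul hdm).pow_const 4).div_const _)
  · exact (hle _ hG).inter (measurableSet_le measurable_const hY)
  · rw [f1]; exact i1.add i2
  · rw [f1, integral_add i1 i2, e1, e2, g1, g2, hSx]; ring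
  · rw [f2]; exact i3.add (i4.mul_const _)
  · rw [f2, integral_add i3 (i4.mul_const _), integral_mul_const, e3, e4, g1]
    have hsq : √((r : ℝ) - s) ^ 4 = ((r : ℝ) - s) ^ 2 := by
      rw [show 4 = 2 * 2 by norm_num, pow_mul,
        Real.sq_sqrt (sub_nonneg.2 (NNReal.coe_le_coe.2 hsr))]
    have hle4 : ∫ ω, Z ω * v ω ^ 4 ∂P ≤ C ^ 4 := by
      calc ∫ ω, Z ω * v ω ^ 4 ∂P ≤ ∫ ω, Z ω * C ^ 4 ∂P := by
            refine integral_mono hZv (hZi.1.mul_const _) fun ω => ?_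
            exact mul_le_mul_of_nonneg_left ((le_abs_self _).trans (hv4 ω))
              (stateDensity_pos W l t s ω).le
        _ = C ^ 4 := by rw [integral_mul_const, hZi.2, one_mul]
    rw [hsq, pow_zero, one_mul, one_mul]
    change _ + ((r : ℝ) - s) ^ 2 * gaussianMomentFour * _ * _ ≤ _
    have hm := gaussianMomentFour_nonneg
    have : ((r : ℝ) - s) ^ 2 * gaussianMomentFour * (∫ ω, Z ω * v ω ^ 4 ∂P) * (ε ^ 3)⁻¹ ≤
        ((r : ℝ) - s) ^ 2 * gaussianMomentFour * C ^ 4 * (ε ^ 3)⁻¹ := by gcongr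
    calc _ ≤ η + ((r : ℝ) - s) ^ 2 * gaussianMomentFour * C ^ 4 * (ε ^ 3)⁻¹ := add_le_add hVη this
      _ = _ := by ring
  · intro ω
    have := hV0 ω
    positivity
  · rintro ω ⟨hωG, hωY⟩
    refine ⟨?_, hωY⟩
    simp only [hu, indicator_of_mem hωG, hd]
    rw [(hSG ω hωG).1, hinc]
  · intro ω hω
    by_cases hωG : ω ∈ G
    · have hov := abs_le_add_pow_four_div hε (v ω * d ω)
      have := neg_abs_le (v ω * d ω)
      have h1 := hSG ω hωG
      have h2 := hV0 ω
      simp only [hu, indicator_of_mem hωG]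
      rw [h1.1]
      linarith [h1.2]
    · have h1 := hSG' ω hωG
      have : 0 ≤ (v ω * d ω) ^ 4 / ε ^ 3 := by positivity
      simp only [hu, indicator_of_notMem hωG, zero_mul, add_zero]
      linarith
  · intro ω hω
    exact ⟨hsub fun q hq => hω q ⟨hq.1, hq.2.trans hsr⟩, hω r ⟨hts.trans hsr, le_rfl⟩⟩

/-- Over an interval on which the strategy is constant in time, the price of the overshoot can be
kept arbitrarily small by refining the stopping grid. -/
lemma HasStoppedWealth.block [IsProbabilityMeasure P] (hW : IsFiltrationBrownian W ℱ P)
    {l x ε : ℝ} (hε : 0 < ε) {t s r : ℝ≥0} (hts : t ≤ s) (hsr : s ≤ r) {Y : ℝ≥0 → Ω → ℝ} {η C : ℝ}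
    {v : Ω → ℝ} (hv : Measurable[ℱ s] v) (hvC : ∀ ω, |v ω| ≤ C) (hY : ∀ r, Measurable[ℱ r] (Y r))
    (hinc : ∀ a b, s ≤ a → a ≤ b → b ≤ r → ∀ ω,
      Y b ω = Y a ω + v ω * (W b ω - W a ω + l * ((b : ℝ) - a)))
    (hs : HasStoppedWealth W ℱ P l x ε t Y s η) {δ : ℝ} (hδ : 0 < δ) :
    HasStoppedWealth W ℱ P l x ε t Y r (η + δ) := by
  set K := C ^ 4 * gaussianMomentFour / ε ^ 3 with hK
  obtain ⟨m, hm⟩ := exists_nat_gt (K * ((r : ℝ) - s) ^ 2 / δ)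
  set h : ℝ≥0 := (r - s) / (m + 1) with hh
  have hm1 : (0 : ℝ≥0) < m + 1 := by positivity
  have hend : s + (m + 1) * h = r := by
    rw [hh, mul_div_cancel₀ _ hm1.ne', add_tsub_cancel_of_le hsr]
  have hiter : ∀ j : ℕ, j ≤ m + 1 →
      HasStoppedWealth W ℱ P l x ε t Y (s + j * h) (η + j * (K * (h : ℝ) ^ 2)) := by
    intro j
    induction j with
    | zero => intro _; simpa using hs
    | succ j ih =>
      intro hj
      have hsj : s ≤ s + j * h := le_self_add
      have h1 : s + (j : ℝ≥0) * h ≤ s + ((j + 1 : ℕ) : ℝ≥0) * h := by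
        gcongr; simp
      have h2 : s + ((j + 1 : ℕ) : ℝ≥0) * h ≤ r := by
        calc s + ((j + 1 : ℕ) : ℝ≥0) * h ≤ s + (m + 1) * h := by
              gcongr
              exact_mod_cast hj
          _ = r := hend
      have := (ih (by omega)).step hW hε (hts.trans hsj) h1
        (hv.mono (ℱ.mono hsj) le_rfl) hvC (hY _) (hinc _ _ hsj h1 h2)
      refine this.mono (le_of_eq ?_)
      push_cast
      ring
  have := hiter (m + 1) le_rfl
  rw [Nat.cast_add, Nat.cast_one, hend] at this
  refine this.mono ?_
  have hhr : (h : ℝ) = ((r : ℝ) - s) / (m + 1) := by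
    rw [hh, NNReal.coe_div, NNReal.coe_sub hsr]; push_cast; rfl
  have h3 : ((m + 1 : ℕ) : ℝ) * (K * (h : ℝ) ^ 2) = K * ((r : ℝ) - s) ^ 2 / (m + 1) := by
    rw [hhr]; push_cast; field_simp
  have h4 : K * ((r : ℝ) - s) ^ 2 / (m + 1) ≤ δ := by
    rw [div_le_iff₀ (by positivity)]
    rw [div_lt_iff₀ hδ] at hm
    nlinarith
  push_cast at h3
  push_cast
  linarith

end Supermartingale

/-! ### Wealth processes of simple strategies -/

section SimpleWealth

variable {Ω : Type*} {mΩ : MeasurableSpace Ω} {P : Measure Ω} {ℱ : Filtration ℝ≥0 mΩ}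
  {W : ℝ≥0 → Ω → ℝ}

/-- The contribution of the `k`-th interval of a simple integrand to the integral up to time `s`
with respect to the Brownian motion `W + l s` with drift. -/
def SimpleIntegrand.driftTerm (ψ : SimpleIntegrand ℱ) (W : ℝ≥0 → Ω → ℝ) (l : ℝ) (k : ℕ) (s : ℝ≥0)
    (ω : Ω) : ℝ :=
  ψ.val k ω * (W (min (ψ.time (k + 1)) s) ω - W (min (ψ.time k) s) ω +
    l * (((min (ψ.time (k + 1)) s : ℝ≥0) : ℝ) - ((min (ψ.time k) s : ℝ≥0) : ℝ)))

/-- The wealth process of a simple strategy in the market with price of risk `l`. -/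
def SimpleIntegrand.wealth (ψ : SimpleIntegrand ℱ) (W : ℝ≥0 → Ω → ℝ) (l x : ℝ) (s : ℝ≥0)
    (ω : Ω) : ℝ :=
  x + ∑ k ∈ Finset.range ψ.n, ψ.driftTerm W l k s ω

namespace SimpleIntegrand

variable (ψ : SimpleIntegrand ℱ) (l x : ℝ)

lemma driftTerm_of_le {k : ℕ} {s : ℝ≥0} (h : s ≤ ψ.time k) (ω : Ω) :
    ψ.driftTerm W l k s ω = 0 := by
  have h' : s ≤ ψ.time (k + 1) := h.trans (ψ.mono (Nat.le_succ k))
  simp [driftTerm, min_eq_right h, min_eq_right h']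

lemma driftTerm_of_ge {k : ℕ} {a b : ℝ≥0} (h : ψ.time (k + 1) ≤ a) (hab : a ≤ b) (ω : Ω) :
    ψ.driftTerm W l k b ω = ψ.driftTerm W l k a ω := by
  have h0 : ψ.time k ≤ a := (ψ.mono (Nat.le_succ k)).trans h
  simp [driftTerm, min_eq_left h, min_eq_left h0, min_eq_left (h.trans hab),
    min_eq_left (h0.trans hab)]

lemma measurable_driftTerm (hW : IsFiltrationBrownian W ℱ P) (k : ℕ) (s : ℝ≥0) :
    Measurable[ℱ s] (ψ.driftTerm W l k s) := by
  rcases le_total s (ψ.time k) with h | h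
  · have : ψ.driftTerm W l k s = fun _ => 0 := funext fun ω => ψ.driftTerm_of_le l h ω
    rw [this]
    exact measurable_const
  · have h1 : Measurable[ℱ s] (ψ.val k) := (ψ.measurable_val k).mono (ℱ.mono h) le_rfl
    exact h1.mul (((hW.measurable_le (min_le_right _ _)).sub
      (hW.measurable_le (min_le_right _ _))).add_const _)

lemma measurable_wealth (hW : IsFiltrationBrownian W ℱ P) (s : ℝ≥0) :
    Measurable[ℱ s] (ψ.wealth W l x s) :=
  (Finset.measurable_sum _ fun k _ => ψ.measurable_driftTerm l hW k s).const_add x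

lemma wealth_of_le {s : ℝ≥0} (h : s ≤ ψ.time 0) (ω : Ω) : ψ.wealth W l x s ω = x := by
  unfold wealth
  rw [Finset.sum_eq_zero fun k _ => ψ.driftTerm_of_le l (h.trans (ψ.mono (Nat.zero_le k))) ω,
    add_zero]

lemma wealth_of_ge {a b : ℝ≥0} (h : ψ.time ψ.n ≤ a) (hab : a ≤ b) (ω : Ω) :
    ψ.wealth W l x b ω = ψ.wealth W l x a ω := by
  unfold wealth
  congr 1
  refine Finset.sum_congr rfl fun k hk => ψ.driftTerm_of_ge l ?_ hab ω
  exact (ψ.mono (by have := Finset.mem_range.1 hk; omega)).trans h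

lemma wealth_block {k : ℕ} (hk : k < ψ.n) {a b : ℝ≥0} (ha : ψ.time k ≤ a) (hab : a ≤ b)
    (hb : b ≤ ψ.time (k + 1)) (ω : Ω) :
    ψ.wealth W l x b ω =
      ψ.wealth W l x a ω + ψ.val k ω * (W b ω - W a ω + l * ((b : ℝ) - a)) := by
  have h1 : ∑ i ∈ Finset.range ψ.n, (ψ.driftTerm W l i b ω - ψ.driftTerm W l i a ω) =
      ψ.driftTerm W l k b ω - ψ.driftTerm W l k a ω := by
    refine Finset.sum_eq_single k (fun i _ hik => ?_) fun h => absurd (Finset.mem_range.2 hk) h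
    rcases lt_or_gt_of_ne hik with h | h
    · rw [ψ.driftTerm_of_ge l ((ψ.mono (by omega)).trans ha) hab, sub_self]
    · have hi : b ≤ ψ.time i := hb.trans (ψ.mono (by omega))
      rw [ψ.driftTerm_of_le l hi, ψ.driftTerm_of_le l (hab.trans hi), sub_self]
  have h2 : ψ.driftTerm W l k b ω - ψ.driftTerm W l k a ω =
      ψ.val k ω * (W b ω - W a ω + l * ((b : ℝ) - a)) := by
    simp only [driftTerm, min_eq_left ha, min_eq_left (ha.trans hab), min_eq_right hb,
      min_eq_right (hab.trans hb)]
    ring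
  rw [Finset.sum_sub_distrib, h2] at h1
  unfold wealth
  linarith

/-- The stopping is carried out interval by interval, so that the strategy is constant in time on
each grid. -/
lemma hasStoppedWealth [IsProbabilityMeasure P] (hW : IsFiltrationBrownian W ℱ P) {ε : ℝ}
    (hε : 0 < ε) (hx : 0 ≤ x) {t T : ℝ≥0} (htT : t ≤ T) (ht : t ≤ ψ.time 0) {η : ℝ} (hη : 0 < η) :
    HasStoppedWealth W ℱ P l x ε t (ψ.wealth W l x) T η := by
  have hYm := ψ.measurable_wealth l x hW
  have h0 : HasStoppedWealth W ℱ P l x ε t (ψ.wealth W l x) t 0 := by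
    have hZ := hW.integrable_stateDensity l (le_refl t)
    refine ⟨fun _ => x, fun _ => 0, univ, measurable_const, measurable_const, MeasurableSet.univ,
      hZ.1.mul_const x, ?_, by simp, by simp, fun _ => le_rfl, fun ω _ => ?_,
      fun ω h => absurd (mem_univ ω) h, subset_univ _⟩
    · rw [integral_mul_const, hZ.2, one_mul]
    · rw [ψ.wealth_of_le l x ht]
      exact ⟨rfl, by linarith⟩
  obtain ⟨C, hC⟩ := ψ.bounded_val
  have key : ∀ k ≤ ψ.n, ∀ η > 0,
      HasStoppedWealth W ℱ P l x ε t (ψ.wealth W l x) (min (ψ.time k) T) η := by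
    intro k
    induction k with
    | zero =>
      intro _ η hη
      refine (h0.block hW hε le_rfl (le_min ht htT) (v := fun _ => 0) (C := 0) measurable_const
        (by simp) hYm (fun a b ha hab hb ω => ?_) hη).mono (by simp)
      have hb' : b ≤ ψ.time 0 := hb.trans (min_le_left _ _)
      rw [ψ.wealth_of_le l x hb', ψ.wealth_of_le l x (hab.trans hb')]
      ring
    | succ k ih =>
      intro hk η hη
      have hmin : min (ψ.time k) T ≤ min (ψ.time (k + 1)) T :=
        min_le_min_right _ (ψ.mono (Nat.le_succ k))
      have htk : t ≤ min (ψ.time k) T := le_min (ht.trans (ψ.mono (Nat.zero_le k))) htT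
      rcases le_total T (ψ.time k) with hT | hT
      · rw [min_eq_right (hT.trans (ψ.mono (Nat.le_succ k)))]
        have := ih (by omega) η hη
        rwa [min_eq_right hT] at this
      · have hprev := ih (by omega) (η / 2) (by positivity)
        refine (hprev.block hW hε htk hmin (v := ψ.val k) (C := C) ?_ (fun ω => hC k ω) hYm
          (fun a b ha hab hb ω => ?_) (half_pos hη)).mono (by linarith)
        · rw [min_eq_left hT]; exact ψ.measurable_val k
        · rw [min_eq_left hT] at ha
          exact ψ.wealth_block l x (by omega) ha hab (hb.trans (min_le_left _ _)) ω
  rcases le_total T (ψ.time ψ.n) with hT | hT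
  · have := key ψ.n le_rfl η hη
    rwa [min_eq_right hT] at this
  · have hprev := key ψ.n le_rfl (η / 2) (by positivity)
    rw [min_eq_left hT] at hprev
    refine (hprev.block hW hε (ht.trans (ψ.mono (Nat.zero_le _))) hT (v := fun _ => 0) (C := 0)
      measurable_const (by simp) hYm (fun a b ha hab hb ω => ?_) (half_pos hη)).mono (by linarith)
    rw [ψ.wealth_of_ge l x ha hab]
    ring

lemma measurable_process (ω : Ω) : Measurable (fun u => ψ.process u ω) := by
  unfold process
  exact Finset.measurable_sum _ fun k _ => measurable_const.indicator measurableSet_Ioc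

lemma integral_indicator_Ioc {t s a b : ℝ≥0} (hta : t ≤ a) (hab : a ≤ b) (hts : t ≤ s) (c : ℝ) :
    IntervalIntegrable (fun u : ℝ => (Ioc a b).indicator (fun _ => c) u.toNNReal) volume t s ∧
    ∫ u in (t : ℝ)..s, (Ioc a b).indicator (fun _ => c) u.toNNReal =
      c * (((min b s : ℝ≥0) : ℝ) - ((min a s : ℝ≥0) : ℝ)) := by
  have hts' : (t : ℝ) ≤ s := NNReal.coe_le_coe.2 hts
  have hmeas : Measurable (fun u : ℝ => (Ioc a b).indicator (fun _ => c) u.toNNReal) :=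
    (measurable_const.indicator measurableSet_Ioc).comp measurable_real_toNNReal
  have hset : Ioc (t : ℝ) s ∩ Ioc (a : ℝ) b = Ioc ((min a s : ℝ≥0) : ℝ) (min b s : ℝ≥0) := by
    ext u
    have := NNReal.coe_le_coe.2 hta
    simp only [mem_inter_iff, mem_Ioc, NNReal.coe_min, min_lt_iff, le_min_iff]
    constructor
    · rintro ⟨⟨h1, h2⟩, h3, h4⟩; exact ⟨Or.inl h3, h4, h2⟩
    · rintro ⟨h1 | h1, h2, h3⟩
      · exact ⟨⟨by linarith, h3⟩, h1, h2⟩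
      · linarith
  have heq : EqOn (fun u : ℝ => (Ioc a b).indicator (fun _ => c) u.toNNReal)
      ((Ioc (a : ℝ) b).indicator (fun _ => c)) (Ioc (t : ℝ) s) := by
    intro u hu
    have hu0 : 0 ≤ u := t.2.trans hu.1.le
    by_cases h : u ∈ Ioc (a : ℝ) b
    · have : u.toNNReal ∈ Ioc a b :=
        ⟨(Real.lt_toNNReal_iff_coe_lt).2 h.1, Real.toNNReal_le_iff_le_coe.2 h.2⟩
      simp only [indicator_of_mem h, indicator_of_mem this]
    · have : u.toNNReal ∉ Ioc a b := fun h' =>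
        h ⟨Real.lt_toNNReal_iff_coe_lt.1 h'.1, Real.toNNReal_le_iff_le_coe.1 h'.2⟩
      simp only [indicator_of_notMem h, indicator_of_notMem this]
  constructor
  · refine (intervalIntegrable_const (c := |c|)).mono_fun hmeas.aestronglyMeasurable
      (ae_of_all _ fun u => ?_)
    simp only [Real.norm_eq_abs, abs_abs]
    by_cases h : u.toNNReal ∈ Ioc a b <;> simp [h]
  · rw [intervalIntegral.integral_of_le hts', setIntegral_congr_fun measurableSet_Ioc heq,
      setIntegral_indicator measurableSet_Ioc, hset, setIntegral_const, smul_eq_mul, mul_comm]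
    congr 1
    rw [measureReal_def, Real.volume_Ioc, ENNReal.toReal_ofReal]
    exact sub_nonneg.2 (NNReal.coe_le_coe.2 (min_le_min_right _ hab))

lemma wealth_eq {t s : ℝ≥0} (ht : t ≤ ψ.time 0) (hts : t ≤ s) (ω : Ω) :
    IntervalIntegrable (fun u : ℝ => ψ.process u.toNNReal ω) volume t s ∧
    ψ.wealth W l x s ω =
      x + l * (∫ u in (t : ℝ)..s, ψ.process u.toNNReal ω) + ψ.integral W s ω := by
  have hk : ∀ k, t ≤ ψ.time k := fun k => ht.trans (ψ.mono (Nat.zero_le k))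
  have h := fun k => integral_indicator_Ioc (hk k) (ψ.mono (Nat.le_succ k)) hts (ψ.val k ω)
  constructor
  · unfold process
    have := IntervalIntegrable.sum (Finset.range ψ.n) fun k _ => (h k).1
    rwa [Finset.sum_fn] at this
  · unfold process wealth integral
    rw [intervalIntegral.integral_finsetSum fun k _ => (h k).1, Finset.mul_sum, add_assoc,
      ← Finset.sum_add_distrib]
    congr 1
    refine Finset.sum_congr rfl fun k _ => ?_
    rw [(h k).2, driftTerm]
    ring

end SimpleIntegrand

end SimpleWealth

/-! ### The budget constraint -/

section Budget

variable {Ω : Type*} {mΩ : MeasurableSpace Ω} {P : Measure Ω} {ℱ : Filtration ℝ≥0 mΩ}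
  {W : ℝ≥0 → Ω → ℝ}

lemma aestronglyMeasurable_path {π : ℝ≥0 → Ω → ℝ} (hπ : IsStronglyProgressive ℱ π) (t T : ℝ≥0)
    (ω : Ω) :
    AEStronglyMeasurable (fun u : ℝ => π u.toNNReal ω) (volume.restrict (Icc (t : ℝ) T)) := by
  have h1 : Measurable (fun p : Iic T => π p ω) := by
    have := (hπ T).measurable
    exact this.comp (@measurable_prodMk_right _ _ _ (ℱ T) ω)
  have h2 : Measurable (fun u : ℝ => π (min u.toNNReal T) ω) :=
    h1.comp (g := fun p : Iic T => π p ω)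
      (f := fun u : ℝ => (⟨min u.toNNReal T, mem_Iic.2 (min_le_right _ _)⟩ : Iic T))
      ((measurable_real_toNNReal.min measurable_const).subtype_mk)
  refine ⟨_, h2.stronglyMeasurable, ?_⟩
  rw [Filter.EventuallyEq, ae_restrict_iff' measurableSet_Icc]
  refine ae_of_all _ fun u hu => ?_
  rw [min_eq_left (Real.toNNReal_le_iff_le_coe.2 hu.2)]

/-- Outside a null set, the wealth of a simple strategy stays uniformly close to an admissible
wealth process as soon as the integrands and the stochastic integrals are close. -/
lemma abs_wealth_sub_le {ψ : SimpleIntegrand ℱ} {m σ x ε δ : ℝ} (hσ : σ ≠ 0) {t T : ℝ≥0}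
    (htT : t ≤ T) (ht : t ≤ ψ.time 0) {π X J : ℝ≥0 → Ω → ℝ} (hπ : IsStronglyProgressive ℱ π) {ω : Ω}
    (hsq : IntegrableOn (fun u : ℝ => π u.toNNReal ω ^ 2) (Icc (t : ℝ) T))
    (hX : ∀ s ∈ Icc t T, X s ω = x + (∫ u in (t : ℝ)..s, π u.toNNReal ω * m) + J s ω)
    (hδ : 0 < δ) (hδε : |m / σ| * (δ * ((T : ℝ) - t + 1)) ≤ ε / 2)
    (h1 : ∫⁻ u in Icc (t : ℝ) T,
      ENNReal.ofReal ((ψ.process u.toNNReal ω - π u.toNNReal ω * σ) ^ 2) < ENNReal.ofReal (δ ^ 2))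
    (h2 : ∀ s ∈ Icc t T, |ψ.integral W s ω - J s ω| < ε / 2) :
    ∀ s ∈ Icc t T, |ψ.wealth W (m / σ) x s ω - X s ω| ≤ ε := by
  set l := m / σ with hl
  have hm : m = l * σ := by rw [hl]; field_simp
  have htT' : (t : ℝ) ≤ T := NNReal.coe_le_coe.2 htT
  set d : ℝ → ℝ := fun u => ψ.process u.toNNReal ω - π u.toNNReal ω * σ with hd
  have hπm := aestronglyMeasurable_path hπ t T ω
  have hdm : AEStronglyMeasurable d (volume.restrict (Icc (t : ℝ) T)) :=
    ((ψ.measurable_process ω).comp measurable_real_toNNReal).aestronglyMeasurable.sub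
      (hπm.mul_const σ)
  have hd2 : IntegrableOn (fun u => d u ^ 2) (Icc (t : ℝ) T) := by
    refine ⟨hdm.pow 2, ?_⟩
    rw [hasFiniteIntegral_iff_ofReal (ae_of_all _ fun u => sq_nonneg _)]
    exact h1.trans ENNReal.ofReal_lt_top
  have hd2le : ∫ u in Icc (t : ℝ) T, d u ^ 2 ≤ δ ^ 2 := by
    rw [integral_eq_lintegral_of_nonneg_ae (ae_of_all _ fun u => sq_nonneg _) (hdm.pow 2)]
    exact ENNReal.toReal_le_of_le_ofReal (sq_nonneg δ) h1.le
  have hdom : ∀ u, |d u| ≤ δ + d u ^ 2 / δ := fun u => by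
    rw [← sub_nonneg]
    have : δ + d u ^ 2 / δ - |d u| = ((|d u| - δ / 2) ^ 2 + 3 / 4 * δ ^ 2) / δ := by
      rw [← sq_abs (d u)]; field_simp; ring
    rw [this]; positivity
  have hcst : Integrable (fun _ : ℝ => δ) (volume.restrict (Icc (t : ℝ) T)) :=
    integrableOn_const (by simp)
  have hdomi : IntegrableOn (fun u => δ + d u ^ 2 / δ) (Icc (t : ℝ) T) :=
    hcst.add (hd2.div_const δ)
  have hdi : IntegrableOn d (Icc (t : ℝ) T) := hdomi.mono' hdm (ae_of_all _ hdom)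
  have hπi : IntegrableOn (fun u : ℝ => π u.toNNReal ω) (Icc (t : ℝ) T) := by
    refine Integrable.mono' ((integrableOn_const (C := (1 : ℝ)) (by simp)).add hsq) hπm
      (ae_of_all _ fun u => ?_)
    rw [Real.norm_eq_abs, Pi.add_apply, ← sq_abs]
    nlinarith [sq_nonneg (|π u.toNNReal ω| - 1 / 2)]
  have hL1 : ∫ u in Icc (t : ℝ) T, |d u| ≤ δ * ((T : ℝ) - t + 1) := by
    calc ∫ u in Icc (t : ℝ) T, |d u| ≤ ∫ u in Icc (t : ℝ) T, (δ + d u ^ 2 / δ) :=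
          integral_mono hdi.abs hdomi hdom
      _ = ((T : ℝ) - t) * δ + (∫ u in Icc (t : ℝ) T, d u ^ 2) / δ := by
          rw [integral_add hcst (hd2.div_const δ), integral_div,
            setIntegral_const, smul_eq_mul, measureReal_def, Real.volume_Icc,
            ENNReal.toReal_ofReal (by linarith)]
      _ ≤ ((T : ℝ) - t) * δ + δ ^ 2 / δ := by gcongr
      _ = _ := by field_simp
  intro s hs
  have hts : (t : ℝ) ≤ s := NNReal.coe_le_coe.2 hs.1
  have hsub : Ioc (t : ℝ) s ⊆ Icc (t : ℝ) T := fun u hu =>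
    ⟨hu.1.le, hu.2.trans (NNReal.coe_le_coe.2 hs.2)⟩
  have hdis : IntervalIntegrable d volume t s :=
    (intervalIntegrable_iff_integrableOn_Ioc_of_le hts).2 (hdi.mono_set hsub)
  have hπis : IntervalIntegrable (fun u : ℝ => π u.toNNReal ω) volume t s :=
    (intervalIntegrable_iff_integrableOn_Ioc_of_le hts).2 (hπi.mono_set hsub)
  obtain ⟨hψi, hψ⟩ := ψ.wealth_eq (W := W) l x ht hs.1 ω
  have hint : ∫ u in (t : ℝ)..s, d u = (∫ u in (t : ℝ)..s, ψ.process u.toNNReal ω) -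
      (∫ u in (t : ℝ)..s, π u.toNNReal ω) * σ := by
    rw [hd, intervalIntegral.integral_sub hψi (hπis.mul_const σ),
      intervalIntegral.integral_mul_const]
  have hbd : |∫ u in (t : ℝ)..s, d u| ≤ δ * ((T : ℝ) - t + 1) := by
    refine le_trans ?_ hL1
    rw [intervalIntegral.integral_of_le hts]
    refine (abs_integral_le_integral_abs).trans ?_
    exact setIntegral_mono_set hdi.abs (ae_of_all _ fun u => abs_nonneg _)
      (LE.le.eventuallyLE hsub)
  have heq : ψ.wealth W l x s ω - X s ω =
      l * (∫ u in (t : ℝ)..s, d u) + (ψ.integral W s ω - J s ω) := by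
    rw [hψ, hX s hs, intervalIntegral.integral_mul_const, hint, hm]
    ring
  rw [heq]
  calc _ ≤ |l| * |∫ u in (t : ℝ)..s, d u| + |ψ.integral W s ω - J s ω| := by
        rw [← abs_mul]; exact abs_add_le _ _
    _ ≤ |l| * (δ * ((T : ℝ) - t + 1)) + ε / 2 := by
        gcongr
        exact (h2 s hs).le
    _ ≤ ε := by linarith

/-- The budget constraint: the price of an admissible terminal wealth is at most the initial
wealth. -/
lemma IsAdmissibleStrategy.lintegral_stateDensity_le [IsProbabilityMeasure P]
    (hW : IsFiltrationBrownian W ℱ P) {T t : ℝ≥0} (htT : t ≤ T) {m σ x : ℝ} (hσ : σ ≠ 0)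
    (hx : 0 ≤ x) {π X : ℝ≥0 → Ω → ℝ} (h : IsAdmissibleStrategy W ℱ P T m σ t x π X) :
    ∫⁻ ω, ENNReal.ofReal (stateDensity W (m / σ) t T ω * X T ω) ∂P ≤ ENNReal.ofReal x := by
  obtain ⟨J, ⟨ψ, hψt, hconv1, hconv2⟩, hXeq⟩ := h.wealth_eq
  set l := m / σ with hl
  have main : ∀ ε : ℝ, 0 < ε →
      ∫⁻ ω, ENNReal.ofReal (stateDensity W l t T ω * X T ω) ∂P ≤ ENNReal.ofReal (x + 3 * ε) := by
    intro ε hε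
    have hTt : (0 : ℝ) ≤ T - t := sub_nonneg.2 (NNReal.coe_le_coe.2 htT)
    set δ := ε / (2 * (|l| * ((T : ℝ) - t + 1) + 1)) with hδdef
    have hden : 0 < |l| * ((T : ℝ) - t + 1) + 1 := by positivity
    have hδ : 0 < δ := by positivity
    have hδε : |l| * (δ * ((T : ℝ) - t + 1)) ≤ ε / 2 := by
      have : δ * (|l| * ((T : ℝ) - t + 1) + 1) = ε / 2 := by rw [hδdef]; field_simp
      nlinarith
    set bad1 : ℕ → Set Ω := fun n => {ω | ENNReal.ofReal (δ ^ 2) ≤ ∫⁻ u in Icc (t : ℝ) T,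
      ENNReal.ofReal (((ψ n).process u.toNNReal ω - π u.toNNReal ω * σ) ^ 2)}
    set bad2 : ℕ → Set Ω := fun n => {ω | ∃ s ∈ Icc t T, ε / 2 ≤ |(ψ n).integral W s ω - J s ω|}
    -- along a subsequence, almost every path is eventually outside both exceptional events
    have hbad : Tendsto (fun n => P (bad1 n ∪ bad2 n)) atTop (𝓝 0) := by
      have h1 := (hconv1 (ENNReal.ofReal (δ ^ 2)) (by positivity)).add
        (hconv2 (ε / 2) (by positivity))
      rw [add_zero] at h1
      exact tendsto_of_tendsto_of_tendsto_of_le_of_le tendsto_const_nhds h1 (fun _ => zero_le)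
        (fun n => measure_union_le _ _)
    have hsub : ∀ k : ℕ, ∃ n, P (bad1 n ∪ bad2 n) ≤ (2⁻¹ : ℝ≥0∞) ^ k := fun k =>
      (hbad.eventually (eventually_le_nhds
        (ENNReal.pow_pos (by norm_num : (0 : ℝ≥0∞) < 2⁻¹) k))).exists
    choose N hN using hsub
    have hsum : ∑' k, P (bad1 (N k) ∪ bad2 (N k)) ≠ ∞ := by
      refine ne_top_of_le_ne_top ?_ (ENNReal.tsum_le_tsum hN)
      rw [ENNReal.tsum_geometric]
      norm_num
    have hBC := ae_eventually_notMem hsum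
    have hstopped := fun k => (ψ (N k)).hasStoppedWealth l x hW hε hx htT (hψt (N k)) hε
    choose S V G hS hV hG hSi hSx hVi hVη hV0 hSG hSG' hGsub using hstopped
    -- the stopped wealth plus the bound on its overshoot: nonnegative, with price at most `x + 3 ε`
    set f : ℕ → Ω → ℝ := fun k ω => stateDensity W l t T ω * (S k ω + 2 * ε + V k ω) with hf
    have hZ := hW.integrable_stateDensity l htT
    have hZm : Measurable (stateDensity W l t T) :=
      (hW.measurable_stateDensity l htT le_rfl).mono (ℱ.le T) le_rfl
    have hfm : ∀ k, Measurable (f k) := fun k =>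
      hZm.mul ((((hS k).mono (ℱ.le T) le_rfl).add_const _).add ((hV k).mono (ℱ.le T) le_rfl))
    have hfeq : ∀ k, f k = fun ω => stateDensity W l t T ω * S k ω +
        stateDensity W l t T ω * (2 * ε) + stateDensity W l t T ω * V k ω := fun k => by
      ext ω; simp only [hf]; ring
    have hSi' : ∀ k, Integrable (fun ω => stateDensity W l t T ω * S k ω +
        stateDensity W l t T ω * (2 * ε)) P := fun k => (hSi k).add (hZ.1.mul_const _)
    have hfi : ∀ k, Integrable (f k) P := fun k => by
      rw [hfeq]; exact (hSi' k).add (hVi k)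
    have hfint : ∀ k, ∫ ω, f k ω ∂P ≤ x + 3 * ε := fun k => by
      rw [hfeq, integral_add (hSi' k) (hVi k),
        integral_add (hSi k) (hZ.1.mul_const _), integral_mul_const, hZ.2, hSx k]
      linarith [hVη k]
    have hf0 : ∀ k ω, 0 ≤ f k ω := fun k ω => by
      refine mul_nonneg (stateDensity_pos W l t T ω).le ?_
      by_cases hω : ω ∈ G k
      · have := hSG k ω hω
        linarith [hV0 k ω, this.1, this.2]
      · linarith [hSG' k ω hω]
    have hlim : ∀ᵐ ω ∂P, ENNReal.ofReal (stateDensity W l t T ω * X T ω) ≤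
        liminf (fun k => ENNReal.ofReal (f k ω)) atTop := by
      filter_upwards [hBC, hXeq, h.sq_integrable, h.nonneg] with ω hω hXω hsqω h0ω
      refine le_liminf_of_le (by isBoundedDefault) ?_
      filter_upwards [hω] with k hk
      apply ENNReal.ofReal_le_ofReal
      refine mul_le_mul_of_nonneg_left ?_ (stateDensity_pos W l t T ω).le
      have hk1 : ω ∉ bad1 (N k) := fun hh => hk (Or.inl hh)
      have hk2 : ω ∉ bad2 (N k) := fun hh => hk (Or.inr hh)
      have hclose := abs_wealth_sub_le (W := W) hσ htT (hψt (N k)) h.progressive hsqω hXω hδ hδε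
        (not_le.1 hk1) (fun s hs => not_le.1 fun hh => hk2 ⟨s, hs, hh⟩)
      have hGk : ω ∈ G k := hGsub k fun r hr => by
        have := abs_le.1 (hclose r hr)
        linarith [h0ω r hr, this.1]
      have hT := abs_le.1 (hclose T ⟨htT, le_rfl⟩)
      rw [(hSG k ω hGk).1]
      linarith [hT.1, hV0 k ω]
    calc ∫⁻ ω, ENNReal.ofReal (stateDensity W l t T ω * X T ω) ∂P
        ≤ ∫⁻ ω, liminf (fun k => ENNReal.ofReal (f k ω)) atTop ∂P := lintegral_mono_ae hlim
      _ ≤ liminf (fun k => ∫⁻ ω, ENNReal.ofReal (f k ω) ∂P) atTop :=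
          lintegral_liminf_le fun k => (hfm k).ennreal_ofReal
      _ ≤ ENNReal.ofReal (x + 3 * ε) := by
          refine liminf_le_of_le (by isBoundedDefault) fun b hb => ?_
          obtain ⟨k, hk⟩ := hb.exists
          refine hk.trans ?_
          rw [← ofReal_integral_eq_lintegral_ofReal (hfi k) (ae_of_all _ (hf0 k))]
          exact ENNReal.ofReal_le_ofReal (hfint k)
  have hlim : Tendsto (fun ε : ℝ => ENNReal.ofReal (x + 3 * ε)) (𝓝[>] 0)
      (𝓝 (ENNReal.ofReal (x + 3 * 0))) := by
    apply Tendsto.mono_left _ nhdsWithin_le_nhds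
    exact (ENNReal.continuous_ofReal.comp (by fun_prop)).tendsto 0
  rw [mul_zero, add_zero] at hlim
  exact ge_of_tendsto hlim (by filter_upwards [self_mem_nhdsWithin] with ε hε using main ε hε)

end Budget

/-! ### Itô integrals from pathwise second-order expansions -/

section ItoFormula

variable {Ω : Type*} {mΩ : MeasurableSpace Ω} {P : Measure Ω} {ℱ : Filtration ℝ≥0 mΩ}
  {W : ℝ≥0 → Ω → ℝ}

/-- The variance of the square of a standard Gaussian. -/
noncomputable def gaussianSqVariance : ℝ := ∫ n, (n ^ 2 - 1) ^ 2 ∂(gaussianReal 0 1)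

lemma gaussianSqVariance_nonneg : 0 ≤ gaussianSqVariance := integral_nonneg fun _ => sq_nonneg _

/-- The centred square `(ΔW)² - Δ` of a Brownian increment is orthogonal to the past, and its
variance given the past is `Δ²` times a constant. -/
lemma IsFiltrationBrownian.integral_sq_sub_mul [IsProbabilityMeasure P]
    (hW : IsFiltrationBrownian W ℱ P) {s r : ℝ≥0} (h : s ≤ r) {B : Ω → ℝ} (hB : Measurable[ℱ s] B)
    (hBi : Integrable B P) :
    (Integrable (fun ω => ((W r ω - W s ω) ^ 2 - ((r : ℝ) - s)) * B ω) P ∧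
      ∫ ω, ((W r ω - W s ω) ^ 2 - ((r : ℝ) - s)) * B ω ∂P = 0) ∧
    (Integrable (fun ω => ((W r ω - W s ω) ^ 2 - ((r : ℝ) - s)) ^ 2 * B ω) P ∧
      ∫ ω, ((W r ω - W s ω) ^ 2 - ((r : ℝ) - s)) ^ 2 * B ω ∂P =
        ((r : ℝ) - s) ^ 2 * gaussianSqVariance * ∫ ω, B ω ∂P) := by
  have h0 : (0 : ℝ) ≤ (r : ℝ) - s := sub_nonneg.2 (NNReal.coe_le_coe.2 h)
  have e1 : ∀ n : ℝ, (√((r : ℝ) - s) * n) ^ 2 - ((r : ℝ) - s) = ((r : ℝ) - s) * (n ^ 2 - 1) := by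
    intro n
    rw [mul_pow, Real.sq_sqrt h0]; ring
  have e2 : ∀ n : ℝ, ((√((r : ℝ) - s) * n) ^ 2 - ((r : ℝ) - s)) ^ 2 =
      ((r : ℝ) - s) ^ 2 * (n ^ 2 - 1) ^ 2 := fun n => by rw [e1, mul_pow]
  have i1 : Integrable (fun n : ℝ => n ^ 2 - 1) (gaussianReal 0 1) :=
    (integrable_gaussian_pow 2).sub (integrable_const 1)
  have i2 : Integrable (fun n : ℝ => (n ^ 2 - 1) ^ 2) (gaussianReal 0 1) := by
    have := ((integrable_gaussian_pow 4).sub ((integrable_gaussian_pow 2).const_mul 2)).add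
      (integrable_const 1)
    refine this.congr (ae_of_all _ fun n => ?_)
    simp only [Pi.add_apply, Pi.sub_apply]
    ring
  have k1 := hW.integral_increment_mul h (f := fun y => y ^ 2 - ((r : ℝ) - s)) (by fun_prop)
    (by simp only [e1]; exact i1.const_mul _) hB hBi
  have k2 := hW.integral_increment_mul h (f := fun y => (y ^ 2 - ((r : ℝ) - s)) ^ 2) (by fun_prop)
    (by simp only [e2]; exact i2.const_mul _) hB hBi
  refine ⟨⟨k1.1, k1.2.trans ?_⟩, k2.1, k2.2.trans ?_⟩
  · simp only [e1]
    rw [integral_const_mul, integral_sub (integrable_gaussian_pow 2) (integrable_const 1),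
      integral_gaussian_sq]
    simp
  · simp only [e2]
    rw [integral_const_mul, gaussianSqVariance]

/-- The martingale `∑ᵢ cᵢ ((ΔWᵢ)² - Δᵢ)`. -/
def quadVariationError (W : ℝ≥0 → Ω → ℝ) (a : ℕ → ℝ≥0) (c : ℕ → Ω → ℝ) (k : ℕ) (ω : Ω) : ℝ :=
  ∑ i ∈ Finset.range k, c i ω * ((W (a (i + 1)) ω - W (a i) ω) ^ 2 - ((a (i + 1) : ℝ) - a i))

/-- Kolmogorov's maximal inequality for `quadVariationError`, obtained by stopping the sums when
they first reach `ε`. -/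
lemma measure_quadVariationError_le [IsProbabilityMeasure P] (hW : IsFiltrationBrownian W ℱ P)
    {a : ℕ → ℝ≥0} (ha : Monotone a) {c : ℕ → Ω → ℝ} (hc : ∀ i, Measurable[ℱ (a i)] (c i)) {L : ℝ}
    (hL : ∀ i ω, |c i ω| ≤ L) {ε : ℝ} (hε : 0 < ε) (N : ℕ) :
    P {ω | ∃ k ≤ N, ε ≤ |quadVariationError W a c k ω|} ≤ ENNReal.ofReal
      (L ^ 2 * gaussianSqVariance * (∑ i ∈ Finset.range N, ((a (i + 1) : ℝ) - a i) ^ 2) /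
        ε ^ 2) := by
  classical
  set M := quadVariationError W a c with hM
  have hMm : ∀ k j, k ≤ j → Measurable[ℱ (a j)] (M k) := by
    intro k j hkj
    refine Finset.measurable_sum _ fun i hi => ?_
    have hik := Finset.mem_range.1 hi
    exact ((hc i).mono (ℱ.mono (ha (by omega))) le_rfl).mul
      ((((hW.measurable_le (ha (by omega))).sub
        (hW.measurable_le (ha (by omega)))).pow_const 2).sub_const _)
  -- `S` is the martingale stopped when its absolute value first reaches `ε`
  have key : ∀ k, ∃ S : Ω → ℝ, Measurable[ℱ (a k)] S ∧ Integrable (fun ω => S ω ^ 2) P ∧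
      ∫ ω, S ω ^ 2 ∂P ≤
        L ^ 2 * gaussianSqVariance * (∑ i ∈ Finset.range k, ((a (i + 1) : ℝ) - a i) ^ 2) ∧
      (∀ ω, (∀ j ≤ k, |M j ω| < ε) → S ω = M k ω) ∧
      (∀ ω, ¬ (∀ j ≤ k, |M j ω| < ε) → ε ≤ |S ω|) := by
    intro k
    induction k with
    | zero =>
      refine ⟨fun _ => 0, measurable_const, by simp, by simp, fun ω _ => by
        simp [hM, quadVariationError], fun ω h => absurd ?_ h⟩
      intro j hj
      obtain rfl : j = 0 := by omega
      simpa [hM, quadVariationError] using hε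
    | succ k ih =>
      obtain ⟨S, hS, hSi, hSle, hSe, hSg⟩ := ih
      set G : Set Ω := {ω | ∀ j ≤ k, |M j ω| < ε} with hG
      have hGm : MeasurableSet[ℱ (a k)] G := by
        have : G = ⋂ j, ⋂ (_ : j ≤ k), {ω | |M j ω| < ε} := by ext ω; simp [hG]
        rw [this]
        refine MeasurableSet.iInter fun j => MeasurableSet.iInter fun hj => ?_
        exact hMm j k hj (measurableSet_lt measurable_norm measurable_const)
      set u : Ω → ℝ := G.indicator (c k) with hu
      have hum : Measurable[ℱ (a k)] u := (hc k).indicator hGm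
      have huL : ∀ ω, |u ω| ≤ L := fun ω => by
        by_cases h : ω ∈ G
        · simpa [hu, h] using hL k ω
        · simpa [hu, h] using (abs_nonneg _).trans (hL k ω)
      have hu2 : ∀ ω, |u ω ^ 2| ≤ L ^ 2 := fun ω => by
        rw [abs_pow]; exact pow_le_pow_left₀ (abs_nonneg _) (huL ω) 2
      have hle : ℱ (a k) ≤ mΩ := ℱ.le _
      have hSi1 : Integrable S P := by
        refine Integrable.mono' ((integrable_const (1 : ℝ)).add hSi)
          (hS.mono hle le_rfl).aestronglyMeasurable (ae_of_all _ fun ω => ?_)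
        rw [Real.norm_eq_abs, Pi.add_apply, ← sq_abs]
        nlinarith [sq_nonneg (|S ω| - 1 / 2)]
      have hSu : Integrable (fun ω => S ω * u ω) P :=
        hSi1.mul_bdd (c := L) (hum.mono hle le_rfl).aestronglyMeasurable (ae_of_all _ huL)
      have hui : Integrable (fun ω => u ω ^ 2) P :=
        Integrable.of_bound ((hum.pow_const 2).mono hle le_rfl).aestronglyMeasurable (L ^ 2)
          (ae_of_all _ hu2)
      set Δ : ℝ := (a (k + 1) : ℝ) - a k with hΔ
      set ξ : Ω → ℝ := fun ω => (W (a (k + 1)) ω - W (a k) ω) ^ 2 - Δ with hξ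
      obtain ⟨i1, e1⟩ := (hW.integral_sq_sub_mul (ha (Nat.le_succ k)) (hS.mul hum) hSu).1
      obtain ⟨i2, e2⟩ := (hW.integral_sq_sub_mul (ha (Nat.le_succ k)) (hum.pow_const 2) hui).2
      replace i1 : Integrable (fun ω => ξ ω * (S ω * u ω)) P := i1
      replace i2 : Integrable (fun ω => ξ ω ^ 2 * u ω ^ 2) P := i2
      have hexp : (fun ω => (S ω + u ω * ξ ω) ^ 2) = fun ω =>
          (S ω ^ 2 + 2 * (ξ ω * (S ω * u ω))) + ξ ω ^ 2 * u ω ^ 2 := by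
        ext ω; ring
      have i1' : Integrable (fun ω => S ω ^ 2 + 2 * (ξ ω * (S ω * u ω))) P :=
        hSi.add (i1.const_mul 2)
      refine ⟨fun ω => S ω + u ω * ξ ω, ?_, ?_, ?_, ?_, ?_⟩
      · have hle' : ℱ (a k) ≤ ℱ (a (k + 1)) := ℱ.mono (ha (Nat.le_succ k))
        refine (hS.mono hle' le_rfl).add ((hum.mono hle' le_rfl).mul ?_)
        exact (((hW.measurable_le le_rfl).sub
          (hW.measurable_le (ha (Nat.le_succ k)))).pow_const 2).sub_const _
      · rw [hexp]; exact i1'.add i2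
      · have hul : ∫ ω, u ω ^ 2 ∂P ≤ L ^ 2 := by
          calc ∫ ω, u ω ^ 2 ∂P ≤ ∫ _, L ^ 2 ∂P :=
                integral_mono hui (integrable_const _) fun ω => (le_abs_self _).trans (hu2 ω)
            _ = L ^ 2 := by simp
        rw [hexp, integral_add i1' i2, integral_add hSi (i1.const_mul 2), integral_const_mul]
        have e1' : ∫ ω, ξ ω * (S ω * u ω) ∂P = 0 := e1
        have e2' : ∫ ω, ξ ω ^ 2 * u ω ^ 2 ∂P = Δ ^ 2 * gaussianSqVariance * ∫ ω, u ω ^ 2 ∂P := e2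
        rw [e1', e2', Finset.sum_range_succ, mul_add]
        have : Δ ^ 2 * gaussianSqVariance * ∫ ω, u ω ^ 2 ∂P ≤
            Δ ^ 2 * gaussianSqVariance * L ^ 2 := by
          have := gaussianSqVariance_nonneg
          gcongr
        rw [← hΔ]
        linarith
      · intro ω hω
        have hωG : ω ∈ G := fun j hj => hω j (by omega)
        simp only [hu, indicator_of_mem hωG]
        rw [hSe ω hωG, hM, quadVariationError, quadVariationError, Finset.sum_range_succ]
      · intro ω hω
        by_cases hωG : ω ∈ G
        · have hMk : ε ≤ |M (k + 1) ω| := by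
            by_contra! hlt
            refine hω fun j hj => ?_
            rcases hj.lt_or_eq with h | rfl
            · exact hωG j (by omega)
            · exact hlt
          simp only [hu, indicator_of_mem hωG]
          rw [hSe ω hωG]
          convert hMk using 2
          rw [hM, quadVariationError, quadVariationError, Finset.sum_range_succ]
        · simp only [hu, indicator_of_notMem hωG, zero_mul, add_zero]
          exact hSg ω hωG
  obtain ⟨S, hS, hSi, hSle, -, hSg⟩ := key N
  have hsub : {ω | ∃ k ≤ N, ε ≤ |M k ω|} ⊆ {ω | ε ^ 2 ≤ S ω ^ 2} := by
    rintro ω ⟨k, hk, hkε⟩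
    have := hSg ω fun h => absurd (h k hk) (not_lt.2 hkε)
    rw [mem_ofPred_eq, ← sq_abs (S ω)]
    exact pow_le_pow_left₀ hε.le this 2
  have hmark := mul_meas_ge_le_integral_of_nonneg (ae_of_all _ fun ω => sq_nonneg (S ω)) hSi (ε ^ 2)
  have hreal : P.real {ω | ε ^ 2 ≤ S ω ^ 2} ≤
      L ^ 2 * gaussianSqVariance * (∑ i ∈ Finset.range N, ((a (i + 1) : ℝ) - a i) ^ 2) / ε ^ 2 := by
    rw [le_div_iff₀ (by positivity), mul_comm]
    exact hmark.trans hSle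
  calc P {ω | ∃ k ≤ N, ε ≤ |M k ω|} ≤ P {ω | ε ^ 2 ≤ S ω ^ 2} := measure_mono hsub
    _ = ENNReal.ofReal (P.real {ω | ε ^ 2 ≤ S ω ^ 2}) := (ofReal_measureReal).symm
    _ ≤ _ := ENNReal.ofReal_le_ofReal hreal

lemma measure_sum_sq_increment_le [IsProbabilityMeasure P] (hW : IsFiltrationBrownian W ℱ P)
    {a : ℕ → ℝ≥0} (ha : Monotone a) {K : ℝ} (hK : 0 < K) (N : ℕ) :
    P {ω | K ≤ ∑ i ∈ Finset.range N, (W (a (i + 1)) ω - W (a i) ω) ^ 2} ≤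
      ENNReal.ofReal (((a N : ℝ) - a 0) / K) := by
  have h1 : ∀ i, Integrable (fun ω => (W (a (i + 1)) ω - W (a i) ω) ^ 2) P ∧
      ∫ ω, (W (a (i + 1)) ω - W (a i) ω) ^ 2 ∂P = (a (i + 1) : ℝ) - a i := by
    intro i
    have hle := ha (Nat.le_succ i)
    have h0 : (0 : ℝ) ≤ (a (i + 1) : ℝ) - a i := sub_nonneg.2 (NNReal.coe_le_coe.2 hle)
    have e : ∀ n : ℝ, (√((a (i + 1) : ℝ) - a i) * n) ^ 2 = ((a (i + 1) : ℝ) - a i) * n ^ 2 :=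
      fun n => by rw [mul_pow, Real.sq_sqrt h0]
    constructor
    · refine hW.integrable_increment hle (f := fun y => y ^ 2) (by fun_prop) ?_
      simp only [Nat.succ_eq_add_one, e]
      exact (integrable_gaussian_pow 2).const_mul _
    · rw [hW.integral_increment hle (f := fun y => y ^ 2) (by fun_prop)]
      simp only [Nat.succ_eq_add_one, e]
      rw [integral_const_mul, integral_gaussian_sq, mul_one]
  have hi : Integrable (fun ω => ∑ i ∈ Finset.range N, (W (a (i + 1)) ω - W (a i) ω) ^ 2) P :=
    integrable_finsetSum _ fun i _ => (h1 i).1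
  have hint : ∫ ω, ∑ i ∈ Finset.range N, (W (a (i + 1)) ω - W (a i) ω) ^ 2 ∂P =
      (a N : ℝ) - a 0 := by
    rw [integral_finsetSum _ fun i _ => (h1 i).1, Finset.sum_congr rfl fun i _ => (h1 i).2]
    exact Finset.sum_range_sub (fun i => (a i : ℝ)) N
  have hmark := mul_meas_ge_le_integral_of_nonneg
    (ae_of_all _ fun ω => Finset.sum_nonneg fun i _ => sq_nonneg _) hi K
  rw [hint] at hmark
  rw [← ofReal_measureReal]
  apply ENNReal.ofReal_le_ofReal
  rw [le_div_iff₀ hK, mul_comm]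
  exact hmark

/-- Decreasing events with empty intersection have arbitrarily small probability. -/
lemma exists_measure_le_of_antitone [IsFiniteMeasure P] {B : ℕ → Set Ω}
    (hm : ∀ n, MeasurableSet (B n)) (ha : Antitone B) (h : ∀ ω, ∃ n, ω ∉ B n) {η : ℝ≥0∞}
    (hη : 0 < η) : ∃ n, P (B n) ≤ η := by
  have := tendsto_measure_iInter_atTop (μ := P) (fun n => (hm n).nullMeasurableSet) ha
    ⟨0, measure_ne_top _ _⟩
  have he : ⋂ n, B n = ∅ := by
    ext ω
    simpa using h ω
  rw [he, measure_empty] at this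
  exact (this.eventually (eventually_le_nhds hη)).exists

/-- A property of pairs of nearby times which holds on every path for sufficiently close times
holds, for a common bound on the distance, outside an event of small probability. -/
lemma exists_uniform_mesh [IsFiniteMeasure P] {t T : ℝ≥0} (htT : t < T) {Φ : ℝ≥0 → ℝ≥0 → Ω → ℝ}
    (hm : ∀ r s, Measurable (Φ r s)) (hc : ∀ ω, Continuous fun p : ℝ≥0 × ℝ≥0 => Φ p.1 p.2 ω)
    (h : ∀ ω, ∃ ρ > 0, ∀ r ∈ Icc t T, ∀ s ∈ Icc t T, r < s → (s : ℝ) - r < ρ → Φ r s ω ≤ 0)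
    {η : ℝ≥0∞} (hη : 0 < η) :
    ∃ ρ : ℝ, 0 < ρ ∧ ∃ B : Set Ω, P B ≤ η ∧ ∀ ω ∉ B, ∀ r ∈ Icc t T, ∀ s ∈ Icc t T, r < s →
      (s : ℝ) - r < ρ → Φ r s ω ≤ 0 := by
  have : Nonempty (Icc t T) := ⟨⟨t, le_rfl, htT.le⟩⟩
  set D := TopologicalSpace.denseSeq (Icc t T) with hD
  set Γ : ℕ → Set Ω := fun n => ⋂ i, ⋂ j, {ω | D i < D j →
    ((D j : ℝ≥0) : ℝ) - (D i : ℝ≥0) < 1 / ((n : ℝ) + 1) → Φ (D i) (D j) ω ≤ 0} with hΓ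
  have hΓm : ∀ n, MeasurableSet (Γ n) := fun n => by
    refine MeasurableSet.iInter fun i => MeasurableSet.iInter fun j => ?_
    by_cases h1 : D i < D j
    · by_cases h2 : ((D j : ℝ≥0) : ℝ) - (D i : ℝ≥0) < 1 / ((n : ℝ) + 1)
      · simp only [h1, h2, forall_true_left]
        exact measurableSet_le (hm _ _) measurable_const
      · convert MeasurableSet.univ
        exact eq_univ_of_forall fun ω _ h => absurd h h2
    · simp [h1]
  have hanti : Antitone fun n => (Γ n)ᶜ := fun n m hnm => by
    refine compl_subset_compl.2 fun ω hω => ?_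
    simp only [hΓ, mem_iInter, mem_ofPred_eq] at hω ⊢
    exact fun i j hij hlt => hω i j hij (hlt.trans_le (Nat.one_div_le_one_div hnm))
  obtain ⟨n, hn⟩ := exists_measure_le_of_antitone (P := P) (fun n => (hΓm n).compl) hanti
    (fun ω => by
      obtain ⟨ρ, hρ, hω⟩ := h ω
      obtain ⟨n, hn⟩ := exists_nat_one_div_lt hρ
      refine ⟨n, ?_⟩
      simp only [hΓ, mem_compl_iff, not_not, mem_iInter, mem_ofPred_eq]
      exact fun i j hij hlt => hω _ (D i).2 _ (D j).2 hij (hlt.trans hn)) hη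
  refine ⟨1 / ((n : ℝ) + 1), by positivity, (Γ n)ᶜ, hn, fun ω hω r hr s hs hrs hlt => ?_⟩
  rw [mem_compl_iff, not_not] at hω
  simp only [hΓ, mem_iInter, mem_ofPred_eq] at hω
  have hdense : Dense (range (Prod.map D D)) :=
    (TopologicalSpace.denseRange_denseSeq (Icc t T)).prodMap
      (TopologicalSpace.denseRange_denseSeq (Icc t T))
  set O : Set (Icc t T × Icc t T) :=
    {p | p.1 < p.2 ∧ ((p.2 : ℝ≥0) : ℝ) - (p.1 : ℝ≥0) < 1 / ((n : ℝ) + 1)} with hO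
  have hOo : IsOpen O := (isOpen_lt continuous_fst continuous_snd).inter
    (isOpen_lt
      (f := fun p : Icc t T × Icc t T => ((p.2 : ℝ≥0) : ℝ) - (p.1 : ℝ≥0)) (by fun_prop)
      continuous_const)
  have hcl : IsClosed {p : Icc t T × Icc t T | Φ p.1 p.2 ω ≤ 0} := by
    refine isClosed_le ?_ continuous_const
    exact (hc ω).comp (f := fun p : Icc t T × Icc t T => ((p.1 : ℝ≥0), (p.2 : ℝ≥0)))
      (by fun_prop)
  have hsub : O ∩ range (Prod.map D D) ⊆ {p : Icc t T × Icc t T | Φ p.1 p.2 ω ≤ 0} := by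
    rintro _ ⟨hp, ⟨i, j⟩, rfl⟩
    exact hω i j hp.1 hp.2
  exact hcl.closure_subset_iff.2 hsub
    (hdense.open_subset_closure_inter hOo (show ((⟨r, hr⟩, ⟨s, hs⟩) : Icc t T × Icc t T) ∈ O from
      ⟨hrs, hlt⟩))

lemma exists_path_modulus {f : ℝ≥0 → ℝ} (hf : Continuous f) (t T : ℝ≥0) {ε : ℝ} (hε : 0 < ε) :
    ∃ ρ : ℝ, 0 < ρ ∧ ∀ r ∈ Icc t T, ∀ s ∈ Icc t T, r ≤ s → (s : ℝ) - r < ρ → |f s - f r| < ε := by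
  have hu := isCompact_Icc.uniformContinuousOn_of_continuous (s := Icc t T) hf.continuousOn
  rw [Metric.uniformContinuousOn_iff] at hu
  obtain ⟨ρ, hρ, h⟩ := hu ε hε
  refine ⟨ρ, hρ, fun r hr s hs hrs hlt => ?_⟩
  rw [← Real.dist_eq]
  refine h s hs r hr ?_
  rwa [NNReal.dist_eq, abs_of_nonneg (sub_nonneg.2 (NNReal.coe_le_coe.2 hrs))]

lemma exists_uniform_modulus [IsFiniteMeasure P] {t T : ℝ≥0} (htT : t < T) {Φ : ℝ≥0 → Ω → ℝ}
    (hm : ∀ s, Measurable (Φ s)) (hc : ∀ ω, Continuous fun s => Φ s ω) {ε : ℝ} (hε : 0 < ε)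
    {η : ℝ≥0∞} (hη : 0 < η) :
    ∃ ρ : ℝ, 0 < ρ ∧ ∃ B : Set Ω, P B ≤ η ∧ ∀ ω ∉ B, ∀ r ∈ Icc t T, ∀ s ∈ Icc t T, r < s →
      (s : ℝ) - r < ρ → |Φ s ω - Φ r ω| ≤ ε := by
  obtain ⟨ρ, hρ, B, hB, h⟩ := exists_uniform_mesh (P := P) htT
    (Φ := fun r s ω => |Φ s ω - Φ r ω| - ε)
    (fun r s => (((hm s).sub (hm r)).abs).sub_const _)
    (fun ω => by
      have := hc ω
      fun_prop)
    (fun ω => by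
      obtain ⟨ρ, hρ, h⟩ := exists_path_modulus (hc ω) t T hε
      exact ⟨ρ, hρ, fun r hr s hs hrs hlt => sub_nonpos.2 (h r hr s hs hrs.le hlt).le⟩) hη
  exact ⟨ρ, hρ, B, hB, fun ω hω r hr s hs hrs hlt => by
    linarith [h ω hω r hr s hs hrs hlt]⟩

lemma exists_uniform_bound [IsFiniteMeasure P] {t T : ℝ≥0} (htT : t < T) {Φ : ℝ≥0 → Ω → ℝ}
    (hm : ∀ s, Measurable (Φ s)) (hc : ∀ ω, Continuous fun s => Φ s ω) {η : ℝ≥0∞} (hη : 0 < η) :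
    ∃ L : ℝ, 0 ≤ L ∧ ∃ B : Set Ω, P B ≤ η ∧ ∀ ω ∉ B, ∀ s ∈ Icc t T, |Φ s ω| ≤ L := by
  have : Nonempty (Icc t T) := ⟨⟨t, le_rfl, htT.le⟩⟩
  set D := TopologicalSpace.denseSeq (Icc t T) with hD
  set Γ : ℕ → Set Ω := fun n => ⋂ i, {ω | |Φ (D i) ω| ≤ n} with hΓ
  have hΓm : ∀ n, MeasurableSet (Γ n) := fun n =>
    MeasurableSet.iInter fun i => measurableSet_le (hm _).abs measurable_const
  have hanti : Antitone fun n => (Γ n)ᶜ := fun n m hnm => by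
    refine compl_subset_compl.2 fun ω hω => ?_
    simp only [hΓ, mem_iInter, mem_ofPred_eq] at hω ⊢
    exact fun i => (hω i).trans (by exact_mod_cast hnm)
  obtain ⟨n, hn⟩ := exists_measure_le_of_antitone (P := P) (fun n => (hΓm n).compl) hanti
    (fun ω => by
      obtain ⟨C, hC⟩ := isCompact_Icc.exists_bound_of_continuousOn (s := Icc t T)
        (hc ω).continuousOn
      obtain ⟨n, hn⟩ := exists_nat_ge C
      refine ⟨n, ?_⟩
      simp only [hΓ, mem_compl_iff, not_not, mem_iInter, mem_ofPred_eq]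
      exact fun i => (hC _ (D i).2).trans hn) hη
  refine ⟨n, by positivity, (Γ n)ᶜ, hn, fun ω hω s hs => ?_⟩
  rw [mem_compl_iff, not_not] at hω
  simp only [hΓ, mem_iInter, mem_ofPred_eq] at hω
  have hcl : IsClosed {p : Icc t T | |Φ p ω| ≤ n} :=
    isClosed_le (((hc ω).comp continuous_subtype_val).abs) continuous_const
  have := (TopologicalSpace.denseRange_denseSeq (Icc t T)).closure_range
  have hsub : closure (range D) ⊆ {p : Icc t T | |Φ p ω| ≤ n} :=
    hcl.closure_subset_iff.2 (by rintro _ ⟨i, rfl⟩; exact hω i)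
  rw [this] at hsub
  exact hsub (mem_univ (⟨s, hs⟩ : Icc t T))

end ItoFormula

/-! ### Discretization of stochastic integrals -/

section ItoApproximation

variable {Ω : Type*} {mΩ : MeasurableSpace Ω} {P : Measure Ω} {ℱ : Filtration ℝ≥0 mΩ}
  {W : ℝ≥0 → Ω → ℝ}

lemma exists_measurable_truncation {m : MeasurableSpace Ω} {f : Ω → ℝ} (hf : Measurable[m] f)
    {L : ℝ} (hL : 0 ≤ L) :
    ∃ v : Ω → ℝ, Measurable[m] v ∧ (∀ ω, |v ω| ≤ L) ∧ ∀ ω, |f ω| ≤ L → v ω = f ω := by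
  refine ⟨fun ω => max (-L) (min L (f ω)), measurable_const.max (measurable_const.min hf),
    fun ω => ?_, fun ω h => ?_⟩
  · rw [abs_le]
    exact ⟨le_max_left _ _, max_le (by linarith) (min_le_left _ _)⟩
  · obtain ⟨h1, h2⟩ := abs_le.1 h
    simp only
    rw [min_eq_right h2, max_eq_right h1]

lemma exists_lt_le_succ {a : ℕ → ℝ≥0} {s : ℝ≥0} (h0 : a 0 < s) :
    ∀ N : ℕ, s ≤ a N → ∃ k < N, a k < s ∧ s ≤ a (k + 1)
  | 0, h => absurd h (not_le.2 h0)
  | N + 1, h => by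
    rcases lt_or_ge (a N) s with h1 | h1
    · exact ⟨N, by omega, h1, h⟩
    · obtain ⟨k, hk, h2⟩ := exists_lt_le_succ h0 N h1
      exact ⟨k, by omega, h2⟩

namespace SimpleIntegrand

variable (ψ : SimpleIntegrand ℱ)

lemma process_of_mem {k : ℕ} (hk : k < ψ.n) {u : ℝ≥0} (hu : ψ.time k < u)
    (hu' : u ≤ ψ.time (k + 1)) (ω : Ω) : ψ.process u ω = ψ.val k ω := by
  unfold process
  rw [Finset.sum_eq_single k]
  · exact indicator_of_mem (show u ∈ Ioc _ _ from ⟨hu, hu'⟩) _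
  · intro i _ hik
    refine indicator_of_notMem (fun h => ?_) _
    rcases lt_or_gt_of_ne hik with hlt | hlt
    · exact absurd (h.2.trans (ψ.mono (Nat.succ_le_of_lt hlt))) (not_le.2 hu)
    · exact absurd (hu'.trans (ψ.mono (Nat.succ_le_of_lt hlt))) (not_le.2 h.1)
  · exact fun h => absurd (Finset.mem_range.2 hk) h

lemma integral_of_mem {k : ℕ} (hk : k < ψ.n) {s : ℝ≥0} (hs : ψ.time k ≤ s)
    (hs' : s ≤ ψ.time (k + 1)) (ω : Ω) :
    ψ.integral W s ω =
      (∑ i ∈ Finset.range k, ψ.val i ω * (W (ψ.time (i + 1)) ω - W (ψ.time i) ω)) +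
        ψ.val k ω * (W s ω - W (ψ.time k) ω) := by
  unfold integral
  rw [← Finset.sum_subset (Finset.range_mono (Nat.succ_le_of_lt hk)), Finset.sum_range_succ,
    min_eq_right hs', min_eq_left hs]
  · congr 1
    refine Finset.sum_congr rfl fun i hi => ?_
    have hik := Finset.mem_range.1 hi
    rw [min_eq_left ((ψ.mono (by omega : i + 1 ≤ k)).trans hs),
      min_eq_left ((ψ.mono hik.le).trans hs)]
  · intro i _ hi
    have hik : k + 1 ≤ i := by simpa using hi
    rw [min_eq_right (hs'.trans (ψ.mono (by omega))), min_eq_right (hs'.trans (ψ.mono hik)),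
      sub_self, mul_zero]

end SimpleIntegrand

/-- Along every path, `F` has increments
`φ ΔW + c ((ΔW)² - Δs) + o((ΔW)² + Δs)`, uniformly on `[t,T]`. -/
def HasItoExpansion (W : ℝ≥0 → Ω → ℝ) (t T : ℝ≥0) (φ c F : ℝ≥0 → Ω → ℝ) : Prop :=
  ∀ ω, ∀ ε > 0, ∃ ρ > 0, ∀ r ∈ Icc t T, ∀ s ∈ Icc t T, r < s → (s : ℝ) - r < ρ →
    |F s ω - F r ω - φ r ω * (W s ω - W r ω) - c r ω * ((W s ω - W r ω) ^ 2 - ((s : ℝ) - r))| ≤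
      ε * ((W s ω - W r ω) ^ 2 + ((s : ℝ) - r))

/-- On a path on which the second-order errors are small, the elementary integral of a
discretization of `φ` is close to the increment of `F`. -/
lemma SimpleIntegrand.abs_integral_sub_le (ψ : SimpleIntegrand ℱ) {F : ℝ≥0 → Ω → ℝ}
    {c : ℕ → Ω → ℝ} {ω : Ω} {ε L K : ℝ} (hε : 0 ≤ ε)
    (hexp : ∀ i < ψ.n, |F (ψ.time (i + 1)) ω - F (ψ.time i) ω -
        ψ.val i ω * (W (ψ.time (i + 1)) ω - W (ψ.time i) ω) -
        c i ω * ((W (ψ.time (i + 1)) ω - W (ψ.time i) ω) ^ 2 -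
          ((ψ.time (i + 1) : ℝ) - ψ.time i))| ≤
      ε * ((W (ψ.time (i + 1)) ω - W (ψ.time i) ω) ^ 2 + ((ψ.time (i + 1) : ℝ) - ψ.time i)))
    (hM : ∀ k ≤ ψ.n, |quadVariationError W ψ.time c k ω| ≤ ε)
    (hK : ∑ i ∈ Finset.range ψ.n, (W (ψ.time (i + 1)) ω - W (ψ.time i) ω) ^ 2 ≤ K)
    (hL : ∀ i, |ψ.val i ω| ≤ L) {k : ℕ} (hk : k < ψ.n) {s : ℝ≥0} (hs : ψ.time k ≤ s)
    (hs' : s ≤ ψ.time (k + 1)) (hsW : |W s ω - W (ψ.time k) ω| ≤ ε)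
    (hsF : |F s ω - F (ψ.time k) ω| ≤ ε) :
    |ψ.integral W s ω - (F s ω - F (ψ.time 0) ω)| ≤
      ε * (K + ((ψ.time ψ.n : ℝ) - ψ.time 0) + L + 2) := by
  set a := ψ.time with ha
  set D : ℕ → ℝ := fun i => W (a (i + 1)) ω - W (a i) ω with hD
  set Δ : ℕ → ℝ := fun i => (a (i + 1) : ℝ) - a i with hΔ
  have hΔ0 : ∀ i, 0 ≤ Δ i := fun i =>
    sub_nonneg.2 (NNReal.coe_le_coe.2 (ψ.mono (Nat.le_succ i)))
  set e : ℕ → ℝ := fun i => F (a (i + 1)) ω - F (a i) ω - ψ.val i ω * D i -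
    c i ω * (D i ^ 2 - Δ i) with he
  have hF : ∑ i ∈ Finset.range k, (F (a (i + 1)) ω - F (a i) ω) = F (a k) ω - F (a 0) ω :=
    Finset.sum_range_sub (fun i => F (a i) ω) k
  have hsum : ∑ i ∈ Finset.range k, e i = F (a k) ω - F (a 0) ω -
      (∑ i ∈ Finset.range k, ψ.val i ω * D i) - quadVariationError W a c k ω := by
    rw [← hF, quadVariationError, ← Finset.sum_sub_distrib, ← Finset.sum_sub_distrib]
  have hle : |∑ i ∈ Finset.range k, e i| ≤ ε * (K + ((a ψ.n : ℝ) - a 0)) := by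
    calc |∑ i ∈ Finset.range k, e i| ≤ ∑ i ∈ Finset.range k, |e i| :=
          Finset.abs_sum_le_sum_abs _ _
      _ ≤ ∑ i ∈ Finset.range k, ε * (D i ^ 2 + Δ i) :=
          Finset.sum_le_sum fun i hi => hexp i ((Finset.mem_range.1 hi).trans hk)
      _ ≤ ∑ i ∈ Finset.range ψ.n, ε * (D i ^ 2 + Δ i) :=
          Finset.sum_le_sum_of_subset_of_nonneg (Finset.range_mono hk.le)
            fun i _ _ => mul_nonneg hε (add_nonneg (sq_nonneg _) (hΔ0 i))
      _ = ε * ((∑ i ∈ Finset.range ψ.n, D i ^ 2) + ((a ψ.n : ℝ) - a 0)) := by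
          rw [← Finset.mul_sum, Finset.sum_add_distrib]
          congr 2
          exact Finset.sum_range_sub (fun i => (a i : ℝ)) ψ.n
      _ ≤ _ := by gcongr
  have hint := ψ.integral_of_mem (W := W) hk hs hs' ω
  have hlast : |ψ.val k ω * (W s ω - W (a k) ω)| ≤ L * ε := by
    rw [abs_mul]
    exact mul_le_mul (hL k) hsW (abs_nonneg _) ((abs_nonneg _).trans (hL k))
  have hMk := hM k hk.le
  rw [hint]
  have hrw : (∑ i ∈ Finset.range k, ψ.val i ω * (W (a (i + 1)) ω - W (a i) ω)) +
      ψ.val k ω * (W s ω - W (a k) ω) - (F s ω - F (a 0) ω) =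
      -(∑ i ∈ Finset.range k, e i) - quadVariationError W a c k ω +
        ψ.val k ω * (W s ω - W (a k) ω) - (F s ω - F (a k) ω) := by
    rw [hsum]; ring
  rw [hrw, abs_le]
  obtain ⟨b1, b2⟩ := abs_le.1 hle
  obtain ⟨b3, b4⟩ := abs_le.1 hlast
  obtain ⟨b5, b6⟩ := abs_le.1 hMk
  obtain ⟨b7, b8⟩ := abs_le.1 hsF
  constructor <;> linarith

lemma measure_union_le_ofReal {A B : Set Ω} {x y : ℝ} (hx : 0 ≤ x) (hy : 0 ≤ y)
    (hA : P A ≤ ENNReal.ofReal x) (hB : P B ≤ ENNReal.ofReal y) :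
    P (A ∪ B) ≤ ENNReal.ofReal (x + y) := by
  rw [ENNReal.ofReal_add hx hy]
  exact (measure_union_le _ _).trans (add_le_add hA hB)

/-- Discretizing `φ` on a fine grid gives a simple integrand that is close to `φ` and whose integral
is close to the increments of `F`, outside an event of small probability. -/
lemma HasItoExpansion.exists_simpleIntegrand [IsProbabilityMeasure P]
    (hW : IsFiltrationBrownian W ℱ P) {t T : ℝ≥0} (htT : t < T) {φ c F : ℝ≥0 → Ω → ℝ}
    (hφ : ∀ s, Measurable[ℱ s] (φ s)) (hφc : ∀ ω, Continuous fun s => φ s ω)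
    (hc : ∀ s, Measurable[ℱ s] (c s)) (hcc : ∀ ω, Continuous fun s => c s ω)
    (hF : ∀ s, Measurable[ℱ s] (F s)) (hFc : ∀ ω, Continuous fun s => F s ω)
    (hexp : HasItoExpansion W t T φ c F) {ε : ℝ} (hε : 0 < ε) :
    ∃ (ψ : SimpleIntegrand ℱ) (B : Set Ω), t ≤ ψ.time 0 ∧ P B ≤ ENNReal.ofReal ε ∧ ∀ ω ∉ B,
      ∫⁻ u in Icc (t : ℝ) T, ENNReal.ofReal ((ψ.process u.toNNReal ω - φ u.toNNReal ω) ^ 2) <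
        ENNReal.ofReal ε ∧
      ∀ s ∈ Icc t T, |ψ.integral W s ω - (F s ω - F t ω)| < ε := by
  have hmono : ∀ {G : ℝ≥0 → Ω → ℝ}, (∀ s, Measurable[ℱ s] (G s)) → ∀ s, Measurable (G s) :=
    fun h s => (h s).mono (ℱ.le s) le_rfl
  have hWm : ∀ s, Measurable (W s) := fun s => (hW.measurable_le le_rfl).mono (ℱ.le s) le_rfl
  have hWc := hW.continuous_paths
  have htT' : (0 : ℝ) < (T : ℝ) - t := sub_pos.2 (NNReal.coe_lt_coe.2 htT)
  have hη : 0 < ENNReal.ofReal (ε / 8) := ENNReal.ofReal_pos.2 (by positivity)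
  obtain ⟨L₁, hL₁, B₁, hB₁, h₁⟩ := exists_uniform_bound (P := P) htT (hmono hφ) hφc hη
  obtain ⟨L₂, hL₂, B₂, hB₂, h₂⟩ := exists_uniform_bound (P := P) htT (hmono hc) hcc hη
  set L := max L₁ L₂ with hL
  have hL0 : 0 ≤ L := hL₁.trans (le_max_left _ _)
  set K := 8 * ((T : ℝ) - t) / ε with hK
  have hK0 : 0 < K := by positivity
  set Q := K + ((T : ℝ) - t) + L + 2 with hQ
  have hQ0 : 0 < Q := by positivity
  set δ := min 1 (ε / (2 * Q)) with hδ
  have hδ0 : 0 < δ := lt_min one_pos (by positivity)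
  have hδQ : δ * Q ≤ ε / 2 := by
    calc δ * Q ≤ ε / (2 * Q) * Q := by gcongr; exact min_le_right _ _
      _ = ε / 2 := by field_simp
  obtain ⟨ρ₃, hρ₃, B₃, hB₃, h₃⟩ := exists_uniform_mesh (P := P) htT (Φ := fun r s ω =>
      |F s ω - F r ω - φ r ω * (W s ω - W r ω) - c r ω * ((W s ω - W r ω) ^ 2 - ((s : ℝ) - r))| -
        δ * ((W s ω - W r ω) ^ 2 + ((s : ℝ) - r)))
    (fun r s => by
      have h1 := hmono hF s
      have h2 := hmono hF r
      have h3 := hmono hφ r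
      have h4 := hmono hc r
      have h5 := hWm s
      have h6 := hWm r
      fun_prop)
    (fun ω => by
      have h1 := hFc ω
      have h2 := hφc ω
      have h3 := hcc ω
      have h4 := hWc ω
      fun_prop)
    (fun ω => by
      obtain ⟨ρ, hρ, h⟩ := hexp ω δ hδ0
      exact ⟨ρ, hρ, fun r hr s hs hrs hlt => sub_nonpos.2 (h r hr s hs hrs hlt)⟩) hη
  obtain ⟨ρ₄, hρ₄, B₄, hB₄, h₄⟩ := exists_uniform_modulus (P := P) htT (hmono hφ) hφc hδ0 hη
  obtain ⟨ρ₅, hρ₅, B₅, hB₅, h₅⟩ := exists_uniform_modulus (P := P) htT hWm hWc hδ0 hη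
  obtain ⟨ρ₆, hρ₆, B₆, hB₆, h₆⟩ := exists_uniform_modulus (P := P) htT (hmono hF) hFc hδ0 hη
  set ρ := min (min ρ₃ ρ₄) (min ρ₅ ρ₆) with hρ
  have hρ0 : 0 < ρ := lt_min (lt_min hρ₃ hρ₄) (lt_min hρ₅ hρ₆)
  -- the number of grid points: the mesh is below `ρ`, and Kolmogorov's inequality is effective
  set A := L ^ 2 * gaussianSqVariance * ((T : ℝ) - t) ^ 2 / δ ^ 2 with hA
  have hA0 : 0 ≤ A := by
    have := gaussianSqVariance_nonneg
    positivity
  obtain ⟨n, hn⟩ := exists_nat_gt (((T : ℝ) - t) / ρ + 8 * A / ε)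
  have hn1 : ((T : ℝ) - t) / ρ < n := lt_of_le_of_lt (le_add_of_nonneg_right (by positivity)) hn
  have hn2 : 8 * A / ε < n := lt_of_le_of_lt (le_add_of_nonneg_left (by positivity)) hn
  have hn0 : (0 : ℝ) < n := lt_of_le_of_lt (by positivity) hn1
  have hn0' : (n : ℝ≥0) ≠ 0 := by
    intro h
    rw [Nat.cast_eq_zero] at h
    simp [h] at hn0
  set h : ℝ≥0 := (T - t) / n with hh
  have hhr : (h : ℝ) = ((T : ℝ) - t) / n := by
    rw [hh, NNReal.coe_div, NNReal.coe_sub htT.le]; simp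
  set a : ℕ → ℝ≥0 := fun i => t + i * h with ha
  have ha0 : a 0 = t := by simp [ha]
  have han : a n = T := by
    simp only [ha, hh]
    rw [mul_div_cancel₀ _ hn0', add_tsub_cancel_of_le htT.le]
  have hamono : Monotone a := fun i j hij => by
    simp only [ha]
    gcongr
  have hstep : ∀ i, (a (i + 1) : ℝ) - a i = h := fun i => by
    simp only [ha]; push_cast; ring
  have hhρ : (h : ℝ) < ρ := by
    rw [hhr, div_lt_iff₀ hn0]
    rwa [div_lt_iff₀ hρ0, mul_comm] at hn1
  have haT : ∀ i ≤ n, a i ∈ Icc t T := fun i hi =>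
    ⟨ha0.symm.le.trans (hamono (Nat.zero_le i)), (hamono hi).trans han.le⟩
  choose v hv hvL hve using fun i => exists_measurable_truncation (hφ (a i)) hL0
  choose d hd hdL hde using fun i => exists_measurable_truncation (hc (a i)) hL0
  set ψ : SimpleIntegrand ℱ := ⟨n, a, hamono, v, hv, ⟨L, hvL⟩⟩ with hψ
  set B₇ := {ω | K ≤ ∑ i ∈ Finset.range n, (W (a (i + 1)) ω - W (a i) ω) ^ 2} with hB₇
  have hP₇ : P B₇ ≤ ENNReal.ofReal (ε / 8) := by
    refine (measure_sum_sq_increment_le hW hamono hK0 n).trans (ENNReal.ofReal_le_ofReal ?_)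
    rw [han, ha0, hK]
    apply le_of_eq
    field_simp
  set B₈ := {ω | ∃ k ≤ n, δ ≤ |quadVariationError W a d k ω|} with hB₈
  have hP₈ : P B₈ ≤ ENNReal.ofReal (ε / 8) := by
    refine (measure_quadVariationError_le hW hamono hd hdL hδ0 n).trans
      (ENNReal.ofReal_le_ofReal ?_)
    simp only [hstep]
    rw [Finset.sum_const, Finset.card_range, nsmul_eq_mul, hhr]
    have : L ^ 2 * gaussianSqVariance * ((n : ℝ) * (((T : ℝ) - t) / n) ^ 2) / δ ^ 2 = A / n := by
      rw [hA]; field_simp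
    rw [this, div_le_iff₀ hn0]
    rw [div_lt_iff₀ hε] at hn2
    linarith
  refine ⟨ψ, B₁ ∪ B₂ ∪ B₃ ∪ B₄ ∪ B₅ ∪ B₆ ∪ B₇ ∪ B₈, ha0.symm.le, ?_, fun ω hω => ?_⟩
  · have h8 : (0 : ℝ) ≤ ε / 8 := by positivity
    have := measure_union_le_ofReal (by positivity) h8 (measure_union_le_ofReal (by positivity) h8
      (measure_union_le_ofReal (by positivity) h8 (measure_union_le_ofReal (by positivity) h8
      (measure_union_le_ofReal (by positivity) h8 (measure_union_le_ofReal (by positivity) h8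
      (measure_union_le_ofReal h8 h8 hB₁ hB₂) hB₃) hB₄) hB₅) hB₆) hP₇) hP₈
    refine this.trans (ENNReal.ofReal_le_ofReal (le_of_eq (by ring)))
  simp only [mem_union, not_or] at hω
  obtain ⟨⟨⟨⟨⟨⟨⟨w₁, w₂⟩, w₃⟩, w₄⟩, w₅⟩, w₆⟩, w₇⟩, w₈⟩ := hω
  have hvφ : ∀ i ≤ n, v i ω = φ (a i) ω := fun i hi =>
    hve i ω ((h₁ ω w₁ _ (haT i hi)).trans (le_max_left _ _))
  have hdc : ∀ i ≤ n, d i ω = c (a i) ω := fun i hi =>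
    hde i ω ((h₂ ω w₂ _ (haT i hi)).trans (le_max_right _ _))
  have hnear : ∀ k, ∀ s, s ≤ a (k + 1) → (s : ℝ) - a k < ρ := fun k s hs => by
    have := hstep k
    have : (s : ℝ) ≤ a (k + 1) := NNReal.coe_le_coe.2 hs
    linarith
  have hh0 : 0 < h := by
    rw [← NNReal.coe_pos, hhr]; positivity
  constructor
  · have hle : ∀ u ∈ Ioc (t : ℝ) T,
        ENNReal.ofReal ((ψ.process u.toNNReal ω - φ u.toNNReal ω) ^ 2) ≤
          ENNReal.ofReal (δ ^ 2) := by
      intro u hu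
      have hu1 : t < u.toNNReal := Real.lt_toNNReal_iff_coe_lt.2 hu.1
      have hu2 : u.toNNReal ≤ T := Real.toNNReal_le_iff_le_coe.2 hu.2
      obtain ⟨k, hk, hk1, hk2⟩ := exists_lt_le_succ (a := a) (ha0.symm ▸ hu1) n (han.symm ▸ hu2)
      rw [ψ.process_of_mem hk hk1 hk2]
      apply ENNReal.ofReal_le_ofReal
      change (v k ω - _) ^ 2 ≤ _
      rw [hvφ k hk.le, sub_sq_comm, ← sq_abs]
      refine pow_le_pow_left₀ (abs_nonneg _) ?_ 2
      exact h₄ ω w₄ _ (haT k hk.le) _ ⟨hu1.le, hu2⟩ hk1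
        ((hnear k _ hk2).trans_le ((min_le_left _ _).trans (min_le_right _ _)))
    rw [← setLIntegral_congr Ioc_ae_eq_Icc]
    calc _ ≤ ∫⁻ _ in Ioc (t : ℝ) T, ENNReal.ofReal (δ ^ 2) :=
          setLIntegral_mono' measurableSet_Ioc hle
      _ = ENNReal.ofReal (δ ^ 2 * ((T : ℝ) - t)) := by
          rw [setLIntegral_const, Real.volume_Ioc, ENNReal.ofReal_mul (by positivity)]
      _ < ENNReal.ofReal ε := by
          rw [ENNReal.ofReal_lt_ofReal_iff hε]
          have h1 : δ ^ 2 ≤ δ := by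
            rw [sq]; exact mul_le_of_le_one_left hδ0.le (min_le_left _ _)
          have h2 : (T : ℝ) - t ≤ Q := by rw [hQ]; linarith
          calc δ ^ 2 * ((T : ℝ) - t) ≤ δ * Q := by gcongr
            _ ≤ ε / 2 := hδQ
            _ < ε := half_lt_self hε
  · intro s hs
    obtain ⟨k, hk, hk1, hk2⟩ : ∃ k < n, a k ≤ s ∧ s ≤ a (k + 1) := by
      rcases hs.1.lt_or_eq with h1 | h1
      · obtain ⟨k, hk, hk1, hk2⟩ := exists_lt_le_succ (a := a) (ha0.symm ▸ h1) n (han.symm ▸ hs.2)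
        exact ⟨k, hk, hk1.le, hk2⟩
      · exact ⟨0, by exact_mod_cast hn0, by rw [ha0, h1], by
          rw [← h1, ← ha0]; exact hamono (Nat.zero_le _)⟩
    have hmod : ∀ {G : ℝ≥0 → Ω → ℝ} {ρ' : ℝ}, ρ ≤ ρ' → (∀ r ∈ Icc t T, ∀ s ∈ Icc t T, r < s →
        (s : ℝ) - r < ρ' → |G s ω - G r ω| ≤ δ) → |G s ω - G (a k) ω| ≤ δ := by
      intro G ρ' hρ' hG
      rcases hk1.lt_or_eq with h1 | h1
      · exact hG _ (haT k hk.le) s hs h1 ((hnear k s hk2).trans_le hρ')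
      · rw [h1, sub_self, abs_zero]; exact hδ0.le
    have hfin := ψ.abs_integral_sub_le (F := F) (c := d) (W := W) (ω := ω) (L := L) (K := K) hδ0.le
      (fun i hi => by
        change |F (a (i + 1)) ω - F (a i) ω - v i ω * _ - _| ≤ _
        have hi' : i < n := hi
        rw [hvφ i hi'.le, hdc i hi'.le]
        refine sub_nonpos.1 (h₃ ω w₃ (a i) (haT i hi'.le) (a (i + 1)) (haT _ hi') ?_ ?_)
        · rw [← NNReal.coe_lt_coe, ← sub_pos, hstep]; exact_mod_cast hh0
        · exact (hnear i _ le_rfl).trans_le ((min_le_left _ _).trans (min_le_left _ _)))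
      (fun j hj => by
        by_contra! hlt
        exact w₈ ⟨j, hj, hlt.le⟩)
      (not_le.1 w₇).le (fun i => hvL i ω) hk hk1 hk2
      (hmod ((min_le_right _ _).trans (min_le_left _ _)) (h₅ ω w₅))
      (hmod ((min_le_right _ _).trans (min_le_right _ _)) (h₆ ω w₆))
    change |ψ.integral W s ω - (F s ω - F (a 0) ω)| ≤
      δ * (K + ((a n : ℝ) - a 0) + L + 2) at hfin
    rw [ha0, han] at hfin
    linarith [half_lt_self hε]

/-- A pathwise expansion without drift identifies `F - F_t` as the Itô integral of `φ`. -/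
theorem HasItoExpansion.isItoIntegral [IsProbabilityMeasure P]
    (hW : IsFiltrationBrownian W ℱ P) {t T : ℝ≥0} (htT : t < T) {φ c F : ℝ≥0 → Ω → ℝ}
    (hφ : ∀ s, Measurable[ℱ s] (φ s)) (hφc : ∀ ω, Continuous fun s => φ s ω)
    (hc : ∀ s, Measurable[ℱ s] (c s)) (hcc : ∀ ω, Continuous fun s => c s ω)
    (hF : ∀ s, Measurable[ℱ s] (F s)) (hFc : ∀ ω, Continuous fun s => F s ω)
    (hexp : HasItoExpansion W t T φ c F) :
    IsItoIntegral W ℱ P t T φ (fun s ω => F s ω - F t ω) := by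
  have hpos : ∀ n : ℕ, (0 : ℝ) < 1 / ((n : ℝ) + 1) := fun n => by positivity
  choose ψ B hψt hB hψ using fun n : ℕ =>
    hexp.exists_simpleIntegrand hW htT hφ hφc hc hcc hF hFc (hpos n)
  have hlim : Tendsto (fun n : ℕ => (1 : ℝ) / ((n : ℝ) + 1)) atTop (𝓝 0) :=
    tendsto_one_div_add_atTop_nhds_zero_nat
  have hlim' : Tendsto (fun n : ℕ => ENNReal.ofReal (1 / ((n : ℝ) + 1))) atTop (𝓝 0) := by
    simpa using ENNReal.tendsto_ofReal hlim
  refine ⟨ψ, hψt, fun ε hε => ?_, fun ε hε => ?_⟩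
  · refine tendsto_of_tendsto_of_tendsto_of_le_of_le' tendsto_const_nhds hlim'
      (Eventually.of_forall fun _ => zero_le) ?_
    filter_upwards [hlim'.eventually (gt_mem_nhds hε)] with n hn
    refine (measure_mono fun ω hω => ?_).trans (hB n)
    by_contra hωB
    exact absurd (hn.le.trans hω) (not_le.2 (hψ n ω hωB).1)
  · refine tendsto_of_tendsto_of_tendsto_of_le_of_le' tendsto_const_nhds hlim'
      (Eventually.of_forall fun _ => zero_le) ?_
    filter_upwards [hlim.eventually (gt_mem_nhds hε)] with n hn
    refine (measure_mono fun ω hω => ?_).trans (hB n)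
    by_contra hωB
    obtain ⟨s, hs, hle⟩ := hω
    linarith [(hψ n ω hωB).2 s hs]

end ItoApproximation

/-! ### Itô's formula along solutions of the heat equation -/

lemma abs_taylor_two_le {f f' f'' : ℝ → ℝ} (hf : ∀ x, HasDerivAt f (f' x) x)
    (hf' : ∀ x, HasDerivAt f' (f'' x) x) {y z ε : ℝ} (h : ∀ x ∈ uIcc y z, |f'' x - f'' y| ≤ ε) :
    |f z - f y - f' y * (z - y) - f'' y / 2 * (z - y) ^ 2| ≤ ε * (z - y) ^ 2 := by
  have hconv : Convex ℝ (uIcc y z) := convex_uIcc y z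
  have hε : 0 ≤ ε := (abs_nonneg _).trans (h y left_mem_uIcc)
  have h1 : ∀ x ∈ uIcc y z, |f' x - f' y - f'' y * (x - y)| ≤ ε * |z - y| := by
    intro x hx
    have := hconv.norm_image_sub_le_of_norm_hasDerivWithin_le
      (f := fun x => f' x - f'' y * (x - y)) (f' := fun x => f'' x - f'' y) (C := ε)
      (fun x _ => (((hf' x).sub (((hasDerivAt_id x).sub_const y).const_mul (f'' y))).congr_deriv
        (by ring)).hasDerivWithinAt) h left_mem_uIcc hx
    simp only [Real.norm_eq_abs, sub_self, mul_zero, sub_zero] at this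
    rw [show f' x - f' y - f'' y * (x - y) = f' x - f'' y * (x - y) - f' y by ring]
    refine this.trans (mul_le_mul_of_nonneg_left ?_ hε)
    exact abs_sub_left_of_mem_uIcc hx
  have := hconv.norm_image_sub_le_of_norm_hasDerivWithin_le
    (f := fun x => f x - f' y * (x - y) - f'' y / 2 * (x - y) ^ 2)
    (f' := fun x => f' x - f' y - f'' y * (x - y)) (C := ε * |z - y|)
    (fun x _ => ((((hf x).sub (((hasDerivAt_id x).sub_const y).const_mul (f' y))).sub
      ((((hasDerivAt_id x).sub_const y).pow 2).const_mul (f'' y / 2))).congr_deriv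
        (by simp; ring)).hasDerivWithinAt) h1 left_mem_uIcc right_mem_uIcc
  simp only [Real.norm_eq_abs, sub_self, mul_zero, sub_zero, ne_eq, OfNat.ofNat_ne_zero,
    not_false_eq_true, zero_pow] at this
  calc _ = |f z - f' y * (z - y) - f'' y / 2 * (z - y) ^ 2 - f y| := by congr 1; ring
    _ ≤ _ := this
    _ = ε * (z - y) ^ 2 := by rw [mul_assoc, ← sq, sq_abs]

/-- One step of Itô's formula: `h0` solves the backward heat equation `∂ₛ h0 = -(l²/2) ∂ᵧᵧ h0`, and
the space variable moves by `l D + l² Δ`. The term `l² A` stands for the drift. -/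
lemma abs_ito_remainder_le {h0 h1 h2 : ℝ → ℝ → ℝ} {l ε L : ℝ}
    (hy : ∀ s y, HasDerivAt (h0 s) (h1 s y) y) (hyy : ∀ s y, HasDerivAt (h1 s) (h2 s y) y)
    {s r y D A : ℝ} (hsr : s < r) (hcont : ∀ y, Continuous fun s => h0 s y)
    (hs : ∀ y, ∀ u ∈ Ioo s r, HasDerivAt (fun u => h0 u y) (-(l ^ 2 / 2 * h2 u y)) u)
    (hD : |D| ≤ ε) (hΔ : r - s ≤ ε) (hΔ1 : r - s ≤ 1) (hL : |h2 s y| ≤ L)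
    (hmod : ∀ u ∈ Icc s r, ∀ z ∈ uIcc y (y + (l * D + l ^ 2 * (r - s))), |h2 u z - h2 s y| ≤ ε)
    (hA : |A - h1 s y * (r - s)| ≤ ε * (r - s)) :
    |h0 r (y + (l * D + l ^ 2 * (r - s))) - h0 s y - l ^ 2 * A - l * h1 s y * D -
        l ^ 2 / 2 * h2 s y * (D ^ 2 - (r - s))| ≤
      ε * (L * (|l| ^ 3 + l ^ 4) + 4 * l ^ 2 + 2 * l ^ 4) * (D ^ 2 + (r - s)) := by
  set Δ := r - s with hΔdef
  have hΔ0 : 0 < Δ := sub_pos.2 hsr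
  have hε : 0 ≤ ε := hΔ0.le.trans hΔ
  have hL0 : 0 ≤ L := (abs_nonneg _).trans hL
  set z := y + (l * D + l ^ 2 * Δ) with hz
  -- the step in time
  have htime : |h0 r z - h0 s z + l ^ 2 / 2 * h2 s y * Δ| ≤ l ^ 2 / 2 * ε * Δ := by
    obtain ⟨u, hu, he⟩ := exists_hasDerivAt_eq_slope (fun u => h0 u z)
      (fun u => -(l ^ 2 / 2 * h2 u z)) hsr (hcont z).continuousOn (hs z)
    rw [eq_div_iff hΔ0.ne'] at he
    rw [← he, show -(l ^ 2 / 2 * h2 u z) * (r - s) + l ^ 2 / 2 * h2 s y * Δ =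
      -(l ^ 2 / 2 * (h2 u z - h2 s y) * Δ) by rw [hΔdef]; ring, abs_neg, abs_mul, abs_mul,
      abs_of_pos hΔ0, abs_of_nonneg (by positivity : (0 : ℝ) ≤ l ^ 2 / 2)]
    gcongr
    exact hmod u ⟨hu.1.le, hu.2.le⟩ z right_mem_uIcc
  -- the step in space
  have hspace := abs_taylor_two_le (hy s) (hyy s) (y := y) (z := z)
    (fun x hx => hmod s ⟨le_rfl, hsr.le⟩ x hx)
  have hzy : z - y = l * D + l ^ 2 * Δ := by rw [hz]; ring
  rw [hzy] at hspace
  have hdelta : (l * D + l ^ 2 * Δ) ^ 2 ≤ 2 * l ^ 2 * D ^ 2 + 2 * l ^ 4 * Δ := by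
    have h1 : Δ ^ 2 ≤ Δ := by rw [sq]; exact mul_le_of_le_one_left hΔ0.le hΔ1
    have h2 : (l * D + l ^ 2 * Δ) ^ 2 ≤ 2 * l ^ 2 * D ^ 2 + 2 * l ^ 4 * Δ ^ 2 := by
      nlinarith [sq_nonneg (l * D - l ^ 2 * Δ)]
    have h3 : 2 * l ^ 4 * Δ ^ 2 ≤ 2 * l ^ 4 * Δ := by gcongr
    linarith
  have hmix : |h2 s y / 2 * (2 * l ^ 3 * D * Δ + l ^ 4 * Δ ^ 2)| ≤
      L * (|l| ^ 3 + l ^ 4) * (ε * Δ) := by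
    have e1 : |2 * l ^ 3 * D * Δ + l ^ 4 * Δ ^ 2| ≤ 2 * |l| ^ 3 * (ε * Δ) + l ^ 4 * (ε * Δ) := by
      refine (abs_add_le _ _).trans (add_le_add ?_ ?_)
      · rw [abs_mul, abs_mul, abs_mul, abs_pow, abs_of_pos hΔ0, abs_two, mul_assoc]
        gcongr
      · rw [abs_of_nonneg (by positivity), sq]
        gcongr
    rw [abs_mul, abs_div, abs_two]
    have hl4 : 0 ≤ l ^ 4 * (ε * Δ) := by positivity
    calc |h2 s y| / 2 * |2 * l ^ 3 * D * Δ + l ^ 4 * Δ ^ 2|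
        ≤ L / 2 * (2 * |l| ^ 3 * (ε * Δ) + l ^ 4 * (ε * Δ)) := by gcongr
      _ ≤ L / 2 * (2 * |l| ^ 3 * (ε * Δ) + 2 * (l ^ 4 * (ε * Δ))) :=
          mul_le_mul_of_nonneg_left (by linarith) (by positivity)
      _ = _ := by ring
  have hdrift : |l ^ 2 * (A - h1 s y * Δ)| ≤ l ^ 2 * (ε * Δ) := by
    rw [abs_mul, abs_of_nonneg (sq_nonneg l)]
    gcongr
  have hid : h0 r z - h0 s y - l ^ 2 * A - l * h1 s y * D - l ^ 2 / 2 * h2 s y * (D ^ 2 - Δ) =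
      (h0 r z - h0 s z + l ^ 2 / 2 * h2 s y * Δ) +
      (h0 s z - h0 s y - h1 s y * (l * D + l ^ 2 * Δ) -
        h2 s y / 2 * (l * D + l ^ 2 * Δ) ^ 2) +
      h2 s y / 2 * (2 * l ^ 3 * D * Δ + l ^ 4 * Δ ^ 2) - l ^ 2 * (A - h1 s y * Δ) := by ring
  have hspace' := hspace.trans (mul_le_mul_of_nonneg_left hdelta hε)
  have hε1 : 0 ≤ ε * L * (|l| ^ 3 + l ^ 4) * D ^ 2 := by positivity
  have hε2 : 0 ≤ ε * l ^ 2 * D ^ 2 := by positivity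
  have hε3 : 0 ≤ ε * l ^ 4 * D ^ 2 := by positivity
  have hε4 : 0 ≤ ε * l ^ 2 * Δ := by positivity
  have htri : ∀ a b c d : ℝ, |a + b + c - d| ≤ |a| + |b| + |c| + |d| := fun a b c d =>
    (abs_sub _ _).trans (add_le_add_left (abs_add_three a b c) _)
  rw [hid]
  refine (htri _ _ _ _).trans ((add_le_add (add_le_add (add_le_add htime hspace') hmix)
    hdrift).trans ?_)
  linarith

section Flow

variable {Ω : Type*} {mΩ : MeasurableSpace Ω} {P : Measure Ω} {ℱ : Filtration ℝ≥0 mΩ}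
  {W : ℝ≥0 → Ω → ℝ}

/-- The process `w + l (W_s - W_t) + l² (s - t)` for `s ≥ t`, which is kept equal to `w` for
`s ≤ t`. -/
def shiftedPath (W : ℝ≥0 → Ω → ℝ) (l w : ℝ) (t s : ℝ≥0) (ω : Ω) : ℝ :=
  w + (l * (W s ω - W (min s t) ω) + l ^ 2 * ((s : ℝ) - (min s t : ℝ≥0)))

lemma shiftedPath_self (l w : ℝ) (t : ℝ≥0) (ω : Ω) : shiftedPath W l w t t ω = w := by
  simp [shiftedPath]

lemma shiftedPath_of_le {l w : ℝ} {t s : ℝ≥0} (h : t ≤ s) (ω : Ω) :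
    shiftedPath W l w t s ω = w + (l * (W s ω - W t ω) + l ^ 2 * ((s : ℝ) - t)) := by
  rw [shiftedPath, min_eq_right h]

lemma continuous_shiftedPath {ω : Ω} (hW : Continuous fun s => W s ω) (l w : ℝ) (t : ℝ≥0) :
    Continuous fun s => shiftedPath W l w t s ω := by
  unfold shiftedPath
  have : Continuous fun s : ℝ≥0 => W (min s t) ω := hW.comp (continuous_id.min continuous_const)
  fun_prop

lemma IsFiltrationBrownian.measurable_shiftedPath (hW : IsFiltrationBrownian W ℱ P) (l w : ℝ)
    (t s : ℝ≥0) : Measurable[ℱ s] (shiftedPath W l w t s) :=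
  ((((hW.measurable_le le_rfl).sub (hW.measurable_le (min_le_left _ _))).const_mul l).add_const
    _).const_add w

/-- Replacing the time `u` by `min u s`, which changes nothing for `u ≤ s`, makes every value of the
integrand `ℱ s`-measurable. -/
lemma measurable_integral_path {G : ℝ≥0 → Ω → ℝ} (hG : ∀ s, Measurable[ℱ s] (G s))
    (hGc : ∀ ω, Continuous fun s => G s ω) {t s : ℝ≥0} (hts : t ≤ s) :
    Measurable[ℱ s] fun ω => ∫ u in (t : ℝ)..s, G u.toNNReal ω := by
  have h1 : (fun ω => ∫ u in (t : ℝ)..s, G u.toNNReal ω) =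
      fun ω => ∫ u in Ioc (t : ℝ) s, G (min u.toNNReal s) ω := by
    ext ω
    rw [intervalIntegral.integral_of_le (NNReal.coe_le_coe.2 hts)]
    refine setIntegral_congr_fun measurableSet_Ioc fun u hu => ?_
    rw [min_eq_left (Real.toNNReal_le_iff_le_coe.2 hu.2)]
  rw [h1]
  have h2 : StronglyMeasurable[Real.measurableSpace.prod (ℱ s)]
      (Function.uncurry fun (u : ℝ) ω => G (min u.toNNReal s) ω) := by
    refine @stronglyMeasurable_uncurry_of_continuous_of_stronglyMeasurable _ _ ℝ _ _ _ _ _ _ _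
      (ℱ s) _ (fun ω => ?_) fun u => ?_
    · exact (hGc ω).comp (continuous_real_toNNReal.min continuous_const)
    · exact ((hG _).mono (ℱ.mono (min_le_right _ _)) le_rfl).stronglyMeasurable
  exact (@StronglyMeasurable.integral_prod_left _ _ _ _ (ℱ s) _ _ _ _ _ h2).measurable

/-- Itô's formula for a solution of the backward heat equation along `shiftedPath`, in pathwise
form. -/
lemma hasItoExpansion_shiftedPath {h0 h1 h2 : ℝ → ℝ → ℝ} {l : ℝ} {t T : ℝ≥0}
    (hW : ∀ ω, Continuous fun s => W s ω)
    (hy : ∀ s y, HasDerivAt (h0 s) (h1 s y) y) (hyy : ∀ s y, HasDerivAt (h1 s) (h2 s y) y)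
    (hc0 : Continuous fun p : ℝ × ℝ => h0 p.1 p.2) (hc1 : Continuous fun p : ℝ × ℝ => h1 p.1 p.2)
    (hc2 : Continuous fun p : ℝ × ℝ => h2 p.1 p.2)
    (hs : ∀ y, ∀ u < (T : ℝ), HasDerivAt (fun u => h0 u y) (-(l ^ 2 / 2 * h2 u y)) u) (w : ℝ) :
    HasItoExpansion W t T (fun s ω => l * h1 s (shiftedPath W l w t s ω))
      (fun s ω => l ^ 2 / 2 * h2 s (shiftedPath W l w t s ω))
      (fun s ω => h0 s (shiftedPath W l w t s ω) -
        l ^ 2 * ∫ u in (t : ℝ)..(max s t : ℝ≥0), h1 u (shiftedPath W l w t u.toNNReal ω)) := by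
  intro ω ε hε
  set e : ℝ≥0 → ℝ := fun s => shiftedPath W l w t s ω with he
  have hec : Continuous e := continuous_shiftedPath (hW ω) l w t
  obtain ⟨A, hA⟩ := isCompact_Icc.exists_bound_of_continuousOn (s := Icc t T) hec.continuousOn
  obtain ⟨L, hL⟩ := isCompact_Icc.exists_bound_of_continuousOn (s := Icc t T)
    (f := fun s : ℝ≥0 => h2 s (e s)) (by fun_prop)
  set C := L * (|l| ^ 3 + l ^ 4) + 4 * l ^ 2 + 2 * l ^ 4 with hC
  set ε₁ := ε / (|C| + 1) with hε₁
  have hε₁0 : 0 < ε₁ := by positivity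
  have hu2 := (isCompact_Icc.prod isCompact_Icc).uniformContinuousOn_of_continuous
    (s := Icc (t : ℝ) T ×ˢ Icc (-A) A) hc2.continuousOn
  rw [Metric.uniformContinuousOn_iff] at hu2
  obtain ⟨δ, hδ, hmod⟩ := hu2 ε₁ hε₁0
  obtain ⟨ρ₁, hρ₁, hm₁⟩ := exists_path_modulus (hW ω) t T hε₁0
  obtain ⟨ρ₂, hρ₂, hm₂⟩ := exists_path_modulus hec t T hδ
  obtain ⟨ρ₃, hρ₃, hm₃⟩ := exists_path_modulus (f := fun s : ℝ≥0 => h1 s (e s)) (by fun_prop)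
    t T hε₁0
  refine ⟨min (min ρ₁ ρ₂) (min (min ρ₃ δ) (min ε₁ 1)), by positivity, fun r hr s hs' hrs hlt => ?_⟩
  simp only [lt_min_iff] at hlt
  obtain ⟨⟨l1, l2⟩, ⟨l3, l4⟩, l5, l6⟩ := hlt
  have hrs' : (r : ℝ) < s := NNReal.coe_lt_coe.2 hrs
  have htr : (t : ℝ) ≤ r := NNReal.coe_le_coe.2 hr.1
  have hsT : (s : ℝ) ≤ T := NNReal.coe_le_coe.2 hs'.2
  have hinc : e s = e r + (l * (W s ω - W r ω) + l ^ 2 * ((s : ℝ) - r)) := by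
    simp only [he]
    rw [shiftedPath_of_le hr.1, shiftedPath_of_le hs'.1]
    ring
  have hcont : Continuous fun u : ℝ => h1 u (e u.toNNReal) := by
    have : Continuous fun u : ℝ => e u.toNNReal := hec.comp continuous_real_toNNReal
    fun_prop
  have hdrift : |(∫ u in (r : ℝ)..s, h1 u (e u.toNNReal)) - h1 r (e r) * ((s : ℝ) - r)| ≤
      ε₁ * ((s : ℝ) - r) := by
    have h1' : (∫ u in (r : ℝ)..s, h1 u (e u.toNNReal)) - h1 r (e r) * ((s : ℝ) - r) =
        ∫ u in (r : ℝ)..s, (h1 u (e u.toNNReal) - h1 r (e r)) := by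
      rw [intervalIntegral.integral_sub (hcont.intervalIntegrable _ _) intervalIntegrable_const,
        intervalIntegral.integral_const, smul_eq_mul, mul_comm (h1 _ _)]
    rw [h1', ← abs_of_pos (sub_pos.2 hrs'), ← Real.norm_eq_abs (∫ _ in _.._, _)]
    refine intervalIntegral.norm_integral_le_of_norm_le_const fun u hu => ?_
    rw [uIoc_of_le hrs'.le] at hu
    have hu0 : 0 ≤ u := r.2.trans hu.1.le
    have hu1 : r ≤ u.toNNReal := (Real.lt_toNNReal_iff_coe_lt.2 hu.1).le
    have hu2 : u.toNNReal ≤ s := Real.toNNReal_le_iff_le_coe.2 hu.2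
    have := hm₃ r hr u.toNNReal ⟨hr.1.trans hu1, hu2.trans hs'.2⟩ hu1 (by
      rw [Real.coe_toNNReal u hu0]; linarith [hu.2])
    rw [Real.coe_toNNReal u hu0] at this
    exact this.le
  have hrA := abs_le.1 (hA r hr)
  have hsA := abs_le.1 (hA s hs')
  have hstep := abs_ito_remainder_le (l := l) (ε := ε₁) (L := L) (D := W s ω - W r ω) (y := e r)
    (A := ∫ u in (r : ℝ)..s, h1 u (e u.toNNReal)) hy hyy hrs'
    (fun y => hc0.comp (Continuous.prodMk_left y))
    (fun y u hu => hs y u (hu.2.trans_le hsT)) (hm₁ r hr s hs' hrs.le l1).le l5.le l6.le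
    (hL r hr)
    (fun u hu z hz => by
      rw [← hinc] at hz
      have hzA : z ∈ Icc (-A) A := uIcc_subset_Icc ⟨hrA.1, hrA.2⟩ ⟨hsA.1, hsA.2⟩ hz
      have := hmod (u, z) ⟨⟨htr.trans hu.1, hu.2.trans hsT⟩, hzA⟩ (r, e r)
        ⟨⟨htr, hrs'.le.trans hsT⟩, hrA.1, hrA.2⟩ (by
          rw [Prod.dist_eq, max_lt_iff, Real.dist_eq, Real.dist_eq]
          refine ⟨?_, ?_⟩
          · rw [abs_of_nonneg (by simpa using hu.1)]
            exact lt_of_le_of_lt (by simpa using hu.2) l4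
          · exact (abs_sub_left_of_mem_uIcc hz).trans_lt (hm₂ r hr s hs' hrs.le l2))
      rw [Real.dist_eq] at this
      exact this.le)
    hdrift
  rw [← hinc] at hstep
  have hsplit : (∫ u in (t : ℝ)..s, h1 u (e u.toNNReal)) =
      (∫ u in (t : ℝ)..r, h1 u (e u.toNNReal)) + ∫ u in (r : ℝ)..s, h1 u (e u.toNNReal) :=
    (intervalIntegral.integral_add_adjacent_intervals (hcont.intervalIntegrable _ _)
      (hcont.intervalIntegrable _ _)).symm
  change |(h0 s (e s) - l ^ 2 * ∫ u in (t : ℝ)..(max s t : ℝ≥0), h1 u (e u.toNNReal)) -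
      (h0 r (e r) - l ^ 2 * ∫ u in (t : ℝ)..(max r t : ℝ≥0), h1 u (e u.toNNReal)) -
      l * h1 r (e r) * (W s ω - W r ω) -
      l ^ 2 / 2 * h2 r (e r) * ((W s ω - W r ω) ^ 2 - ((s : ℝ) - r))| ≤ _
  rw [max_eq_left hr.1, max_eq_left hs'.1]
  have hrw : h0 s (e s) - l ^ 2 * (∫ u in (t : ℝ)..s, h1 u (e u.toNNReal)) -
      (h0 r (e r) - l ^ 2 * ∫ u in (t : ℝ)..r, h1 u (e u.toNNReal)) -
      l * h1 r (e r) * (W s ω - W r ω) -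
      l ^ 2 / 2 * h2 r (e r) * ((W s ω - W r ω) ^ 2 - ((s : ℝ) - r)) =
      h0 s (e s) - h0 r (e r) - l ^ 2 * (∫ u in (r : ℝ)..s, h1 u (e u.toNNReal)) -
      l * h1 r (e r) * (W s ω - W r ω) -
      l ^ 2 / 2 * h2 r (e r) * ((W s ω - W r ω) ^ 2 - ((s : ℝ) - r)) := by
    rw [hsplit]; ring
  rw [hrw]
  refine hstep.trans ?_
  have hpos : 0 ≤ (W s ω - W r ω) ^ 2 + ((s : ℝ) - r) :=
    add_nonneg (sq_nonneg _) (sub_pos.2 hrs').le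
  refine mul_le_mul_of_nonneg_right ?_ hpos
  calc ε₁ * C ≤ ε₁ * (|C| + 1) := by
        gcongr; linarith [le_abs_self C]
    _ = ε := by rw [hε₁]; field_simp

end Flow

/-! ### The optimal strategy -/

section OptimalStrategy

variable {Ω : Type*} {mΩ : MeasurableSpace Ω} {P : Measure Ω} {ℱ : Filtration ℝ≥0 mΩ}
  {W : ℝ≥0 → Ω → ℝ} {U : ℝ → ℝ} {g : ℕ → ℝ → ℝ}

/-- The heat flow run backwards from time `T` solves the backward heat equation. -/
lemma IsWealthCurve.hasDerivAt_heat_time (hg : IsWealthCurve U g) (l y : ℝ) {T u : ℝ} (hu : u < T) :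
    HasDerivAt (fun u => heat (g 0) (l * √(T - u)) y)
      (-(l ^ 2 / 2 * heat (g 2) (l * √(T - u)) y)) u := by
  have h1 := hasDerivAt_heat_param (hg.expBounded 0 (by norm_num)) (hg.expBounded 1 (by norm_num))
    (hg.expBounded 2 (by norm_num)) (hg.hasDerivAt 0 (by norm_num)) (hg.hasDerivAt 1 (by norm_num))
    (hg.continuous 2 (by norm_num)) (l * √(T - u)) y
  have h2 : HasDerivAt (fun u => l * √(T - u)) (l * (-1 / (2 * √(T - u)))) u :=
    (((hasDerivAt_id u).const_sub T).sqrt (sub_pos.2 hu).ne').const_mul l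
  have hne : √(T - u) ≠ 0 := (Real.sqrt_pos.2 (sub_pos.2 hu)).ne'
  refine (h1.comp u h2).congr_deriv ?_
  field_simp

/-- The optimal strategy: wealth is the heat flow of the wealth curve along `shiftedPath`, and the
terminal wealth is the wealth curve at the terminal value of `shiftedPath`. -/
lemma IsWealthCurve.exists_isAdmissibleStrategy [IsProbabilityMeasure P] (hg : IsWealthCurve U g)
    (hW : IsFiltrationBrownian W ℱ P) {t T : ℝ≥0} (htT : t < T) {m σ : ℝ} (hσ : σ ≠ 0) (w : ℝ) :
    ∃ π X : ℝ≥0 → Ω → ℝ,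
      IsAdmissibleStrategy W ℱ P T m σ t (heat (g 0) (m / σ * √((T : ℝ) - t)) w) π X ∧
      ∀ ω, X T ω = g 0 (shiftedPath W (m / σ) w t T ω) := by
  set l := m / σ with hl
  have hm : m = l * σ := by rw [hl]; field_simp
  set h : ℕ → ℝ → ℝ → ℝ := fun k s y => heat (g k) (l * √((T : ℝ) - s)) y with hh
  have hcont : ∀ k ≤ 6, Continuous fun p : ℝ × ℝ => h k p.1 p.2 := fun k hk => by
    have := _root_.continuous_heat (hg.expBounded k hk) (hg.continuous k hk)
    exact this.comp (f := fun p : ℝ × ℝ => (l * √((T : ℝ) - p.1), p.2)) (by fun_prop)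
  set η := shiftedPath W l w t with hη
  have hηc : ∀ ω, Continuous fun s => η s ω := fun ω =>
    continuous_shiftedPath (hW.continuous_paths ω) l w t
  have hHc : ∀ k ≤ 6, ∀ ω, Continuous fun s : ℝ≥0 => h k s (η s ω) := fun k hk ω => by
    have := hcont k hk
    have := hηc ω
    fun_prop
  have hHm : ∀ k ≤ 6, ∀ s : ℝ≥0, Measurable[ℱ s] fun ω => h k s (η s ω) := fun k hk s =>
    ((hcont k hk).comp (Continuous.prodMk_right (s : ℝ))).measurable.comp
      (hW.measurable_shiftedPath l w t s)
  have hIc : ∀ ω, Continuous fun u : ℝ => h 1 u (η u.toNNReal ω) := fun ω => by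
    have h1 : Continuous fun u : ℝ => η u.toNNReal ω := (hηc ω).comp continuous_real_toNNReal
    have h2 := hcont 1 (by norm_num)
    fun_prop
  -- the drift of the wealth divided by `l²`; the maximum keeps `I s` adapted for `s ≤ t`
  set I : ℝ≥0 → Ω → ℝ := fun s ω => ∫ u in (t : ℝ)..(max s t : ℝ≥0), h 1 u (η u.toNNReal ω) with hI
  have hIcont : ∀ ω, Continuous fun s => I s ω := fun ω => by
    have h1 := intervalIntegral.continuous_primitive
      (fun a b => (hIc ω).intervalIntegrable (μ := volume) a b) (t : ℝ)
    exact h1.comp (NNReal.continuous_coe.comp (continuous_id.max continuous_const))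
  have hcongr : ∀ s ω, t ≤ s → (∫ u in (t : ℝ)..s, h 1 u (η u.toNNReal ω)) =
      ∫ u in (t : ℝ)..s, h 1 (u.toNNReal : ℝ≥0) (η u.toNNReal ω) := fun s ω hts => by
    refine intervalIntegral.integral_congr fun u hu => ?_
    rw [uIcc_of_le (NNReal.coe_le_coe.2 hts)] at hu
    rw [Real.coe_toNNReal u (t.2.trans hu.1)]
  have hImeas : ∀ s, Measurable[ℱ s] (I s) := fun s => by
    rcases le_total s t with hst | hst
    · simp only [hI, max_eq_right hst, intervalIntegral.integral_same]
      exact measurable_const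
    · simp only [hI, max_eq_left hst]
      simp only [hcongr s _ hst]
      exact measurable_integral_path (G := fun s ω => h 1 s (η s ω)) (hHm 1 (by norm_num))
        (hHc 1 (by norm_num)) hst
  have hexp : HasItoExpansion W t T (fun s ω => l * h 1 s (η s ω))
      (fun s ω => l ^ 2 / 2 * h 2 s (η s ω)) (fun s ω => h 0 s (η s ω) - l ^ 2 * I s ω) :=
    hasItoExpansion_shiftedPath hW.continuous_paths
      (fun s y => hg.hasDerivAt_heat (by norm_num) _ y)
      (fun s y => hg.hasDerivAt_heat (by norm_num) _ y) (hcont 0 (by norm_num))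
      (hcont 1 (by norm_num)) (hcont 2 (by norm_num))
      (fun y u hu => hg.hasDerivAt_heat_time l y hu) w
  have hito : IsItoIntegral W ℱ P t T (fun s ω => l * h 1 s (η s ω)) (fun s ω =>
      (h 0 s (η s ω) - l ^ 2 * I s ω) - (h 0 t (η t ω) - l ^ 2 * I t ω)) :=
    hexp.isItoIntegral hW htT (fun s => (hHm 1 (by norm_num) s).const_mul l)
    (fun ω => (hHc 1 (by norm_num) ω).const_mul l)
    (fun s => (hHm 2 (by norm_num) s).const_mul (l ^ 2 / 2))
    (fun ω => (hHc 2 (by norm_num) ω).const_mul (l ^ 2 / 2))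
    (fun s => (hHm 0 (by norm_num) s).sub ((hImeas s).const_mul (l ^ 2)))
    (fun ω => (hHc 0 (by norm_num) ω).sub ((hIcont ω).const_mul (l ^ 2)))
  have hπc : ∀ ω, Continuous fun s : ℝ≥0 => l * h 1 s (η s ω) / σ := fun ω =>
    ((hHc 1 (by norm_num) ω).const_mul l).div_const σ
  refine ⟨fun s ω => l * h 1 s (η s ω) / σ, fun s ω => h 0 s (η s ω), ⟨?_, ?_, ?_, ?_⟩, ?_⟩
  · refine StronglyAdapted.isStronglyProgressive_of_continuous (fun s => ?_) hπc
    exact (((hHm 1 (by norm_num) s).const_mul l).div_const σ).stronglyMeasurable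
  · exact ae_of_all _ fun ω => ((((hπc ω).comp continuous_real_toNNReal).pow 2).integrableOn_Icc)
  · refine ⟨_, (?_ : IsItoIntegral W ℱ P t T _ (fun s ω =>
      (h 0 s (η s ω) - l ^ 2 * I s ω) - (h 0 t (η t ω) - l ^ 2 * I t ω))),
      ae_of_all _ fun ω s hs => ?_⟩
    · convert hito using 3
      field_simp
    · have hlin : (∫ u in (t : ℝ)..s, l * h 1 (u.toNNReal : ℝ≥0) (η u.toNNReal ω) / σ * m) =
          l ^ 2 * I s ω := by
        simp only [hI, max_eq_left hs.1]
        rw [hcongr s ω hs.1, ← intervalIntegral.integral_const_mul]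
        refine intervalIntegral.integral_congr fun u _ => ?_
        rw [hm]
        field_simp
      rw [hlin]
      have h0 : I t ω = 0 := by simp [hI]
      have hηt : η t ω = w := shiftedPath_self l w t ω
      simp only [h0, hηt, hh]
      ring
  · exact ae_of_all _ fun ω s _ => (hg.heat_pos _ _).le
  · -- at time `T` the averaging has variance zero
    intro ω
    simp [hh, heat]

end OptimalStrategy

/-! ### The Merton value function -/

section Value

variable {Ω : Type*} {mΩ : MeasurableSpace Ω} {P : Measure Ω} {ℱ : Filtration ℝ≥0 mΩ}
  {W : ℝ≥0 → Ω → ℝ} {U : ℝ → ℝ} {g : ℕ → ℝ → ℝ}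

/-- The terminal value of `shiftedPath` is Gaussian with variance `q² = l² (T - t)` and mean
`w + q²`. -/
lemma IsFiltrationBrownian.lintegral_shiftedPath (hW : IsFiltrationBrownian W ℱ P) {l : ℝ}
    {t T : ℝ≥0} (htT : t ≤ T) (w : ℝ) {f : ℝ → ℝ} (hf : ExpBounded f) (hc : Continuous f)
    (h0 : ∀ y, 0 ≤ f y) :
    ∫⁻ ω, ENNReal.ofReal (f (shiftedPath W l w t T ω)) ∂P =
      ENNReal.ofReal (heat f (l * √((T : ℝ) - t)) (w + (l * √((T : ℝ) - t)) ^ 2)) := by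
  have hsq : (l * √((T : ℝ) - t)) ^ 2 = l ^ 2 * ((T : ℝ) - t) := by
    rw [mul_pow, Real.sq_sqrt (sub_nonneg.2 (NNReal.coe_le_coe.2 htT))]
  set F : ℝ → ℝ := fun D => f (w + (l * D + l ^ 2 * ((T : ℝ) - t))) with hF
  have hFm : Measurable F := by
    have := hc.measurable
    fun_prop
  have hFe : ∀ n, F (√((T : ℝ) - t) * n) =
      f (w + (l * √((T : ℝ) - t)) ^ 2 + l * √((T : ℝ) - t) * n) := fun n => by
    simp only [hF]
    rw [hsq]
    congr 1
    ring
  have hi : Integrable (fun n => F (√((T : ℝ) - t) * n)) (gaussianReal 0 1) := by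
    simp only [hFe]
    exact hf.integrable hc _ _
  have hint := hW.integrable_increment htT hFm hi
  have hval := hW.integral_increment htT hFm
  simp only [hFe] at hval
  simp only [shiftedPath_of_le htT]
  rw [← ofReal_integral_eq_lintegral_ofReal hint (ae_of_all _ fun ω => h0 _), hval]
  rfl

lemma IsWealthCurve.continuous_utility (hg : IsWealthCurve U g) : Continuous fun w => U (g 0 w) :=
  continuous_iff_continuousAt.2 fun w => (hg.utility_hasDerivAt w).continuousAt

/-- Duality bound: Fenchel's inequality at the marginal utility `e^{-η}`, a multiple of the state
price density, combined with the budget constraint. -/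
lemma IsWealthCurve.lintegral_utility_le [IsProbabilityMeasure P] (hg : IsWealthCurve U g)
    (hW : IsFiltrationBrownian W ℱ P) {t T : ℝ≥0} (htT : t ≤ T) {m σ : ℝ} (hσ : σ ≠ 0) (w : ℝ)
    {π X : ℝ≥0 → Ω → ℝ}
    (h : IsAdmissibleStrategy W ℱ P T m σ t (heat (g 0) (m / σ * √((T : ℝ) - t)) w) π X) :
    ∫⁻ ω, ENNReal.ofReal (U (X T ω)) ∂P ≤ ENNReal.ofReal
      (heat (fun w => U (g 0 w)) (m / σ * √((T : ℝ) - t))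
        (w + (m / σ * √((T : ℝ) - t)) ^ 2)) := by
  set l := m / σ with hl
  set q := l * √((T : ℝ) - t) with hq
  set x := heat (g 0) q w with hx
  set η := shiftedPath W l w t T with hη
  set y := Real.exp (-w - q ^ 2 / 2) with hy
  have hsq : q ^ 2 = l ^ 2 * ((T : ℝ) - t) := by
    rw [hq, mul_pow, Real.sq_sqrt (sub_nonneg.2 (NNReal.coe_le_coe.2 htT))]
  have hx0 : 0 < x := hg.heat_pos q w
  have hy0 : 0 < y := Real.exp_pos _
  have hdens : ∀ ω, Real.exp (-η ω) = y * stateDensity W l t T ω := fun ω => by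
    rw [hη, shiftedPath_of_le htT, stateDensity, hy, ← Real.exp_add, hsq]
    congr 1
    ring
  have hηm : Measurable η := (hW.measurable_shiftedPath l w t T).mono (ℱ.le T) le_rfl
  have hg0 : Continuous (g 0) := hg.continuous 0 (by norm_num)
  have hexpc : Continuous fun w => Real.exp (-w) * g 0 w := by fun_prop
  have hcost : ∫⁻ ω, ENNReal.ofReal (Real.exp (-η ω) * g 0 (η ω)) ∂P = ENNReal.ofReal (y * x) := by
    rw [hη, hW.lintegral_shiftedPath htT w (hg.expBounded 0 (by norm_num)).exp_neg_mul hexpc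
      (fun v => (mul_pos (Real.exp_pos _) (hg.pos v)).le), heat_exp_neg_mul, ← hq,
      add_sub_cancel_right, hy, hx]
    congr 3
    ring
  have hgain : ∫⁻ ω, ENNReal.ofReal (U (g 0 (η ω))) ∂P = _ :=
    hW.lintegral_shiftedPath (l := l) htT w hg.utility_expBounded hg.continuous_utility
    (fun v => hg.utility_nonneg _ (hg.pos v).le)
  have hbudget : ∫⁻ ω, ENNReal.ofReal (Real.exp (-η ω) * X T ω) ∂P ≤ ENNReal.ofReal (y * x) := by
    have h1 : ∀ ω, ENNReal.ofReal (Real.exp (-η ω) * X T ω) =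
        ENNReal.ofReal y * ENNReal.ofReal (stateDensity W l t T ω * X T ω) := fun ω => by
      rw [hdens, mul_assoc, ENNReal.ofReal_mul hy0.le]
    simp only [h1]
    rw [lintegral_const_mul' _ _ ENNReal.ofReal_ne_top, ENNReal.ofReal_mul hy0.le]
    gcongr
    exact h.lintegral_stateDensity_le hW htT hσ hx0.le
  have hpt : ∀ᵐ ω ∂P, ENNReal.ofReal (Real.exp (-η ω) * g 0 (η ω)) + ENNReal.ofReal (U (X T ω)) ≤
      ENNReal.ofReal (U (g 0 (η ω))) + ENNReal.ofReal (Real.exp (-η ω) * X T ω) := by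
    filter_upwards [h.nonneg] with ω hω
    have hX0 : 0 ≤ X T ω := hω T ⟨htT, le_rfl⟩
    have hfen := hg.utility_le (η ω) (X T ω) hX0
    have h2 := (mul_pos (Real.exp_pos (-η ω)) (hg.pos (η ω))).le
    rw [← ENNReal.ofReal_add h2 (hg.utility_nonneg _ hX0),
      ← ENNReal.ofReal_add (hg.utility_nonneg _ (hg.pos _).le)
        (mul_nonneg (Real.exp_pos _).le hX0)]
    exact ENNReal.ofReal_le_ofReal (by linarith)
  have hmono := lintegral_mono_ae hpt
  have hm1 : Measurable fun ω => Real.exp (-η ω) * g 0 (η ω) := hexpc.measurable.comp hηm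
  have hm2 : Measurable fun ω => U (g 0 (η ω)) := hg.continuous_utility.measurable.comp hηm
  rw [lintegral_add_left hm1.ennreal_ofReal, lintegral_add_left hm2.ennreal_ofReal, hcost, hgain,
    add_comm] at hmono
  exact (ENNReal.add_le_add_iff_right ENNReal.ofReal_ne_top).1
    (hmono.trans (add_le_add_right hbudget _))

/-- The Merton value function along the heat flow of the wealth curve. -/
lemma IsWealthCurve.mertonValue_eq [IsProbabilityMeasure P] (hg : IsWealthCurve U g)
    (hW : IsFiltrationBrownian W ℱ P) {t T : ℝ≥0} (htT : t < T) {m σ : ℝ} (hσ : σ ≠ 0) (w : ℝ) :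
    mertonValue W ℱ P U T m σ t (heat (g 0) (m / σ * √((T : ℝ) - t)) w) =
      heat (fun w => U (g 0 w)) (m / σ * √((T : ℝ) - t))
        (w + (m / σ * √((T : ℝ) - t)) ^ 2) := by
  have hpos := heat_nonneg (fun v => hg.utility_nonneg _ (hg.pos v).le)
    (m / σ * √((T : ℝ) - t)) (w + (m / σ * √((T : ℝ) - t)) ^ 2)
  rw [mertonValue, ← ENNReal.toReal_ofReal hpos]
  congr 1
  apply le_antisymm
  · exact iSup_le fun π => iSup_le fun X => iSup_le fun h =>
      hg.lintegral_utility_le hW htT.le hσ w h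
  · obtain ⟨π, X, h, hX⟩ := hg.exists_isAdmissibleStrategy hW htT (m := m) hσ w
    refine le_trans (le_of_eq ?_) (le_iSup_of_le π (le_iSup_of_le X (le_iSup_of_le h le_rfl)))
    simp only [hX]
    exact (hW.lintegral_shiftedPath htT.le w hg.utility_expBounded hg.continuous_utility
      (fun v => hg.utility_nonneg _ (hg.pos v).le)).symm

end Value

theorem proposition3p5 {Ω : Type*} {mΩ : MeasurableSpace Ω} (P : Measure Ω)
    [IsProbabilityMeasure P] (ℱ : Filtration ℝ≥0 mΩ) (W : ℝ≥0 → Ω → ℝ)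
    (hW : IsFiltrationBrownian W ℱ P)
    (U : ℝ → ℝ) (hU : IsAdmissibleUtility U)
    (T : ℝ≥0) (hT : 0 < T)
    (μ σ : ℝ → ℝ) (hσ : ∀ z, 0 < σ z) :
    let M : ℝ≥0 → ℝ → ℝ → ℝ := fun t x z => mertonValue W ℱ P U T (μ z) (σ z) t x
    let R : ℝ≥0 → ℝ → ℝ → ℝ := fun t x z => mertonRiskTolerance W ℱ P U T (μ z) (σ z) t x
    -- `R` and its derivatives are well defined
    (∀ t < T, ∀ z : ℝ,
      ContDiffOn ℝ 2 (fun x => M t x z) (Ioi 0) ∧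
      (∀ x : ℝ, 0 < x → iteratedDeriv 2 (fun y => M t y z) x < 0) ∧
      ContDiffOn ℝ 5 (fun x => R t x z) (Ioi 0)) ∧
    (∃ K : ℕ → ℝ,
      (∀ j ≤ 4, 0 < K j ∧ ∀ t < T, ∀ x : ℝ, 0 < x → ∀ z : ℝ,
        |R t x z ^ j * iteratedDeriv (j + 1) (fun y => R t y z) x| ≤ K j) ∧
      (∀ t < T, ∀ x : ℝ, 0 < x → ∀ z : ℝ, R t x z ≤ K 0 * x)) ∧
    (∃ K' : ℕ → ℝ, ∀ j : ℕ, 1 ≤ j → j ≤ 5 → 0 < K' j ∧ ∀ t < T, ∀ x : ℝ, 0 < x → ∀ z : ℝ,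
        |iteratedDeriv j (fun y => R t y z ^ j) x| ≤ K' j) := by
  intro M R
  obtain ⟨g, hg⟩ := hU.exists_isWealthCurve
  set q : {t : ℝ≥0 // t < T} × ℝ → ℝ := fun i => μ i.2 / σ i.2 * √((T : ℝ) - (i.1 : ℝ≥0)) with hq
  set V : {t : ℝ≥0 // t < T} × ℝ → ℝ → ℝ :=
    fun i => mertonValue W ℱ P U T (μ i.2) (σ i.2) i.1 with hV
  have hVw : ∀ i w, V i (heat (g 0) (q i) w) = heat (fun w => U (g 0 w)) (q i) (w + q i ^ 2) :=
    fun i w => hg.mertonValue_eq hW i.1.2 (hσ i.2).ne' w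
  have hreg := fun i => hg.value_regularity (hVw i)
  obtain ⟨hbound, C, hC⟩ := hg.uniform_bounds hVw
  have hpow := fun j (h1 : 1 ≤ j) (h5 : j ≤ 5) => uniformlyBounded_powPoly hbound h1 h5
  refine ⟨fun t ht z => ?_, ?_, ?_⟩
  · obtain ⟨h1, h2, h3, -⟩ := hreg (⟨t, ht⟩, z)
    exact ⟨h1, h2, h3⟩
  · choose! K hK using hbound
    -- `K 0` must dominate both `|R_x|` and `R / x`
    refine ⟨fun j => |K j| + |C| + 1, fun j hj => ⟨by positivity, fun t ht x hx z => ?_⟩,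
      fun t ht x hx z => ?_⟩
    · have : |R t x z ^ j * iteratedDeriv (j + 1) (fun y => R t y z) x| ≤ K j :=
        hK j hj ((⟨t, ht⟩, z), ⟨x, hx⟩)
      linarith [le_abs_self (K j), abs_nonneg C]
    · have : R t x z ≤ C * x := hC (⟨t, ht⟩, z) x hx
      refine this.trans (mul_le_mul_of_nonneg_right ?_ hx.le)
      linarith [le_abs_self C, abs_nonneg (K 0)]
  · choose! K hK using hpow
    refine ⟨fun j => |K j| + 1, fun j h1 h5 => ⟨by positivity, fun t ht x hx z => ?_⟩⟩
    have : iteratedDeriv j (fun y => R t y z ^ j) x = _ :=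
      iteratedDeriv_pow_eq (hreg (⟨t, ht⟩, z)).2.2.1 h1 h5 hx
    rw [this]
    exact (hK j h1 h5 ((⟨t, ht⟩, z), ⟨x, hx⟩)).trans (by linarith [le_abs_self (K j)])
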